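/- Let $A_0,A_1,A_2,A_3$ be real symmetric $4\times4$ matrices, $A(x)=\sum_i x_iA_i$, $f=\det A(x)$, let $X=V(f)\subset\mathbb{CP}^3$ be the symmetroid and $$S=\{x\in\mathbb{RP}^3 : A(x)\text{ is positive or negative semidefinite}\}$$ the spectrahedron. Assume that $S$ is full-dimensional (has non-empty interior) and that $X$ is transversal: all singular points of $X$ are nodes (nondegenerate quadratic singularities), and $A$ has rank $2$ at each of them. Let $p\in\mathbb{RP}^3$ be a real rank-$2$ node of $X$ such that no (complex) line through $p$ lies on $X$. Let $\pi_p$ denote the projection $\mathbb{RP}^3\dashrightarrow\mathbb{RP}^2$ from $p$, extended to the blow-up of $\mathbb{RP}^3$ at $p$; the image of $S$ means the image of its strict transform, the closure of $S\setminus\{p\}$ in the blow-up. In coordinates with $p=(1:0:0:0)$ write $f=ax_0^2+bx_0+c$ with $a,b,c\in\mathbb R[x_1,x_2,x_3]$; the tangent cone of $X$ at $p$ is $V(a)$, its image is the real conic $C_p\subset\mathbb{RP}^2$, and the ramification sextic is $V(b^2-4ac)$. The convex hull of $C_p$ is taken in an affine chart of $\mathbb{RP}^2$ containing $C_p$. A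 point of $\mathbb{RP}^3$ is inside the tangent cone if it is $p$ or if its image lies in the (closed) convex hull of $C_p$, and outside otherwise. "Node" below means real node of $X$. An oval of a smooth real plane cubic is a connected component of its real points that is contractible in $\mathbb{RP}^2$. Then every point of $S$ lies inside the tangent cone of $X$ at $p$. Furthermore: (a) If $p\in S$, then the image of $S$ in $\mathbb{RP}^2$ is the convex hull of $C_p$. Every node other than $p$ in $\partial S$ is inside the cone, and every node not in $S$ is outside the cone. (b) If $p\notin S$, then the ramification sextic is the union of two smooth real cubics $R_1,R_2$, each of which has an oval, and the image of $S$ is the intersection of the two convex regions bounded by these ovals (the convex hulls of the ovals in affine charts). Both regions are contained in the convex hull of $C_p$, and the image of $S$ is contained in the interior of the convex hull of $C_p$. Every node in $\partial S$ is mapped to the boundary of the image of $S$. Every node other than $p$ that is not in $S$ is mapped to a point outside the convex hull of $C_p$. -/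

import Mathlib

noncomputable section

namespace QSpec

/-- Real projective `n`-space, as the space of lines in `ℝ^(n+1)`. -/
abbrev RP (n : ℕ) : Type := Projectivization ℝ (Fin (n + 1) → ℝ)

/-- The quotient topology on real projective space. -/
instance instTopologicalSpaceRP (n : ℕ) : TopologicalSpace (RP n) :=
  TopologicalSpace.coinduced
    (fun v : {v : Fin (n + 1) → ℝ // v ≠ 0} => Projectivization.mk' ℝ v) inferInstance

/-! ### Symmetroids and spectrahedra -/

/-- The matrix `A(x) = x₀ A₀ + x₁ A₁ + x₂ A₂ + x₃ A₃`. -/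
def linMat {K : Type*} [Field K] (A : Fin 4 → Matrix (Fin 4) (Fin 4) K) (x : Fin 4 → K) :
    Matrix (Fin 4) (Fin 4) K :=
  ∑ i, x i • A i

/-- The quartic form `f = det A(x)` in the variables `x₀, x₁, x₂, x₃`. -/
def detForm {K : Type*} [Field K] (A : Fin 4 → Matrix (Fin 4) (Fin 4) K) :
    MvPolynomial (Fin 4) K :=
  (∑ i, (MvPolynomial.X i : MvPolynomial (Fin 4) K) • (A i).map MvPolynomial.C).det

/-- The same matrices, with their entries regarded as complex numbers. -/
def complexify (A : Fin 4 → Matrix (Fin 4) (Fin 4) ℝ) : Fin 4 → Matrix (Fin 4) (Fin 4) ℂ :=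
  fun i => (A i).map (algebraMap ℝ ℂ)

/-- Homogeneous coordinates of a real point, regarded as complex numbers. -/
def complexPoint {n : ℕ} (x : RP n) : Fin (n + 1) → ℂ := fun i => (x.rep i : ℂ)

/-- The spectrahedron: the real points `x` for which `A(x)` is (positive or negative)
semidefinite. -/
def spectrahedron (A : Fin 4 → Matrix (Fin 4) (Fin 4) ℝ) : Set (RP 3) :=
  {x | (linMat A x.rep).PosSemidef ∨ (-(linMat A x.rep)).PosSemidef}

/-- `z` (homogeneous coordinates) is a singular point of the hypersurface `V(f)`. -/
def IsSingularAt {n : ℕ} {K : Type*} [Field K] (f : MvPolynomial (Fin n) K) (z : Fin n → K) :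
    Prop :=
  MvPolynomial.eval z f = 0 ∧ ∀ i, MvPolynomial.eval z (MvPolynomial.pderiv i f) = 0

/-- The Hessian matrix of the form `f` at `z`. -/
def hessian {n : ℕ} {K : Type*} [Field K] (f : MvPolynomial (Fin n) K) (z : Fin n → K) :
    Matrix (Fin n) (Fin n) K :=
  Matrix.of fun i j => MvPolynomial.eval z (MvPolynomial.pderiv i (MvPolynomial.pderiv j f))

/-- `z` is a node (nondegenerate quadratic singularity) of the surface `V(f)` in projective
3-space.  By Euler's relation `z` lies in the kernel of the Hessian of the homogeneous equation at
a singular point, so the quadratic part of a local equation is nondegenerate exactly when this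
`4 × 4` matrix has rank 3. -/
def IsNodeAt {K : Type*} [Field K] (f : MvPolynomial (Fin 4) K) (z : Fin 4 → K) : Prop :=
  IsSingularAt f z ∧ (hessian f z).rank = 3

/-- The complex surface `V(f)` is nodal: all its singular points are nodes. -/
def IsNodal (f : MvPolynomial (Fin 4) ℂ) : Prop :=
  ∀ z : Fin 4 → ℂ, z ≠ 0 → IsSingularAt f z → IsNodeAt f z

/-- The symmetroid of `A` is transversal: it is nodal, and it has no further nodes besides the
points where `A(z)` has rank 2. -/
def IsTransversal (A : Fin 4 → Matrix (Fin 4) (Fin 4) ℝ) : Prop :=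
  IsNodal (detForm (complexify A)) ∧
    ∀ z : Fin 4 → ℂ, z ≠ 0 → IsNodeAt (detForm (complexify A)) z →
      (linMat (complexify A) z).rank = 2

/-- The real point `x` is a node of the complex symmetroid of `A`. -/
def IsRealNode (A : Fin 4 → Matrix (Fin 4) (Fin 4) ℝ) (x : RP 3) : Prop :=
  IsNodeAt (detForm (complexify A)) (complexPoint x)

/-- No complex line through the real point `p` is contained in the complex symmetroid of `A`. -/
def NoLineThrough (A : Fin 4 → Matrix (Fin 4) (Fin 4) ℝ) (p : RP 3) : Prop :=
  ∀ z : Fin 4 → ℂ, LinearIndependent ℂ ![complexPoint p, z] →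
    ∃ s t : ℂ, MvPolynomial.eval (s • complexPoint p + t • z) (detForm (complexify A)) ≠ 0

/-! ### Projection from a node

A projection with centre `p` is given by a linear map `L : ℝ⁴ → ℝ³` whose kernel is the line `p`. -/

/-- The polynomial `f(v + T p)` in one variable `T`.  If `p` is a double point of the quartic `f`,
it has the form `a(v) T² + b(v) T + c(v)`; for `p = (1 : 0 : 0 : 0)` and `v = (0, x₁, x₂, x₃)` this
is the expansion `f = a x₀² + b x₀ + c` with `T = x₀`. -/
def alongLine (f : MvPolynomial (Fin 4) ℝ) (p v : Fin 4 → ℝ) : Polynomial ℝ :=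
  MvPolynomial.aeval (fun i => Polynomial.C (v i) + Polynomial.X * Polynomial.C (p i)) f

/-- The quadratic form `a` whose zero set is the tangent cone of the symmetroid at `p`. -/
def coneForm (A : Fin 4 → Matrix (Fin 4) (Fin 4) ℝ) (p : RP 3) (v : Fin 4 → ℝ) : ℝ :=
  (alongLine (detForm A) p.rep v).coeff 2

/-- The sextic `b² - 4ac` that defines the ramification curve of the projection from `p`; its value
at `v` depends only on `v` modulo `p`. -/
def ramification (A : Fin 4 → Matrix (Fin 4) (Fin 4) ℝ) (p : RP 3) (v : Fin 4 → ℝ) : ℝ :=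
  (alongLine (detForm A) p.rep v).coeff 1 ^ 2 -
    4 * (alongLine (detForm A) p.rep v).coeff 2 * (alongLine (detForm A) p.rep v).coeff 0

/-- `y ∈ ℝP²` is the image of `x ∈ ℝP³`, `x` not the centre, under the projection given by `L`. -/
def ProjectsTo (L : (Fin 4 → ℝ) →ₗ[ℝ] (Fin 3 → ℝ)) (x : RP 3) (y : RP 2) : Prop :=
  ∃ (v : Fin 4 → ℝ) (hv : v ≠ 0) (hLv : L v ≠ 0),
    x = Projectivization.mk ℝ v hv ∧ y = Projectivization.mk ℝ (L v) hLv

/-- The image of `S` under the projection extended to the blow-up of `ℝP³` at the centre.  The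
blow-up is the closure of the graph of the projection in `ℝP³ × ℝP²`; the strict transform of `S`
is the closure of the part of the graph that lies over `S` minus the centre. -/
def projImage (L : (Fin 4 → ℝ) →ₗ[ℝ] (Fin 3 → ℝ)) (S : Set (RP 3)) : Set (RP 2) :=
  Prod.snd '' closure {z : RP 3 × RP 2 | z.1 ∈ S ∧ ProjectsTo L z.1 z.2}

/-- The real conic `C_p`: the image of the tangent cone at `p`. -/
def tangentConic (A : Fin 4 → Matrix (Fin 4) (Fin 4) ℝ) (p : RP 3)
    (L : (Fin 4 → ℝ) →ₗ[ℝ] (Fin 3 → ℝ)) : Set (RP 2) :=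
  {y | ∃ x : RP 3, coneForm A p x.rep = 0 ∧ ProjectsTo L x y}

/-- The convex hull of `K ⊆ ℝP²` in an affine chart `{l = 1}` that contains `K`.  For connected `K`
(the only case in which it is used) it does not depend on the chart, because two linear forms
without zeros on `K` have a quotient of constant sign on `K`. -/
def convHull (K : Set (RP 2)) : Set (RP 2) :=
  {y | ∃ l : (Fin 3 → ℝ) →ₗ[ℝ] ℝ, (∀ x ∈ K, l x.rep ≠ 0) ∧
    ∃ (v : Fin 3 → ℝ) (hv : v ≠ 0), y = Projectivization.mk ℝ v hv ∧
      v ∈ convexHull ℝ {w | l w = 1 ∧ ∃ hw : w ≠ 0, Projectivization.mk ℝ w hw ∈ K}}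

/-- `x` is inside the tangent cone at `p`: it is the apex `p`, or its image lies in the
closed convex region bounded by the conic `C_p`.  It is outside otherwise. -/
def InsideCone (A : Fin 4 → Matrix (Fin 4) (Fin 4) ℝ) (p : RP 3)
    (L : (Fin 4 → ℝ) →ₗ[ℝ] (Fin 3 → ℝ)) (x : RP 3) : Prop :=
  x = p ∨ ∃ y, ProjectsTo L x y ∧ y ∈ convHull (tangentConic A p L)

/-! ### Plane cubics and their ovals -/

/-- The real points of the plane curve `V(F)`. -/
def realCurve (F : MvPolynomial (Fin 3) ℝ) : Set (RP 2) :=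
  {y | MvPolynomial.eval y.rep F = 0}

/-- `F` is a cubic form and the complex curve `V(F)` is smooth. -/
def IsSmoothCubic (F : MvPolynomial (Fin 3) ℝ) : Prop :=
  F.IsHomogeneous 3 ∧
    ∀ z : Fin 3 → ℂ, z ≠ 0 → ¬ IsSingularAt (MvPolynomial.map (algebraMap ℝ ℂ) F) z

/-- `O` is an oval of the plane curve `V(F)`: a connected component of its real points that is
contractible in `ℝP²`. -/
def IsOval (F : MvPolynomial (Fin 3) ℝ) (O : Set (RP 2)) : Prop :=
  (∃ y ∈ realCurve F, O = connectedComponentIn (realCurve F) y) ∧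
    (⟨Subtype.val, continuous_subtype_val⟩ : C(O, RP 2)).Nullhomotopic

/-- `V(F₁)` and `V(F₂)` are the ramification cubics of the projection from `p`: they are smooth
real cubics whose union is the ramification sextic. -/
def AreRamificationCubics (A : Fin 4 → Matrix (Fin 4) (Fin 4) ℝ) (p : RP 3)
    (L : (Fin 4 → ℝ) →ₗ[ℝ] (Fin 3 → ℝ)) (F₁ F₂ : MvPolynomial (Fin 3) ℝ) : Prop :=
  IsSmoothCubic F₁ ∧ IsSmoothCubic F₂ ∧
    ∀ v, ramification A p v = MvPolynomial.eval (L v) F₁ * MvPolynomial.eval (L v) F₂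

end QSpec

end

open QSpec

/-!
The real form `A(p)` has rank two, so after a congruence it is supported on the first two basis
vectors, and it is either definite there or a hyperbolic plane (`exists_congr_corner`).  Let
`lower A(x)` be the block of `A(x)` on the other two basis vectors.  It does not change when `x`
moves on a line through `p`, so that it is a linear family of binary forms on the plane onto which
`p` projects.  The quartic restricted to such a line is a quadratic polynomial whose leading
coefficient is a multiple of `det (lower A(x))` (`det_pencil`): the tangent cone is the locus where
the lower block is singular, and, as a singular symmetric `2 × 2` matrix is semidefinite, the convex
hull of the conic is the locus where the lower block is semidefinite.  Since blocks of semidefinite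
matrices are semidefinite, the spectrahedron lies inside the cone.  At a node all `3 × 3` minors
vanish, so that the Schur complement of the lower block is zero; a node inside the cone is
therefore semidefinite (`IsNormalForm.semidef_of_isRealNode`).

If `A(p)` is semidefinite, a form with definite lower block becomes semidefinite after adding a
large multiple of `A(p)`, and closing up gives the whole hull (`IsNormalForm.projImage_eq`).

If `A(p)` is a hyperbolic plane, then the blocks `face₁` and `face₂`, obtained by deleting one of
the first two basis vectors, are constant along lines through `p` as well.  The Desnanot–Jacobi identity
`det m * det (lower m) = det (face₁ m) * det (face₂ m) - det (mixed m) ^ 2` (`det_mul_det_lower`)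
gives three things.
* The discriminant of the quadratic polynomial above is `4 det (face₁ m) det (face₂ m)`, so the
  ramification sextic splits into two determinantal cubics.
* The cubics are smooth: differentiating the identity at a singular point of a cubic produces either
  a singular point of the quartic that is not a node, or a singular point of the tangent cone
  (`face₁_smooth`).
* The entries of the Schur complement of the lower block are the `3 × 3` minors in the identity, up
  to the factor `det (lower m)`.  On each line one point has `det (mixed m) = 0`; there the form is
  semidefinite as soon as both faces are, so that the image of the spectrahedron is the intersection
  of the plane spectrahedra of the two faces (`IsNormalForm.projImage_eq_inter`).

It remains to see that the boundary of a plane spectrahedron with a definite point is an oval of its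
cubic and spans it.  In the affine chart given by the trace the spectrahedron is compact and
convex, whence connectedness, contractibility and the convex hull (`isPreconnected_boundary`,
`nullhomotopic_boundary`, `convHull_boundary`).  It is a whole component because, on a smooth
determinantal cubic, the semidefinite points are those at which the sum of the principal `2 × 2`
minors is positive, which is an open condition, while semidefiniteness is a closed one
(`isOval_boundary`).
-/

namespace QSpec

open Matrix

/-! ### Semidefinite matrices of small size -/

theorem isHermitian_of_isSymm {n : Type*} {M : Matrix n n ℝ} (h : M.IsSymm) : M.IsHermitian := by
  rw [IsHermitian, conjTranspose_eq_transpose_of_trivial]; exact h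

theorem isSymm_of_isHermitian {n : Type*} {M : Matrix n n ℝ} (h : M.IsHermitian) : M.IsSymm := by
  rw [IsHermitian, conjTranspose_eq_transpose_of_trivial] at h; exact h

theorem posSemidef_of_isSymm {n : Type*} [Fintype n] {M : Matrix n n ℝ} (h : M.IsSymm)
    (h' : ∀ x, 0 ≤ x ⬝ᵥ (M *ᵥ x)) : M.PosSemidef :=
  PosSemidef.of_dotProduct_mulVec_nonneg (isHermitian_of_isSymm h) (by simpa using h')

theorem quad_nonneg {n : Type*} [Fintype n] {M : Matrix n n ℝ} (h : M.PosSemidef) (x : n → ℝ) :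
    0 ≤ x ⬝ᵥ (M *ᵥ x) := by
  simpa using h.dotProduct_mulVec_nonneg x

theorem quad_pos {n : Type*} [Fintype n] {M : Matrix n n ℝ} (h : M.PosDef) {x : n → ℝ}
    (hx : x ≠ 0) : 0 < x ⬝ᵥ (M *ᵥ x) := by
  simpa using h.dotProduct_mulVec_pos hx

theorem posDef_of_det_ne_zero {n : Type*} [Fintype n] [DecidableEq n] {M : Matrix n n ℝ}
    (h : M.PosSemidef) (hd : M.det ≠ 0) : M.PosDef :=
  h.posDef_iff_det_ne_zero.mpr hd

theorem mulVec_eq_zero_of_quad {n : Type*} [Fintype n] [DecidableEq n] {M : Matrix n n ℝ}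
    (h : M.PosSemidef) {x : n → ℝ} (hx : x ⬝ᵥ (M *ᵥ x) = 0) : M *ᵥ x = 0 :=
  (h.dotProduct_mulVec_zero_iff x).mp hx

/-- A symmetric `2 × 2` matrix with nonnegative determinant is semidefinite. -/
theorem posSemidef_two {M : Matrix (Fin 2) (Fin 2) ℝ} (h : M.IsSymm) (hd : 0 ≤ M.det) :
    M.PosSemidef ∨ (-M).PosSemidef := by
  have h01 : M 1 0 = M 0 1 := h.apply 0 1
  rw [det_fin_two, h01] at hd
  have hn : (-M).IsSymm := h.neg
  by_cases h0 : 0 < M 0 0 ∨ 0 < M 1 1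
  · left
    refine posSemidef_of_isSymm h fun x => ?_
    simp only [dotProduct, mulVec, Fin.sum_univ_two, h01]
    rcases h0 with h0 | h0
    · refine nonneg_of_mul_nonneg_right (a := M 0 0) ?_ h0
      nlinarith [sq_nonneg (M 0 0 * x 0 + M 0 1 * x 1), mul_nonneg hd (sq_nonneg (x 1))]
    · refine nonneg_of_mul_nonneg_right (a := M 1 1) ?_ h0
      nlinarith [sq_nonneg (M 1 1 * x 1 + M 0 1 * x 0), mul_nonneg hd (sq_nonneg (x 0))]
  · right
    push Not at h0
    refine posSemidef_of_isSymm hn fun x => ?_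
    simp only [dotProduct, mulVec, Fin.sum_univ_two, Matrix.neg_apply, h01]
    rcases h0.1.lt_or_eq with h1 | h1
    · refine nonneg_of_mul_nonneg_right (a := - M 0 0) ?_ (by linarith)
      nlinarith [sq_nonneg (M 0 0 * x 0 + M 0 1 * x 1), mul_nonneg hd (sq_nonneg (x 1))]
    · have h2 : M 0 1 = 0 := by
        rw [h1] at hd; nlinarith [sq_nonneg (M 0 1)]
      rw [h1, h2]
      nlinarith [mul_nonneg (neg_nonneg.2 h0.2) (sq_nonneg (x 1))]

/-! ### Minors of symmetric `4 × 4` matrices -/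

section Minors

variable {R : Type*}

/-- The restriction of the form `m` to the span of the last two coordinate vectors. -/
def lower (m : Matrix (Fin 4) (Fin 4) R) : Matrix (Fin 2) (Fin 2) R := m.submatrix ![2, 3] ![2, 3]

/-- The restriction of the form `m` to the hyperplane on which coordinate `1` vanishes. -/
def face₁ (m : Matrix (Fin 4) (Fin 4) R) : Matrix (Fin 3) (Fin 3) R :=
  m.submatrix ![0, 2, 3] ![0, 2, 3]

/-- The restriction of the form `m` to the hyperplane on which coordinate `0` vanishes. -/
def face₂ (m : Matrix (Fin 4) (Fin 4) R) : Matrix (Fin 3) (Fin 3) R :=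
  m.submatrix ![1, 2, 3] ![1, 2, 3]

/-- The off-diagonal `3 × 3` submatrix with rows `0, 2, 3` and columns `1, 2, 3`. -/
def mixed (m : Matrix (Fin 4) (Fin 4) R) : Matrix (Fin 3) (Fin 3) R :=
  m.submatrix ![0, 2, 3] ![1, 2, 3]

/-- The `4 × 4` matrix with a symmetric upper left `2 × 2` block and zeros elsewhere. -/
def corner [CommRing R] (d₁ d₂ d₃ : R) : Matrix (Fin 4) (Fin 4) R :=
  !![d₁, d₃, 0, 0; d₃, d₂, 0, 0; 0, 0, 0, 0; 0, 0, 0, 0]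

theorem symm_entries {m : Matrix (Fin 4) (Fin 4) R} (h : m.IsSymm) :
    m 1 0 = m 0 1 ∧ m 2 0 = m 0 2 ∧ m 3 0 = m 0 3 ∧ m 2 1 = m 1 2 ∧ m 3 1 = m 1 3 ∧
      m 3 2 = m 2 3 :=
  ⟨h.apply _ _, h.apply _ _, h.apply _ _, h.apply _ _, h.apply _ _, h.apply _ _⟩

theorem lower_isSymm {m : Matrix (Fin 4) (Fin 4) R} (h : m.IsSymm) : (lower m).IsSymm :=
  h.submatrix _

variable [CommRing R]

theorem det_fin_four (m : Matrix (Fin 4) (Fin 4) R) : m.det =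
    m 0 0 * (m 1 1 * (m 2 2 * m 3 3 - m 2 3 * m 3 2) - m 1 2 * (m 2 1 * m 3 3 - m 2 3 * m 3 1)
      + m 1 3 * (m 2 1 * m 3 2 - m 2 2 * m 3 1))
    - m 0 1 * (m 1 0 * (m 2 2 * m 3 3 - m 2 3 * m 3 2) - m 1 2 * (m 2 0 * m 3 3 - m 2 3 * m 3 0)
      + m 1 3 * (m 2 0 * m 3 2 - m 2 2 * m 3 0))
    + m 0 2 * (m 1 0 * (m 2 1 * m 3 3 - m 2 3 * m 3 1) - m 1 1 * (m 2 0 * m 3 3 - m 2 3 * m 3 0)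
      + m 1 3 * (m 2 0 * m 3 1 - m 2 1 * m 3 0))
    - m 0 3 * (m 1 0 * (m 2 1 * m 3 2 - m 2 2 * m 3 1) - m 1 1 * (m 2 0 * m 3 2 - m 2 2 * m 3 0)
      + m 1 2 * (m 2 0 * m 3 1 - m 2 1 * m 3 0)) := by
  rw [det_succ_row_zero, Fin.sum_univ_four]
  simp only [det_fin_three, submatrix_apply, Fin.succAbove]
  simp [Fin.lt_def]
  ring

/-- The Desnanot–Jacobi identity for a symmetric `4 × 4` matrix. -/
theorem det_mul_det_lower {m : Matrix (Fin 4) (Fin 4) R} (h : m.IsSymm) :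
    m.det * (lower m).det = (face₁ m).det * (face₂ m).det - (mixed m).det ^ 2 := by
  obtain ⟨h1, h2, h3, h4, h5, h6⟩ := symm_entries h
  rw [det_fin_four, det_fin_two, det_fin_three, det_fin_three, det_fin_three]
  simp only [lower, face₁, face₂, mixed, submatrix_apply, cons_val_zero, cons_val_one, cons_val,
    h1, h2, h3, h4, h5, h6]
  ring

/-- The determinant of the pencil spanned by a symmetric matrix and a form of rank two. -/
theorem det_pencil {m : Matrix (Fin 4) (Fin 4) R} (h : m.IsSymm) (s t d₁ d₂ d₃ : R) :
    (s • m + t • corner d₁ d₂ d₃).det = s ^ 4 * m.det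
      + s ^ 3 * t * (d₁ * (face₂ m).det + d₂ * (face₁ m).det - 2 * d₃ * (mixed m).det)
      + s ^ 2 * t ^ 2 * ((d₁ * d₂ - d₃ ^ 2) * (lower m).det) := by
  obtain ⟨h1, h2, h3, h4, h5, h6⟩ := symm_entries h
  rw [det_fin_four, det_fin_four, det_fin_two, det_fin_three, det_fin_three, det_fin_three]
  simp only [lower, face₁, face₂, mixed, submatrix_apply, cons_val_zero, cons_val_one, cons_val,
    h1, h2, h3, h4, h5, h6, corner, Matrix.add_apply, Matrix.smul_apply, smul_eq_mul, of_apply]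
  ring

theorem lower_add (m m' : Matrix (Fin 4) (Fin 4) R) : lower (m + m') = lower m + lower m' := rfl

theorem lower_corner (d₁ d₂ d₃ : R) : lower (corner d₁ d₂ d₃) = 0 := by
  ext i j; fin_cases i <;> fin_cases j <;> simp [lower, corner]

end Minors

/-- Semidefiniteness through the Schur complement of the lower block, whose entries are
`det (face₁ m)`, `det (mixed m)`, `det (face₂ m)` divided by `det (lower m)`. -/
theorem posSemidef_of_schur {m : Matrix (Fin 4) (Fin 4) ℝ} (h : m.IsSymm)
    (hR : (lower m).PosDef) (h₁ : 0 ≤ (face₁ m).det) (h₂ : 0 ≤ (face₂ m).det)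
    (h₁₂ : (mixed m).det ^ 2 ≤ (face₁ m).det * (face₂ m).det) : m.PosSemidef := by
  refine posSemidef_of_isSymm h fun x => ?_
  have hr := hR.det_pos
  set r := (lower m).det with hr'
  set F := (face₁ m).det with hF
  set G := (face₂ m).det with hG
  set g := (mixed m).det with hg
  -- The vector is `r` times the displacement of `(x 2, x 3)` from the point at which the form is
  -- minimal for fixed `x 0`, `x 1`.
  have hq := quad_nonneg hR.posSemidef
    ![r * x 2 + (m 3 3 * (x 0 * m 0 2 + x 1 * m 1 2) - m 2 3 * (x 0 * m 0 3 + x 1 * m 1 3)),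
      r * x 3 + (m 2 2 * (x 0 * m 0 3 + x 1 * m 1 3) - m 2 3 * (x 0 * m 0 2 + x 1 * m 1 2))]
  have hs : 0 ≤ F * x 0 ^ 2 + 2 * g * (x 0 * x 1) + G * x 1 ^ 2 := by
    have := quad_nonneg (M := !![F, g; g, G]) ?_ ![x 0, x 1]
    · convert this using 1
      simp [dotProduct, mulVec, Fin.sum_univ_two]; ring
    · have hsy : (!![F, g; g, G]).IsSymm := by
        ext i j; fin_cases i <;> fin_cases j <;> rfl
      rcases posSemidef_two hsy (by rw [det_fin_two]; simp; nlinarith) with h | h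
      · exact h
      · have e1 := h.diag_nonneg (i := 0)
        have e2 := h.diag_nonneg (i := 1)
        simp at e1 e2
        have e3 : F = 0 := le_antisymm e1 h₁
        have e4 : G = 0 := le_antisymm e2 h₂
        have e5 : g = 0 := by rw [e3] at h₁₂; nlinarith [sq_nonneg g]
        rw [e3, e4, e5]
        convert PosSemidef.zero using 1
        ext i j; fin_cases i <;> fin_cases j <;> rfl
  refine nonneg_of_mul_nonneg_right (a := r ^ 2) ?_ (by positivity)
  have key : r ^ 2 * (x ⬝ᵥ (m *ᵥ x)) = r * (F * x 0 ^ 2 + 2 * g * (x 0 * x 1) + G * x 1 ^ 2) +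
    ![r * x 2 + (m 3 3 * (x 0 * m 0 2 + x 1 * m 1 2) - m 2 3 * (x 0 * m 0 3 + x 1 * m 1 3)),
      r * x 3 + (m 2 2 * (x 0 * m 0 3 + x 1 * m 1 3) - m 2 3 * (x 0 * m 0 2 + x 1 * m 1 2))] ⬝ᵥ
      (lower m *ᵥ ![r * x 2 + (m 3 3 * (x 0 * m 0 2 + x 1 * m 1 2) -
          m 2 3 * (x 0 * m 0 3 + x 1 * m 1 3)),
      r * x 3 + (m 2 2 * (x 0 * m 0 3 + x 1 * m 1 3) -
          m 2 3 * (x 0 * m 0 2 + x 1 * m 1 2))]) := by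
    obtain ⟨h1, h2, h3, h4, h5, h6⟩ := symm_entries h
    rw [hr', hF, hG, hg, det_fin_two, det_fin_three, det_fin_three, det_fin_three]
    simp only [dotProduct, mulVec, Fin.sum_univ_two, Fin.sum_univ_four, lower, face₁, face₂, mixed,
      submatrix_apply, cons_val_zero, cons_val_one, cons_val, h1, h2, h3, h4, h5, h6]
    ring
  rw [key]
  exact add_nonneg (mul_nonneg hr.le hs) hq

/-! ### Symmetric `3 × 3` matrices of rank two -/

section Three

/-- The sum of the principal `2 × 2` minors. -/
def minorSum (M : Matrix (Fin 3) (Fin 3) ℝ) : ℝ :=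
  (M 1 1 * M 2 2 - M 1 2 * M 2 1) + (M 0 0 * M 2 2 - M 0 2 * M 2 0) +
    (M 0 0 * M 1 1 - M 0 1 * M 1 0)

/-- The coefficient of `t` in `det (M + t N)`, for symmetric `M` and `N`. -/
def polarDet {R : Type*} [CommRing R] (M N : Matrix (Fin 3) (Fin 3) R) : R :=
  (M 1 1 * M 2 2 - M 1 2 ^ 2) * N 0 0 + (M 0 0 * M 2 2 - M 0 2 ^ 2) * N 1 1 +
    (M 0 0 * M 1 1 - M 0 1 ^ 2) * N 2 2 + 2 * (M 0 2 * M 1 2 - M 0 1 * M 2 2) * N 0 1 +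
    2 * (M 0 1 * M 1 2 - M 0 2 * M 1 1) * N 0 2 + 2 * (M 0 1 * M 0 2 - M 0 0 * M 1 2) * N 1 2

theorem symm_entries_three {R : Type*} {m : Matrix (Fin 3) (Fin 3) R} (h : m.IsSymm) :
    m 1 0 = m 0 1 ∧ m 2 0 = m 0 2 ∧ m 2 1 = m 1 2 :=
  ⟨h.apply _ _, h.apply _ _, h.apply _ _⟩

theorem det_add_smul {R : Type*} [CommRing R] {M N : Matrix (Fin 3) (Fin 3) R} (hM : M.IsSymm)
    (hN : N.IsSymm) (t : R) :
    (M + t • N).det = M.det + t * polarDet M N + t ^ 2 * polarDet N M + t ^ 3 * N.det := by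
  obtain ⟨h1, h2, h3⟩ := symm_entries_three hM
  obtain ⟨k1, k2, k3⟩ := symm_entries_three hN
  simp only [det_fin_three, polarDet, Matrix.add_apply, Matrix.smul_apply, smul_eq_mul, h1, h2, h3,
    k1, k2, k3]
  ring

/-- A singular form is semidefinite as soon as it is definite on a coordinate plane. -/
theorem posSemidef_three_of_minor {M : Matrix (Fin 3) (Fin 3) ℝ} (h : M.IsSymm) (hd : M.det = 0)
    (h0 : 0 < M 1 1 * M 2 2 - M 1 2 * M 2 1) : M.PosSemidef ∨ (-M).PosSemidef := by
  obtain ⟨h1, h2, h3⟩ := symm_entries_three h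
  rw [det_fin_three, h1, h2, h3] at hd
  rw [h3] at h0
  set r := M 1 1 * M 2 2 - M 1 2 * M 1 2 with hr
  have hsub : (M.submatrix ![1, 2] ![1, 2]).IsSymm := h.submatrix _
  have key : ∀ x, r ^ 2 * (x ⬝ᵥ (M *ᵥ x)) =
      ![r * x 1 + (M 2 2 * M 0 1 - M 1 2 * M 0 2) * x 0,
        r * x 2 + (M 1 1 * M 0 2 - M 1 2 * M 0 1) * x 0] ⬝ᵥ ((M.submatrix ![1, 2] ![1, 2]) *ᵥ
      ![r * x 1 + (M 2 2 * M 0 1 - M 1 2 * M 0 2) * x 0,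
        r * x 2 + (M 1 1 * M 0 2 - M 1 2 * M 0 1) * x 0]) := by
    intro x
    simp only [dotProduct, mulVec, Fin.sum_univ_two, Fin.sum_univ_three,
      submatrix_apply, cons_val_zero, cons_val_one, h1, h2, h3]
    linear_combination r * x 0 ^ 2 * hd
  have hr2 : 0 < r ^ 2 := by positivity
  rcases posSemidef_two hsub (by rw [det_fin_two]; simp [h3]; linarith) with hp | hp
  · left
    refine posSemidef_of_isSymm h fun x => nonneg_of_mul_nonneg_right ?_ hr2
    rw [key]
    exact quad_nonneg hp _
  · right
    refine posSemidef_of_isSymm h.neg fun x => nonneg_of_mul_nonneg_right ?_ hr2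
    rw [neg_mulVec, dotProduct_neg, mul_neg, key, ← dotProduct_neg, ← neg_mulVec]
    exact quad_nonneg hp _

theorem semidef_of_submatrix {M : Matrix (Fin 3) (Fin 3) ℝ} (e : Fin 3 ≃ Fin 3)
    (h : (M.submatrix e e).PosSemidef ∨ (-(M.submatrix e e)).PosSemidef) :
    M.PosSemidef ∨ (-M).PosSemidef := by
  rcases h with h | h
  · exact .inl ((posSemidef_submatrix_equiv e).1 h)
  · exact .inr ((posSemidef_submatrix_equiv (M := -M) e).1 h)

/-- A singular form of which the principal `2 × 2` minors have positive sum is semidefinite: some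
principal minor is positive, and the form is definite on that coordinate plane. -/
theorem semidef_of_minorSum_pos {M : Matrix (Fin 3) (Fin 3) ℝ} (h : M.IsSymm) (hd : M.det = 0)
    (h0 : 0 < minorSum M) : M.PosSemidef ∨ (-M).PosSemidef := by
  by_cases ha : 0 < M 1 1 * M 2 2 - M 1 2 * M 2 1
  · exact posSemidef_three_of_minor h hd ha
  by_cases hb : 0 < M 0 0 * M 2 2 - M 0 2 * M 2 0
  · refine semidef_of_submatrix (Equiv.swap 0 1)
      (posSemidef_three_of_minor (h.submatrix _) (by rw [det_submatrix_equiv_self, hd]) ?_)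
    simpa [Equiv.swap_apply_of_ne_of_ne] using hb
  by_cases hc : 0 < M 0 0 * M 1 1 - M 0 1 * M 1 0
  · refine semidef_of_submatrix (Equiv.swap 0 2)
      (posSemidef_three_of_minor (h.submatrix _) (by rw [det_submatrix_equiv_self, hd]) ?_)
    simp [Equiv.swap_apply_of_ne_of_ne]
    linarith
  rw [minorSum] at h0
  linarith

/-- A singular semidefinite form without positive principal `2 × 2` minors has rank at most one,
so that it is a critical point of the determinant. -/
theorem polarDet_eq_zero {M : Matrix (Fin 3) (Fin 3) ℝ} (h : M.PosSemidef ∨ (-M).PosSemidef)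
    (hd : M.det = 0) (h0 : minorSum M ≤ 0) (N : Matrix (Fin 3) (Fin 3) ℝ) : polarDet M N = 0 := by
  have hs : M.IsSymm := by
    rcases h with h | h
    · exact isSymm_of_isHermitian h.1
    · simpa using (isSymm_of_isHermitian h.1).neg
  have hminor : ∀ i j, 0 ≤ M i i * M j j - M i j * M j i := by
    intro i j
    rcases h with h | h
    · have := (h.submatrix ![i, j]).det_nonneg
      rw [det_fin_two] at this
      simpa using this
    · have := (h.submatrix ![i, j]).det_nonneg
      rw [det_fin_two] at this
      simpa using this
  obtain ⟨h1, h2, h3⟩ := symm_entries_three hs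
  have ha := hminor 1 2
  have hb := hminor 0 2
  have hc := hminor 0 1
  rw [minorSum] at h0
  have ha' : M 1 1 * M 2 2 - M 1 2 * M 2 1 = 0 := by linarith
  have hb' : M 0 0 * M 2 2 - M 0 2 * M 2 0 = 0 := by linarith
  have hc' : M 0 0 * M 1 1 - M 0 1 * M 1 0 = 0 := by linarith
  rw [det_fin_three] at hd
  rw [h1, h2, h3] at hd
  rw [h3] at ha'
  rw [h2] at hb'
  rw [h1] at hc'
  -- The square of a mixed minor is a combination of the determinant and of principal minors.
  have e1 : M 0 2 * M 1 2 - M 0 1 * M 2 2 = 0 := by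
    refine pow_eq_zero_iff (two_ne_zero) |>.1 ?_
    linear_combination - M 2 2 * hd + (M 0 0 * M 2 2 - M 0 2 * M 0 2) * ha'
  have e2 : M 0 1 * M 1 2 - M 0 2 * M 1 1 = 0 := by
    refine pow_eq_zero_iff (two_ne_zero) |>.1 ?_
    linear_combination - M 1 1 * hd + (M 0 0 * M 1 1 - M 0 1 * M 0 1) * ha'
  have e3 : M 0 1 * M 0 2 - M 0 0 * M 1 2 = 0 := by
    refine pow_eq_zero_iff (two_ne_zero) |>.1 ?_
    linear_combination - M 0 0 * hd + (M 0 0 * M 1 1 - M 0 1 * M 0 1) * hb'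
  rw [polarDet, e1, e2, e3, pow_two, pow_two, pow_two, ha', hb', hc']
  ring

end Three

/-! ### The topology of real projective space -/

section Topology

variable {n : ℕ}

/-- The topology of projective space is the quotient topology, and the quotient map is open because
the saturation of an open set is a union of its multiples. -/
theorem isOpenQuotientMap_mk :
    IsOpenQuotientMap
      (fun v : {v : Fin (n + 1) → ℝ // v ≠ 0} => (Projectivization.mk' ℝ v : RP n)) where
  surjective := by
    intro x
    exact ⟨⟨x.rep, x.rep_nonzero⟩, x.mk_rep⟩
  continuous := continuous_coinduced_rng
  isOpenMap := by
    intro U hU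
    rw [isOpen_coinduced]
    have : (fun v : {v : Fin (n + 1) → ℝ // v ≠ 0} => (Projectivization.mk' ℝ v : RP n)) ⁻¹'
        ((fun v : {v : Fin (n + 1) → ℝ // v ≠ 0} => (Projectivization.mk' ℝ v : RP n)) '' U) =
        ⋃ c : ℝˣ, (fun v : {v : Fin (n + 1) → ℝ // v ≠ 0} =>
          (⟨c • v.1, (smul_ne_zero_iff_ne c).2 v.2⟩ : {v : Fin (n + 1) → ℝ // v ≠ 0})) ⁻¹' U := by
      ext v
      simp only [Set.mem_preimage, Set.mem_image, Set.mem_iUnion]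
      constructor
      · rintro ⟨w, hw, h⟩
        rw [Projectivization.mk'_eq_mk, Projectivization.mk'_eq_mk,
          Projectivization.mk_eq_mk_iff] at h
        obtain ⟨c, hc⟩ := h
        refine ⟨c, ?_⟩
        convert hw
      · rintro ⟨c, hc⟩
        refine ⟨_, hc, ?_⟩
        rw [Projectivization.mk'_eq_mk, Projectivization.mk'_eq_mk,
          Projectivization.mk_eq_mk_iff]
        exact ⟨c, rfl⟩
    rw [this]
    refine isOpen_iUnion fun c => hU.preimage ?_
    refine Continuous.subtype_mk ?_ _
    exact continuous_subtype_val.const_smul (c : ℝ)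

theorem continuous_mk_comp {X : Type*} [TopologicalSpace X] {φ : X → Fin (n + 1) → ℝ}
    (hφ : Continuous φ) (h0 : ∀ x, φ x ≠ 0) :
    Continuous fun x => (Projectivization.mk ℝ (φ x) (h0 x) : RP n) :=
  isOpenQuotientMap_mk.continuous.comp (hφ.subtype_mk h0)

theorem exists_smul_rep (y : RP n) (v : Fin (n + 1) → ℝ) (hv : v ≠ 0)
    (h : y = Projectivization.mk ℝ v hv) : ∃ c : ℝ, c ≠ 0 ∧ y.rep = c • v := by
  obtain ⟨a, ha⟩ := Projectivization.exists_smul_eq_mk_rep ℝ v hv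
  exact ⟨a, a.ne_zero, by rw [h, ← ha]; rfl⟩

theorem mk_smul_eq {v : Fin (n + 1) → ℝ} (hv : v ≠ 0) {c : ℝ} (h : c • v ≠ 0) :
    (Projectivization.mk ℝ (c • v) h : RP n) = Projectivization.mk ℝ v hv :=
  (Projectivization.mk_eq_mk_iff' ℝ _ _ _ _).2 ⟨c, rfl⟩

/-- A set of points of projective space is open if it is so in homogeneous coordinates. -/
theorem isOpen_of_homogeneous {P : (Fin (n + 1) → ℝ) → Prop}
    (hP : ∀ c : ℝ, c ≠ 0 → ∀ v, P (c • v) ↔ P v) (ho : IsOpen {v | P v}) :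
    IsOpen {y : RP n | P y.rep} := by
  rw [← isOpenQuotientMap_mk.isQuotientMap.isOpen_preimage]
  convert ho.preimage (continuous_subtype_val (p := fun v : Fin (n + 1) → ℝ => v ≠ 0)) using 1
  ext v
  obtain ⟨c, hc, h⟩ := exists_smul_rep (Projectivization.mk' ℝ v) v.1 v.2 rfl
  rw [Projectivization.mk'_eq_mk] at h
  simp [h, hP c hc]

/-- The punctured cone over an open set of projective space is open. -/
theorem isOpen_cone {U : Set (RP n)} (hU : IsOpen U) :
    IsOpen {v : Fin (n + 1) → ℝ | ∃ hv : v ≠ 0, (Projectivization.mk ℝ v hv : RP n) ∈ U} := by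
  have h1 := hU.preimage (isOpenQuotientMap_mk (n := n)).continuous
  have h2 := (isOpen_ne (x := (0 : Fin (n + 1) → ℝ))).isOpenMap_subtype_val _ h1
  convert h2 using 1
  ext v
  constructor
  · rintro ⟨hv, h⟩
    exact ⟨⟨v, hv⟩, h, rfl⟩
  · rintro ⟨w, h, rfl⟩
    exact ⟨w.2, h⟩

theorem isClosed_of_homogeneous {P : (Fin (n + 1) → ℝ) → Prop}
    (hP : ∀ c : ℝ, c ≠ 0 → ∀ v, P (c • v) ↔ P v) (ho : IsClosed {v | P v}) :
    IsClosed {y : RP n | P y.rep} := by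
  rw [← isOpen_compl_iff]
  exact isOpen_of_homogeneous (P := fun v => ¬ P v) (fun c hc v => not_congr (hP c hc v))
    (isOpen_compl_iff.2 ho)

/-- The normalization of homogeneous coordinates by a linear form `l` is continuous away from
the hyperplane `l = 0`. -/
theorem continuousAt_normalize (l : (Fin (n + 1) → ℝ) →ₗ[ℝ] ℝ) {y : RP n} (hy : l y.rep ≠ 0) :
    ContinuousAt (fun y : RP n => (l y.rep)⁻¹ • y.rep) y := by
  have hl : Continuous l := l.continuous_of_finiteDimensional
  have hmk : y = Projectivization.mk' ℝ ⟨y.rep, y.rep_nonzero⟩ := y.mk_rep.symm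
  have key : ContinuousAt ((fun y : RP n => (l y.rep)⁻¹ • y.rep) ∘
      (fun v : {v : Fin (n + 1) → ℝ // v ≠ 0} => (Projectivization.mk' ℝ v : RP n)))
      ⟨y.rep, y.rep_nonzero⟩ := by
    have : ((fun y : RP n => (l y.rep)⁻¹ • y.rep) ∘
      (fun v : {v : Fin (n + 1) → ℝ // v ≠ 0} => (Projectivization.mk' ℝ v : RP n))) =
      fun v => (l v.1)⁻¹ • v.1 := by
      funext v
      obtain ⟨c, hc, h⟩ := exists_smul_rep (Projectivization.mk' ℝ v) v.1 v.2 rfl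
      simp only [Function.comp_apply, h, map_smul, smul_smul, smul_eq_mul]
      congr 1
      field_simp
    rw [this]
    exact ((hl.comp continuous_subtype_val).continuousAt.inv₀ hy).smul
      continuous_subtype_val.continuousAt
  rw [isOpenQuotientMap_mk.continuousAt_comp_iff] at key
  rw [hmk]
  convert key

end Topology

/-! ### Projective spectrahedra -/

section Region

variable {n : ℕ} {ι : Type*}

/-- Positive or negative semidefinite real matrices. -/
def Semidef (M : Matrix ι ι ℝ) : Prop := M.PosSemidef ∨ (-M).PosSemidef

theorem Semidef.smul {M : Matrix ι ι ℝ} (h : Semidef M) (c : ℝ) : Semidef (c • M) := by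
  rcases le_total 0 c with hc | hc
  · rcases h with h | h
    · exact .inl (h.smul hc)
    · exact .inr (by rw [← smul_neg]; exact h.smul hc)
  · rcases h with h | h
    · exact .inr (by rw [← neg_smul]; exact h.smul (neg_nonneg.2 hc))
    · exact .inl (by rw [← neg_smul_neg]; exact h.smul (neg_nonneg.2 hc))

theorem semidef_smul_iff {M : Matrix ι ι ℝ} {c : ℝ} (hc : c ≠ 0) :
    Semidef (c • M) ↔ Semidef M :=
  ⟨fun h => by simpa [smul_smul, hc] using h.smul c⁻¹, fun h => h.smul c⟩

variable (B : (Fin (n + 1) → ℝ) →ₗ[ℝ] Matrix ι ι ℝ)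

/-- The projective spectrahedron of the pencil `B`. -/
def region : Set (RP n) := {y | Semidef (B y.rep)}

variable {B}

theorem mem_region_mk {v : Fin (n + 1) → ℝ} (hv : v ≠ 0) :
    (Projectivization.mk ℝ v hv : RP n) ∈ region B ↔ Semidef (B v) := by
  obtain ⟨c, hc, h⟩ := exists_smul_rep (Projectivization.mk ℝ v hv) v hv rfl
  rw [region, Set.mem_ofPred_eq, h, map_smul, semidef_smul_iff hc]

variable [Fintype ι]

theorem continuous_quad (x : ι → ℝ) : Continuous fun v => x ⬝ᵥ (B v *ᵥ x) := by
  have hB : Continuous B := B.continuous_of_finiteDimensional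
  fun_prop

theorem isClosed_posSemidef (hB : ∀ v, (B v).IsSymm) : IsClosed {v | (B v).PosSemidef} := by
  have : {v | (B v).PosSemidef} = ⋂ x : ι → ℝ, {v | 0 ≤ x ⬝ᵥ (B v *ᵥ x)} := by
    ext v
    simp only [Set.mem_ofPred_eq, Set.mem_iInter]
    exact ⟨fun h x => quad_nonneg h x, posSemidef_of_isSymm (hB v)⟩
  rw [this]
  exact isClosed_iInter fun x => isClosed_le continuous_const (continuous_quad x)

/-- Positive definiteness is positivity on the compact unit sphere, hence an open condition. -/
theorem isOpen_posDef (hB : ∀ v, (B v).IsSymm) : IsOpen {v | (B v).PosDef} := by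
  rw [isOpen_iff_mem_nhds]
  intro v hv
  have hBc : Continuous B := B.continuous_of_finiteDimensional
  have hK : IsCompact (Metric.sphere (0 : ι → ℝ) 1) := isCompact_sphere _ _
  have hc : Continuous fun z : (Fin (n + 1) → ℝ) × (ι → ℝ) => z.2 ⬝ᵥ (B z.1 *ᵥ z.2) := by
    fun_prop
  have := hK.eventually_forall_of_forall_eventually (x₀ := v)
    (P := fun v x => 0 < x ⬝ᵥ (B v *ᵥ x)) ?_
  · filter_upwards [this] with w hw
    refine PosDef.of_dotProduct_mulVec_pos (isHermitian_of_isSymm (hB w)) fun x hx => ?_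
    have hx' : 0 < ‖x‖ := norm_pos_iff.2 hx
    have h1 := hw (‖x‖⁻¹ • x) (by simp [norm_smul, hx'.ne'])
    rw [mulVec_smul, dotProduct_smul, smul_dotProduct, smul_eq_mul, smul_eq_mul] at h1
    have h2 : 0 < ‖x‖⁻¹ := inv_pos.2 hx'
    simpa using (pos_of_mul_pos_right (pos_of_mul_pos_right h1 h2.le) h2.le)
  · intro x hx
    have hx0 : x ≠ 0 := by
      rintro rfl
      simp at hx
    exact continuousAt_const.eventually_lt (hc.continuousAt (x := (v, x))) (quad_pos hv hx0)

theorem isClosed_region (hB : ∀ v, (B v).IsSymm) : IsClosed (region B) := by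
  refine isClosed_of_homogeneous (P := fun v => Semidef (B v)) ?_ ?_
  · intro c hc v
    rw [map_smul, semidef_smul_iff hc]
  · have h2 : IsClosed {v | (-B v).PosSemidef} :=
      isClosed_posSemidef (B := -B) fun v => (hB v).neg
    exact (isClosed_posSemidef hB).union h2

variable [DecidableEq ι]

theorem det_ne_zero_of_posDef {M : Matrix ι ι ℝ} (h : M.PosDef) : M.det ≠ 0 := h.det_pos.ne'

/-- The points of the projective spectrahedron at which the determinant vanishes. -/
def boundary (B : (Fin (n + 1) → ℝ) →ₗ[ℝ] Matrix ι ι ℝ) : Set (RP n) :=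
  {y | Semidef (B y.rep) ∧ (B y.rep).det = 0}

theorem mem_boundary_mk {v : Fin (n + 1) → ℝ} (hv : v ≠ 0) :
    (Projectivization.mk ℝ v hv : RP n) ∈ boundary B ↔ Semidef (B v) ∧ (B v).det = 0 := by
  obtain ⟨c, hc, h⟩ := exists_smul_rep (Projectivization.mk ℝ v hv) v hv rfl
  rw [boundary, Set.mem_ofPred_eq, h, map_smul, semidef_smul_iff hc, det_smul]
  simp [hc]

end Region

/-! ### Plane spectrahedra with a definite point -/

section Plane

variable {ι : Type*} [Fintype ι]

/-- The trace of a pencil, a linear form that is positive on nonzero semidefinite points. -/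
def traceForm (B : (Fin 3 → ℝ) →ₗ[ℝ] Matrix ι ι ℝ) : (Fin 3 → ℝ) →ₗ[ℝ] ℝ :=
  Matrix.traceLinearMap ι ℝ ℝ ∘ₗ B

theorem traceForm_apply (B : (Fin 3 → ℝ) →ₗ[ℝ] Matrix ι ι ℝ) (v : Fin 3 → ℝ) :
    traceForm B v = (B v).trace := rfl

variable {B : (Fin 3 → ℝ) →ₗ[ℝ] Matrix ι ι ℝ}

theorem traceForm_pos (hinj : ∀ v, B v = 0 → v = 0) {v : Fin 3 → ℝ} (hv : v ≠ 0)
    (h : (B v).PosSemidef) : 0 < traceForm B v :=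
  lt_of_le_of_ne h.trace_nonneg fun h0 => hv (hinj v (h.trace_eq_zero_iff.1 h0.symm))

theorem traceForm_ne_zero (hinj : ∀ v, B v = 0 → v = 0) {v : Fin 3 → ℝ} (hv : v ≠ 0)
    (h : Semidef (B v)) : traceForm B v ≠ 0 := by
  rcases h with h | h
  · exact (traceForm_pos hinj hv h).ne'
  · have := traceForm_pos hinj (neg_ne_zero.2 hv) (by rwa [map_neg])
    rw [map_neg] at this
    linarith

theorem exists_normalized (hinj : ∀ v, B v = 0 → v = 0) {y : RP 2} (hy : y ∈ region B) :
    ∃ (v : Fin 3 → ℝ) (hv : v ≠ 0), y = Projectivization.mk ℝ v hv ∧ (B v).PosSemidef ∧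
      traceForm B v = 1 := by
  have ht := traceForm_ne_zero hinj y.rep_nonzero hy
  have hv : (traceForm B y.rep)⁻¹ • y.rep ≠ 0 := smul_ne_zero (inv_ne_zero ht) y.rep_nonzero
  refine ⟨_, hv, ?_, ?_, ?_⟩
  · rw [mk_smul_eq y.rep_nonzero, y.mk_rep]
  · rw [map_smul]
    rcases hy with h | h
    · exact h.smul (inv_nonneg.2 h.trace_nonneg)
    · rw [← neg_smul_neg]
      refine h.smul (neg_nonneg.2 (inv_nonpos.2 ?_))
      have := h.trace_nonneg
      rw [trace_neg] at this
      rw [traceForm_apply]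
      linarith
  · rw [map_smul, smul_eq_mul, inv_mul_cancel₀ ht]

variable [DecidableEq ι]

/-- The affine part of the boundary of a plane spectrahedron: semidefinite points of trace one
with vanishing determinant. -/
def rim (B : (Fin 3 → ℝ) →ₗ[ℝ] Matrix ι ι ℝ) : Set (Fin 3 → ℝ) :=
  {w | traceForm B w = 1 ∧ (B w).PosSemidef ∧ (B w).det = 0}

theorem rim_ne_zero {w : Fin 3 → ℝ} (hw : w ∈ rim B) : w ≠ 0 := by
  rintro rfl
  have := hw.1
  simp at this

theorem exists_mem_rim (hinj : ∀ v, B v = 0 → v = 0) {y : RP 2} (hy : y ∈ boundary B) :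
    ∃ (w : Fin 3 → ℝ) (hw : w ∈ rim B), y = Projectivization.mk ℝ w (rim_ne_zero hw) := by
  obtain ⟨v, hv, h1, h2, h3⟩ := exists_normalized hinj hy.1
  rw [h1, mem_boundary_mk] at hy
  exact ⟨v, ⟨h3, h2, hy.2⟩, h1⟩

theorem mk_mem_boundary {w : Fin 3 → ℝ} (hw : w ∈ rim B) :
    (Projectivization.mk ℝ w (rim_ne_zero hw) : RP 2) ∈ boundary B :=
  (mem_boundary_mk _).2 ⟨.inl hw.2.1, hw.2.2⟩

/-- A ray in a direction of trace zero leaves the semidefinite cone through its rim. -/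
theorem exists_ray_det_eq_zero (hB : ∀ v, (B v).IsSymm) (hinj : ∀ v, B v = 0 → v = 0)
    {v d : Fin 3 → ℝ} (hv : (B v).PosSemidef) (hd : d ≠ 0) (htr : traceForm B d = 0) :
    ∃ t : ℝ, 0 ≤ t ∧ (B (v + t • d)).PosSemidef ∧ (B (v + t • d)).det = 0 := by
  have hnot : ¬ (B d).PosSemidef := fun h => (traceForm_pos hinj hd h).ne' htr
  obtain ⟨x, hx⟩ : ∃ x, x ⬝ᵥ (B d *ᵥ x) < 0 := by
    by_contra! h
    exact hnot (posSemidef_of_isSymm (hB d) h)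
  set T : Set ℝ := {t | 0 ≤ t ∧ (B (v + t • d)).PosSemidef} with hT
  have hcont : Continuous fun t : ℝ => v + t • d := by fun_prop
  have hclosed : IsClosed T :=
    isClosed_Ici.inter ((isClosed_posSemidef hB).preimage hcont)
  have hbdd : ∀ t ∈ T, t ≤ (x ⬝ᵥ (B v *ᵥ x)) / (-(x ⬝ᵥ (B d *ᵥ x))) := by
    rintro t ⟨-, ht⟩
    have := quad_nonneg ht x
    rw [map_add, map_smul, add_mulVec, smul_mulVec, dotProduct_add, dotProduct_smul,
      smul_eq_mul] at this
    rw [le_div_iff₀ (by linarith)]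
    linarith
  have h0 : (0 : ℝ) ∈ T := ⟨le_rfl, by simpa using hv⟩
  have hmem : sSup T ∈ T := hclosed.csSup_mem ⟨0, h0⟩ ⟨_, hbdd⟩
  refine ⟨sSup T, hmem.1, hmem.2, ?_⟩
  by_contra hdet
  have hpd := posDef_of_det_ne_zero hmem.2 hdet
  have hopen : IsOpen {t : ℝ | (B (v + t • d)).PosDef} := (isOpen_posDef hB).preimage hcont
  obtain ⟨ε, hε, hball⟩ := Metric.isOpen_iff.1 hopen _ hpd
  have h1 : sSup T + ε / 2 ∈ T := by
    refine ⟨by linarith [hmem.1], PosDef.posSemidef (hball ?_)⟩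
    simp [abs_of_pos hε, hε]
  have := le_csSup ⟨_, hbdd⟩ h1
  linarith

omit [DecidableEq ι] in
theorem exists_trace_zero : ∃ d : Fin 3 → ℝ, d ≠ 0 ∧ traceForm B d = 0 := by
  have h := (traceForm B).finrank_range_add_finrank_ker
  have h2 : Module.finrank ℝ (LinearMap.range (traceForm B)) ≤ 1 := by
    simpa using Submodule.finrank_le (LinearMap.range (traceForm B))
  have h3 : 0 < Module.finrank ℝ (LinearMap.ker (traceForm B)) := by
    simp at h
    omega
  have : Nontrivial (LinearMap.ker (traceForm B)) := Module.nontrivial_of_finrank_pos h3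
  obtain ⟨d, hd⟩ := exists_ne (0 : LinearMap.ker (traceForm B))
  exact ⟨d, by simpa using hd, d.2⟩

omit [Fintype ι] [DecidableEq ι] in
/-- If the segment from a definite form `M` to `N` can be prolonged within the semidefinite cone,
then `N` is definite. -/
theorem posDef_of_ray {M N : Matrix ι ι ℝ} (hM : M.PosDef) {s : ℝ} (hs : 0 < s)
    (h : (N + s • (N - M)).PosSemidef) : N.PosDef := by
  have h1 := (hM.smul hs).add_posSemidef h
  have h2 : N = (1 + s)⁻¹ • (s • M + (N + s • (N - M))) := by
    have : (1 + s) ≠ 0 := by positivity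
    rw [eq_inv_smul_iff₀ this]
    module
  rw [h2]
  exact h1.smul (by positivity)

/-- The rim is the image of a punctured plane under radial projection from a definite point. -/
theorem isPreconnected_rim (hB : ∀ v, (B v).IsSymm) (hinj : ∀ v, B v = 0 → v = 0)
    {e : Fin 3 → ℝ} (he : (B e).PosDef) (he1 : traceForm B e = 1) : IsPreconnected (rim B) := by
  set E := LinearMap.ker (traceForm B) with hE
  have hrank : 1 < Module.rank ℝ E := by
    have h := (traceForm B).finrank_range_add_finrank_ker
    have h2 : Module.finrank ℝ (LinearMap.range (traceForm B)) ≤ 1 := by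
      simpa using Submodule.finrank_le (LinearMap.range (traceForm B))
    have h3 : 1 < Module.finrank ℝ E := by
      rw [hE]
      simp at h
      omega
    rw [← Module.finrank_eq_rank]
    exact_mod_cast h3
  set Ω : Set E := {d | (B (e + d)).PosSemidef} with hΩ
  have hcont : Continuous fun d : E => e + (d : Fin 3 → ℝ) := by fun_prop
  have hΩclosed : IsClosed Ω := (isClosed_posSemidef hB).preimage hcont
  have hopen : IsOpen {d : E | (B (e + d)).PosDef} := (isOpen_posDef hB).preimage hcont
  have hsub : {d : E | (B (e + d)).PosDef} ⊆ Ω := fun d hd => PosDef.posSemidef hd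
  have hΩ0 : Ω ∈ nhds (0 : E) :=
    Filter.mem_of_superset (hopen.mem_nhds (by simpa using he)) hsub
  have hΩconv : Convex ℝ Ω := by
    intro a ha b hb s t hs ht hst
    have := (PosSemidef.smul ha hs).add (PosSemidef.smul hb ht)
    rw [← map_smul, ← map_smul, ← map_add] at this
    rw [hΩ, Set.mem_ofPred_eq]
    convert this using 2
    push_cast
    have : e = (s + t) • e := by rw [hst, one_smul]
    nth_rewrite 1 [this]
    module
  have hint : ∀ d ∈ interior Ω, (B (e + d)).PosDef := by
    intro d hd
    have hc : Filter.Tendsto (fun s : ℝ => d + s • d) (nhds 0) (nhds d) := by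
      have : Continuous fun s : ℝ => d + s • d := by fun_prop
      simpa using this.tendsto 0
    have h1 := hc.eventually (mem_interior_iff_mem_nhds.1 hd)
    obtain ⟨ε, hε, h2⟩ := Metric.eventually_nhds_iff.1 h1
    have h3 : d + (ε / 2) • d ∈ Ω := h2 (by simp [abs_of_pos hε, hε])
    refine posDef_of_ray he (half_pos hε) ?_
    rw [← map_sub, ← map_smul, ← map_add]
    have h4 : (B (e + ((d + (ε / 2) • d : E) : Fin 3 → ℝ))).PosSemidef := h3
    convert h4 using 2
    push_cast
    module
  have hgauge : ∀ d : E, gauge Ω d = 1 ↔ (B (e + d)).PosSemidef ∧ (B (e + d)).det = 0 := by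
    intro d
    rw [gauge_eq_one_iff_mem_frontier hΩconv hΩ0, hΩclosed.frontier_eq]
    constructor
    · rintro ⟨h1, h2⟩
      refine ⟨h1, ?_⟩
      by_contra h3
      exact h2 (mem_interior.2 ⟨_, hsub, hopen, posDef_of_det_ne_zero h1 h3⟩)
    · rintro ⟨h1, h2⟩
      exact ⟨h1, fun h3 => det_ne_zero_of_posDef (hint d h3) h2⟩
  have hpos : ∀ d : E, d ≠ 0 → 0 < gauge Ω d := by
    intro d hd
    obtain ⟨t, ht, h1, h2⟩ := exists_ray_det_eq_zero hB hinj he.posSemidef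
      (d := (d : Fin 3 → ℝ)) (by simpa using hd) d.2
    have h3 := (hgauge (t • d)).2 ⟨h1, h2⟩
    rw [gauge_smul_of_nonneg ht, smul_eq_mul] at h3
    by_contra h4
    nlinarith
  -- The radial projection from `e` rescales `d` to gauge one.
  have himage : rim B = (fun d : E => e + (gauge Ω d)⁻¹ • (d : Fin 3 → ℝ)) '' {0}ᶜ := by
    ext w
    constructor
    · rintro ⟨h1, h2, h3⟩
      have hw : w - e ∈ E := by
        rw [hE, LinearMap.mem_ker, map_sub, h1, he1, sub_self]
      have hg : gauge Ω ⟨w - e, hw⟩ = 1 := (hgauge _).2 (by simpa using ⟨h2, h3⟩)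
      refine ⟨⟨w - e, hw⟩, ?_, by simp [hg]⟩
      intro h0
      rw [Set.mem_singleton_iff] at h0
      rw [h0, gauge_zero] at hg
      exact zero_ne_one hg
    · rintro ⟨d, hd, rfl⟩
      have h1 := hpos d hd
      have h2 := (hgauge ((gauge Ω d)⁻¹ • d)).1 (by
        rw [gauge_smul_of_nonneg (inv_nonneg.2 h1.le), smul_eq_mul, inv_mul_cancel₀ h1.ne'])
      refine ⟨?_, h2⟩
      rw [map_add, map_smul, he1, show traceForm B d = 0 from d.2]
      simp
  rw [himage]
  refine (isConnected_compl_singleton_of_one_lt_rank hrank 0).isPreconnected.image _ ?_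
  have hgc : Continuous (gauge Ω) := continuous_gauge hΩconv hΩ0
  have hgi : ContinuousOn (fun d : E => (gauge Ω d)⁻¹) {0}ᶜ :=
    hgc.continuousOn.inv₀ fun d hd => (hpos d hd).ne'
  fun_prop

variable [Nonempty ι]

omit [DecidableEq ι] in
theorem exists_normalized_posDef {e : Fin 3 → ℝ} (he : (B e).PosDef) :
    ∃ e' : Fin 3 → ℝ, (B e').PosDef ∧ traceForm B e' = 1 := by
  have h : 0 < traceForm B e := he.trace_pos
  refine ⟨(traceForm B e)⁻¹ • e, ?_, ?_⟩
  · rw [map_smul]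
    exact he.smul (inv_pos.2 h)
  · rw [map_smul, smul_eq_mul, inv_mul_cancel₀ h.ne']

variable (hB : ∀ v, (B v).IsSymm) (hinj : ∀ v, B v = 0 → v = 0) {e : Fin 3 → ℝ}
  (he : (B e).PosDef)

include hB hinj he

theorem rim_nonempty : (rim B).Nonempty := by
  obtain ⟨e, he, he1⟩ := exists_normalized_posDef he
  obtain ⟨d, hd, hd1⟩ := exists_trace_zero (B := B)
  obtain ⟨t, -, h1, h2⟩ := exists_ray_det_eq_zero hB hinj he.posSemidef hd hd1
  exact ⟨_, by simp [he1, hd1], h1, h2⟩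

theorem isPreconnected_boundary : IsPreconnected (boundary B) := by
  obtain ⟨e, he, he1⟩ := exists_normalized_posDef he
  have h := isPreconnected_rim hB hinj he he1
  have : PreconnectedSpace (rim B) := isPreconnected_iff_preconnectedSpace.1 h
  have hc : Continuous fun w : rim B =>
      (Projectivization.mk ℝ (w : Fin 3 → ℝ) (rim_ne_zero w.2) : RP 2) :=
    continuous_mk_comp continuous_subtype_val _
  convert isPreconnected_range hc
  ext y
  constructor
  · intro hy
    obtain ⟨w, hw, rfl⟩ := exists_mem_rim hinj hy
    exact ⟨⟨w, hw⟩, rfl⟩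
  · rintro ⟨w, rfl⟩
    exact mk_mem_boundary w.2

theorem boundary_nonempty : (boundary B).Nonempty := by
  obtain ⟨w, hw⟩ := rim_nonempty hB hinj he
  exact ⟨_, mk_mem_boundary hw⟩

omit hB in
/-- The boundary is null-homotopic: it contracts to a definite point within the affine chart
given by the trace. -/
theorem nullhomotopic_boundary :
    (⟨Subtype.val, continuous_subtype_val⟩ : C(boundary B, RP 2)).Nullhomotopic := by
  obtain ⟨e, he, he1⟩ := exists_normalized_posDef he
  have he0 : e ≠ 0 := by
    rintro rfl
    simp at he1
  have hne : ∀ y : boundary B, traceForm B (y : RP 2).rep ≠ 0 := fun y =>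
    traceForm_ne_zero hinj (y : RP 2).rep_nonzero y.2.1
  have hσ : Continuous fun y : boundary B =>
      (traceForm B (y : RP 2).rep)⁻¹ • (y : RP 2).rep := by
    rw [continuous_iff_continuousAt]
    intro y
    exact (continuousAt_normalize (traceForm B) (hne y)).comp
      (f := (Subtype.val : boundary B → RP 2)) continuous_subtype_val.continuousAt
  set φ : unitInterval × boundary B → Fin 3 → ℝ := fun z =>
    (1 - (z.1 : ℝ)) • ((traceForm B (z.2 : RP 2).rep)⁻¹ • (z.2 : RP 2).rep) + (z.1 : ℝ) • e with hφ
  have hφ1 : ∀ z, traceForm B (φ z) = 1 := by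
    intro z
    rw [hφ]
    simp only [map_add, map_smul, he1, smul_eq_mul, inv_mul_cancel₀ (hne z.2)]
    ring
  have hφ0 : ∀ z, φ z ≠ 0 := by
    intro z h
    have := hφ1 z
    rw [h] at this
    simp at this
  have hφc : Continuous φ := by
    have h2 := hσ.comp (continuous_snd (X := unitInterval))
    have h1 : Continuous fun z : unitInterval × boundary B => (z.1 : ℝ) := by fun_prop
    exact ((continuous_const.sub h1).smul h2).add (h1.smul continuous_const)
  refine ⟨Projectivization.mk ℝ e he0, ⟨⟨⟨_, continuous_mk_comp hφc hφ0⟩, ?_, ?_⟩⟩⟩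
  · intro y
    have : φ (0, y) = (traceForm B (y : RP 2).rep)⁻¹ • (y : RP 2).rep := by simp [hφ]
    simp only [this]
    rw [mk_smul_eq (y : RP 2).rep_nonzero, Projectivization.mk_rep]
    rfl
  · intro y
    have : φ (1, y) = e := by simp [hφ]
    simp only [this]
    rfl

/-- A plane spectrahedron is the convex hull of its boundary. -/
theorem convHull_boundary : convHull (boundary B) = region B := by
  ext y
  constructor
  · rintro ⟨l, hl, v, hv, rfl, hmem⟩
    obtain ⟨e, he, he1⟩ := exists_normalized_posDef he
    have hpre := isPreconnected_rim hB hinj he he1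
    have hlc : Continuous l := l.continuous_of_finiteDimensional
    have hlne : ∀ w ∈ rim B, l w ≠ 0 := by
      intro w hw h
      obtain ⟨c, -, h'⟩ := exists_smul_rep _ w (rim_ne_zero hw) rfl
      exact hl _ (mk_mem_boundary hw) (by rw [h', map_smul, h, smul_zero])
    -- The form `l` has constant sign on the connected rim.
    have hsign : (∀ w ∈ rim B, 0 < l w) ∨ (∀ w ∈ rim B, l w < 0) := by
      by_contra! h
      obtain ⟨⟨a, ha, ha'⟩, b, hb, hb'⟩ := h
      obtain ⟨c, hc, hc'⟩ := hpre.intermediate_value ha hb hlc.continuousOn ⟨ha', hb'⟩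
      exact hlne c hc hc'
    have hform : ∀ w, (l w = 1 ∧ ∃ hw : w ≠ 0, Projectivization.mk ℝ w hw ∈ boundary B) →
        ∃ k ∈ rim B, w = (l k)⁻¹ • k := by
      rintro w ⟨h1, hw, h2⟩
      obtain ⟨k, hk, h3⟩ := exists_mem_rim hinj h2
      obtain ⟨c, hc⟩ := (Projectivization.mk_eq_mk_iff' ℝ _ _ _ _).1 h3
      refine ⟨k, hk, ?_⟩
      rw [← hc, map_smul, smul_eq_mul] at h1
      rw [← hc, eq_inv_of_mul_eq_one_left h1]
    rw [mem_region_mk]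
    rcases hsign with h | h
    · left
      have hconv : Convex ℝ {w | (B w).PosSemidef} := by
        intro a ha b hb s t hs ht _
        rw [Set.mem_ofPred_eq, map_add, map_smul, map_smul]
        exact (PosSemidef.smul ha hs).add (PosSemidef.smul hb ht)
      refine convexHull_min ?_ hconv hmem
      intro w hw
      obtain ⟨k, hk, rfl⟩ := hform w hw
      rw [Set.mem_ofPred_eq, map_smul]
      exact hk.2.1.smul (inv_nonneg.2 (h k hk).le)
    · right
      have hconv : Convex ℝ {w | (-(B w)).PosSemidef} := by
        intro a ha b hb s t hs ht _
        rw [Set.mem_ofPred_eq, map_add, map_smul, map_smul, neg_add, ← smul_neg, ← smul_neg]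
        exact (PosSemidef.smul ha hs).add (PosSemidef.smul hb ht)
      refine convexHull_min ?_ hconv hmem
      intro w hw
      obtain ⟨k, hk, rfl⟩ := hform w hw
      rw [Set.mem_ofPred_eq, map_smul, ← neg_smul]
      exact hk.2.1.smul (neg_nonneg.2 (inv_nonpos.2 (h k hk).le))
  · intro hy
    obtain ⟨v, hv, rfl, hpsd, htr⟩ := exists_normalized hinj hy
    refine ⟨traceForm B, fun x hx => traceForm_ne_zero hinj x.rep_nonzero hx.1, v, hv, rfl, ?_⟩
    -- The point lies between the two boundary points in an arbitrary direction.
    obtain ⟨d, hd, hd1⟩ := exists_trace_zero (B := B)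
    obtain ⟨s, hs, h1, h2⟩ := exists_ray_det_eq_zero hB hinj hpsd hd hd1
    obtain ⟨t, ht, h3, h4⟩ := exists_ray_det_eq_zero hB hinj hpsd (neg_ne_zero.2 hd)
      (by rw [map_neg, hd1, neg_zero])
    set K : Set (Fin 3 → ℝ) :=
      {w | traceForm B w = 1 ∧ ∃ hw : w ≠ 0, Projectivization.mk ℝ w hw ∈ boundary B} with hK
    have hrim : rim B ⊆ K := fun w hw => ⟨hw.1, rim_ne_zero hw, mk_mem_boundary hw⟩
    have k1 : v + s • d ∈ convexHull ℝ K :=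
      subset_convexHull ℝ K (hrim ⟨by simp [htr, hd1], h1, h2⟩)
    have k2 : v + t • (-d) ∈ convexHull ℝ K :=
      subset_convexHull ℝ K (hrim ⟨by simp [htr, hd1], h3, h4⟩)
    rcases (add_nonneg hs ht).eq_or_lt with h0 | h0
    · have : s = 0 := by linarith
      rw [this] at k1
      simpa using k1
    · have := (convex_convexHull ℝ K) k1 k2 (div_nonneg ht h0.le) (div_nonneg hs h0.le)
        (by field_simp; ring)
      convert this using 1
      ext i
      simp
      field_simp
      ring

omit [Nonempty ι] hB in
/-- A singular form that is semidefinite leaves the semidefinite cone when a small multiple of a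
definite form is subtracted. -/
theorem notMem_interior_of_mem_boundary {y : RP 2} (hy : y ∈ boundary B) :
    y ∉ interior (region B) := by
  intro hint
  obtain ⟨w, hw, rfl⟩ := exists_mem_rim hinj hy
  have hw0 := rim_ne_zero hw
  have hdet := hw.2.2
  have h1 : ∀ᶠ s : ℝ in nhds 0, w - s • e ∈
      {v | ∃ hv : v ≠ 0, (Projectivization.mk ℝ v hv : RP 2) ∈ interior (region B)} ∩
        {v | 0 < traceForm B v} := by
    have hc : Continuous fun s : ℝ => w - s • e := by fun_prop
    have htc : Continuous (traceForm B) := (traceForm B).continuous_of_finiteDimensional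
    refine hc.continuousAt.eventually_mem (((isOpen_cone isOpen_interior).inter
      (isOpen_lt continuous_const htc)).mem_nhds ?_)
    rw [zero_smul, sub_zero]
    exact ⟨⟨rim_ne_zero hw, hint⟩, by simp [hw.1]⟩
  obtain ⟨ε, hε, h2⟩ := Metric.eventually_nhds_iff.1 h1
  obtain ⟨⟨h3, h4⟩, h5⟩ := h2 (y := ε / 2) (by simp [abs_of_pos hε, hε])
  have h6 := (mem_region_mk h3).1 (interior_subset h4)
  rcases h6 with h6 | h6
  · have := PosDef.posSemidef_add h6 (he.smul (half_pos hε))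
    rw [map_sub, map_smul, sub_add_cancel] at this
    exact det_ne_zero_of_posDef this hdet
  · have := h6.trace_nonneg
    rw [trace_neg, ← traceForm_apply] at this
    have h5' : 0 < traceForm B (w - (ε / 2) • e) := h5
    linarith

end Plane

/-! ### Taylor expansion of a form along a line -/

section Line

variable {σ K : Type*} [Field K]

/-- The restriction `F (z + T w)` of the polynomial `F` to a parametrized line, as a polynomial in
`T`.  Over the reals and in four variables this is `alongLine F w z`. -/
noncomputable def restrict (F : MvPolynomial σ K) (z w : σ → K) : Polynomial K :=
  MvPolynomial.aeval (fun i => Polynomial.C (z i) + Polynomial.X * Polynomial.C (w i)) F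

theorem eval_restrict (F : MvPolynomial σ K) (z w : σ → K) (t : K) :
    (restrict F z w).eval t = MvPolynomial.eval (z + t • w) F := by
  induction F using MvPolynomial.induction_on with
  | C a => simp [restrict]
  | add p q hp hq => simp only [restrict, map_add, Polynomial.eval_add] at *; rw [hp, hq]
  | mul_X p i hp =>
    simp only [restrict, map_mul, Polynomial.eval_mul] at *
    rw [hp]
    simp only [MvPolynomial.aeval_X, Polynomial.eval_add, Polynomial.eval_C, Polynomial.eval_mul,
      Polynomial.eval_X, MvPolynomial.eval_X, Pi.add_apply, Pi.smul_apply, smul_eq_mul]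

theorem restrict_coeff_zero (F : MvPolynomial σ K) (z w : σ → K) :
    (restrict F z w).coeff 0 = MvPolynomial.eval z F := by
  rw [Polynomial.coeff_zero_eq_eval_zero, eval_restrict, zero_smul, add_zero]

theorem restrict_mul (F G : MvPolynomial σ K) (z w : σ → K) :
    restrict (F * G) z w = restrict F z w * restrict G z w := map_mul _ _ _

theorem restrict_sub (F G : MvPolynomial σ K) (z w : σ → K) :
    restrict (F - G) z w = restrict F z w - restrict G z w := map_sub _ _ _

variable [Fintype σ]

theorem derivative_restrict (F : MvPolynomial σ K) (z w : σ → K) :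
    Polynomial.derivative (restrict F z w) =
      ∑ i, Polynomial.C (w i) * restrict (MvPolynomial.pderiv i F) z w := by
  classical
  induction F using MvPolynomial.induction_on with
  | C a => simp [restrict]
  | add p q hp hq =>
    simp only [restrict, map_add, mul_add, Finset.sum_add_distrib] at *
    rw [hp, hq]
  | mul_X p i hp =>
    simp only [restrict, map_mul, Derivation.leibniz, smul_eq_mul, map_add, mul_add,
      Finset.sum_add_distrib, Polynomial.derivative_mul] at *
    rw [hp]
    simp only [MvPolynomial.aeval_X, MvPolynomial.pderiv_X, Finset.sum_mul, Pi.single_apply]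
    rw [add_comm]
    congr 1
    · rw [Finset.sum_eq_single i]
      · simp; ring
      · intro b _ hb; simp [hb.symm]
      · simp
    · exact Finset.sum_congr rfl fun j _ => by ring

theorem restrict_coeff_one (F : MvPolynomial σ K) (z w : σ → K) :
    (restrict F z w).coeff 1 = ∑ i, w i * MvPolynomial.eval z (MvPolynomial.pderiv i F) := by
  have h := Polynomial.coeff_derivative (restrict F z w) 0
  rw [derivative_restrict, Polynomial.finsetSum_coeff] at h
  simp only [Polynomial.coeff_C_mul, restrict_coeff_zero] at h
  rw [h]
  simp

theorem isSingularAt_iff {n : ℕ} (F : MvPolynomial (Fin n) K) (z : Fin n → K) :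
    IsSingularAt F z ↔ MvPolynomial.eval z F = 0 ∧ ∀ w, (restrict F z w).coeff 1 = 0 := by
  classical
  refine and_congr_right fun _ => ⟨fun h w => ?_, fun h i => ?_⟩
  · rw [restrict_coeff_one]
    simp [h]
  · have := h (Pi.single i 1)
    rw [restrict_coeff_one, Finset.sum_eq_single i] at this
    · simpa using this
    · intro j _ hj
      simp [hj]
    · simp

theorem hessian_quad {n : ℕ} (F : MvPolynomial (Fin n) K) (z w : Fin n → K) :
    w ⬝ᵥ (hessian F z *ᵥ w) = 2 * (restrict F z w).coeff 2 := by
  have h1 := Polynomial.coeff_derivative (restrict F z w) 1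
  rw [derivative_restrict, Polynomial.finsetSum_coeff] at h1
  simp only [Polynomial.coeff_C_mul, restrict_coeff_one] at h1
  rw [mul_comm, show (2 : K) = ((1 : ℕ) : K) + 1 by norm_num, ← h1]
  simp only [dotProduct, mulVec, hessian, of_apply, Finset.mul_sum]
  rw [Finset.sum_comm]
  refine Finset.sum_congr rfl fun i _ => Finset.sum_congr rfl fun j _ => ?_
  ring

omit [Fintype σ] in
theorem pderiv_comm (F : MvPolynomial σ K) (i j : σ) :
    MvPolynomial.pderiv i (MvPolynomial.pderiv j F) =
      MvPolynomial.pderiv j (MvPolynomial.pderiv i F) := by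
  classical
  have h : ⁅MvPolynomial.pderiv (R := K) i, MvPolynomial.pderiv (R := K) j⁆ = 0 := by
    refine MvPolynomial.derivation_ext fun k => ?_
    rw [Derivation.commutator_apply, MvPolynomial.pderiv_X, MvPolynomial.pderiv_X]
    simp only [Pi.single_apply]
    split_ifs <;> simp
  have h2 := congrArg (fun D => D F) h
  rwa [Derivation.commutator_apply, Derivation.zero_apply, sub_eq_zero] at h2

theorem hessian_isSymm {n : ℕ} (F : MvPolynomial (Fin n) K) (z : Fin n → K) :
    (hessian F z).IsSymm := by
  ext i j
  simp only [hessian, transpose_apply, of_apply]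
  rw [pderiv_comm]

/-- A vector that is orthogonal to everything for the quadratic form of `H` is in its kernel. -/
theorem mulVec_eq_zero_of_polar {n : ℕ} [NeZero (2 : K)] {H : Matrix (Fin n) (Fin n) K}
    (hH : H.IsSymm) {u : Fin n → K}
    (h : ∀ w, (u + w) ⬝ᵥ (H *ᵥ (u + w)) = u ⬝ᵥ (H *ᵥ u) + w ⬝ᵥ (H *ᵥ w)) : H *ᵥ u = 0 := by
  have key : ∀ w, w ⬝ᵥ (H *ᵥ u) = 0 := by
    intro w
    have h1 := h w
    have h2 : u ⬝ᵥ (H *ᵥ w) = w ⬝ᵥ (H *ᵥ u) := by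
      rw [dotProduct_mulVec, ← mulVec_transpose, hH.eq, dotProduct_comm]
    rw [mulVec_add, add_dotProduct, dotProduct_add, dotProduct_add, h2] at h1
    have h3 : 2 * (w ⬝ᵥ (H *ᵥ u)) = 0 := by linear_combination h1
    exact (mul_eq_zero.1 h3).resolve_left two_ne_zero
  exact dotProduct_eq_zero _ fun w => by rw [dotProduct_comm]; exact key w

theorem finrank_le_one_of_rank_three {H : Matrix (Fin 4) (Fin 4) K} (hr : H.rank = 3)
    (W : Submodule K (Fin 4 → K)) (hW : ∀ w ∈ W, H *ᵥ w = 0) : Module.finrank K W ≤ 1 := by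
  have h1 := H.mulVecLin.finrank_range_add_finrank_ker
  rw [← Matrix.rank, hr] at h1
  have h2 : Module.finrank K W ≤ Module.finrank K (LinearMap.ker H.mulVecLin) :=
    Submodule.finrank_mono fun w hw => hW w hw
  simp at h1
  omega

theorem not_linearIndependent_of_rank_three {H : Matrix (Fin 4) (Fin 4) K} (hr : H.rank = 3)
    {u w : Fin 4 → K} (hu : H *ᵥ u = 0) (hw : H *ᵥ w = 0) : ¬ LinearIndependent K ![u, w] := by
  intro hli
  have h1 := finrank_le_one_of_rank_three hr (Submodule.span K (Set.range ![u, w])) ?_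
  · rw [finrank_span_eq_card hli] at h1
    simp at h1
  · intro v hv
    have : Submodule.span K (Set.range ![u, w]) ≤ LinearMap.ker H.mulVecLin := by
      rw [Submodule.span_le]
      rintro _ ⟨i, rfl⟩
      fin_cases i <;> simpa
    exact this hv

end Line

/-! ### Determinants of linear pencils of matrices -/

section Pencil

variable {ι κ K : Type*} [Fintype ι] [Fintype κ] [DecidableEq κ] [Field K]

/-- The member of the linear system of matrices `B` with coordinates `z`; for four `4 × 4` matrices
this is `linMat`. -/
def pencil (B : ι → Matrix κ κ K) (z : ι → K) : Matrix κ κ K := ∑ i, z i • B i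

/-- The determinant of the generic member of the linear system `B`. -/
noncomputable def pencilDet (B : ι → Matrix κ κ K) : MvPolynomial ι K :=
  (∑ i, (MvPolynomial.X i : MvPolynomial ι K) • (B i).map (MvPolynomial.C (σ := ι))).det

theorem detForm_eq_pencilDet (A : Fin 4 → Matrix (Fin 4) (Fin 4) K) :
    detForm A = pencilDet A := rfl

omit [Fintype κ] [DecidableEq κ] in
theorem pencil_add (B : ι → Matrix κ κ K) (z w : ι → K) :
    pencil B (z + w) = pencil B z + pencil B w := by
  simp [pencil, add_smul, Finset.sum_add_distrib]

omit [Fintype κ] [DecidableEq κ] in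
theorem pencil_smul (B : ι → Matrix κ κ K) (c : K) (w : ι → K) :
    pencil B (c • w) = c • pencil B w := by
  simp [pencil, mul_smul, Finset.smul_sum]

omit [Fintype κ] [DecidableEq κ] in
theorem pencil_isSymm {B : ι → Matrix κ κ K} (hB : ∀ i, (B i).IsSymm) (z : ι → K) :
    (pencil B z).IsSymm := by
  unfold pencil
  rw [IsSymm, transpose_sum]
  exact Finset.sum_congr rfl fun i _ => by rw [transpose_smul, (hB i).eq]

theorem restrict_pencilDet (B : ι → Matrix κ κ K) (z w : ι → K) :
    restrict (pencilDet B) z w =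
      ((pencil B z).map Polynomial.C +
        (Polynomial.X : Polynomial K) • (pencil B w).map Polynomial.C).det := by
  rw [restrict, pencilDet, AlgHom.map_det]
  congr 1
  ext1 i j
  simp only [AlgHom.mapMatrix_apply, map_apply, Matrix.sum_apply, Matrix.smul_apply, smul_eq_mul,
    map_sum, map_mul, MvPolynomial.aeval_X, pencil, Matrix.add_apply, Finset.mul_sum]
  rw [← Finset.sum_add_distrib]
  refine Finset.sum_congr rfl fun k _ => ?_
  simp
  ring

theorem eval_pencilDet (B : ι → Matrix κ κ K) (z : ι → K) :
    MvPolynomial.eval z (pencilDet B) = (pencil B z).det := by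
  rw [pencilDet, RingHom.map_det]
  congr 1
  ext1 i j
  simp [Matrix.sum_apply, pencil]

theorem pencilDet_isHomogeneous (B : ι → Matrix κ κ K) :
    (pencilDet B).IsHomogeneous (Fintype.card κ) := by
  rw [pencilDet, det_apply]
  refine MvPolynomial.IsHomogeneous.sum _ _ _ fun τ _ => ?_
  have h : (∏ i, (∑ k, (MvPolynomial.X k : MvPolynomial ι K) • (B k).map (MvPolynomial.C (σ := ι)))
      (τ i) i).IsHomogeneous (∑ _i : κ, 1) := by
    refine MvPolynomial.IsHomogeneous.prod _ _ _ fun i _ => ?_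
    rw [Matrix.sum_apply]
    refine MvPolynomial.IsHomogeneous.sum _ _ _ fun k _ => ?_
    simpa using
      (MvPolynomial.isHomogeneous_X K k).mul (MvPolynomial.isHomogeneous_C ι (B k (τ i) i))
  simp only [Finset.sum_const, smul_eq_mul, mul_one] at h
  rcases Int.units_eq_one_or (Equiv.Perm.sign τ) with h1 | h1
  · rw [h1, one_smul]; exact h
  · rw [h1]; simpa using h.neg

theorem map_pencilDet {K' : Type*} [Field K'] (φ : K →+* K') (B : ι → Matrix κ κ K) :
    MvPolynomial.map φ (pencilDet B) = pencilDet fun i => (B i).map φ := by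
  rw [pencilDet, RingHom.map_det, pencilDet]
  congr 1
  ext1 i j
  simp [Matrix.sum_apply]

end Pencil

/-! ### The quartic near a node in normal form -/

section Node

variable {K : Type*} [Field K]

theorem corner_map {R R' : Type*} [CommRing R] [CommRing R'] (φ : R →+* R') (d₁ d₂ d₃ : R) :
    (corner d₁ d₂ d₃).map φ = corner (φ d₁) (φ d₂) (φ d₃) := by
  ext i j
  fin_cases i <;> fin_cases j <;> simp [corner]

theorem det_map_C {κ : Type*} [Fintype κ] [DecidableEq κ] (M : Matrix κ κ K) :
    (M.map Polynomial.C).det = Polynomial.C M.det := (RingHom.map_det Polynomial.C M).symm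

/-- The coefficient of `T` in the polynomial `det (m + T D)`, where `D = corner d₁ d₂ d₃`. -/
def linearCoeff {R : Type*} [CommRing R] (d₁ d₂ d₃ : R) (m : Matrix (Fin 4) (Fin 4) R) : R :=
  d₁ * (face₂ m).det + d₂ * (face₁ m).det - 2 * d₃ * (mixed m).det

variable {A : Fin 4 → Matrix (Fin 4) (Fin 4) K} (hA : ∀ i, (A i).IsSymm) {p : Fin 4 → K}
  {d₁ d₂ d₃ : K} (hp : pencil A p = corner d₁ d₂ d₃)

include hA hp

theorem restrict_through_node (z : Fin 4 → K) :
    restrict (pencilDet A) z p = Polynomial.C (pencil A z).det +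
      Polynomial.C (linearCoeff d₁ d₂ d₃ (pencil A z)) * Polynomial.X +
      Polynomial.C ((d₁ * d₂ - d₃ ^ 2) * (lower (pencil A z)).det) * Polynomial.X ^ 2 := by
  have hs : ((pencil A z).map Polynomial.C).IsSymm := (pencil_isSymm hA z).map _
  have h := det_pencil hs 1 Polynomial.X (Polynomial.C d₁) (Polynomial.C d₂) (Polynomial.C d₃)
  rw [restrict_pencilDet, hp, corner_map Polynomial.C, ← one_smul (Polynomial K)
    ((pencil A z).map Polynomial.C), h]
  have e1 : (face₁ ((pencil A z).map Polynomial.C)).det = Polynomial.C (face₁ (pencil A z)).det :=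
    det_map_C _
  have e2 : (face₂ ((pencil A z).map Polynomial.C)).det = Polynomial.C (face₂ (pencil A z)).det :=
    det_map_C _
  have e3 : (mixed ((pencil A z).map Polynomial.C)).det = Polynomial.C (mixed (pencil A z)).det :=
    det_map_C _
  have e4 : (lower ((pencil A z).map Polynomial.C)).det = Polynomial.C (lower (pencil A z)).det :=
    det_map_C _
  rw [e1, e2, e3, e4, det_map_C]
  simp only [linearCoeff, map_mul, map_add, map_sub, map_pow, map_ofNat]
  ring

theorem restrict_at_node_coeff_two (w : Fin 4 → K) :
    (restrict (pencilDet A) p w).coeff 2 = (d₁ * d₂ - d₃ ^ 2) * (lower (pencil A w)).det := by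
  have hs : ((pencil A w).map Polynomial.C).IsSymm := (pencil_isSymm hA w).map _
  have h := det_pencil hs Polynomial.X 1 (Polynomial.C d₁) (Polynomial.C d₂) (Polynomial.C d₃)
  rw [restrict_pencilDet, hp, corner_map Polynomial.C, add_comm, ← one_smul (Polynomial K)
    (corner (Polynomial.C d₁) (Polynomial.C d₂) (Polynomial.C d₃)), h]
  have e1 : (face₁ ((pencil A w).map Polynomial.C)).det = Polynomial.C (face₁ (pencil A w)).det :=
    det_map_C _
  have e2 : (face₂ ((pencil A w).map Polynomial.C)).det = Polynomial.C (face₂ (pencil A w)).det :=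
    det_map_C _
  have e3 : (mixed ((pencil A w).map Polynomial.C)).det = Polynomial.C (mixed (pencil A w)).det :=
    det_map_C _
  have e4 : (lower ((pencil A w).map Polynomial.C)).det = Polynomial.C (lower (pencil A w)).det :=
    det_map_C _
  rw [e1, e2, e3, e4, det_map_C]
  have : (Polynomial.X ^ 4 * Polynomial.C (pencil A w).det + Polynomial.X ^ 3 * 1 *
      (Polynomial.C d₁ * Polynomial.C (face₂ (pencil A w)).det +
        Polynomial.C d₂ * Polynomial.C (face₁ (pencil A w)).det -
        2 * Polynomial.C d₃ * Polynomial.C (mixed (pencil A w)).det) +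
      Polynomial.X ^ 2 * 1 ^ 2 * ((Polynomial.C d₁ * Polynomial.C d₂ - Polynomial.C d₃ ^ 2) *
        Polynomial.C (lower (pencil A w)).det) : Polynomial K) =
      Polynomial.C (pencil A w).det * Polynomial.X ^ 4 +
      Polynomial.C (linearCoeff d₁ d₂ d₃ (pencil A w)) * Polynomial.X ^ 3 +
      Polynomial.C ((d₁ * d₂ - d₃ ^ 2) * (lower (pencil A w)).det) * Polynomial.X ^ 2 := by
    simp only [linearCoeff, map_mul, map_add, map_sub, map_pow, map_ofNat]
    ring
  rw [this]
  simp only [Polynomial.coeff_add, Polynomial.coeff_C_mul, Polynomial.coeff_X_pow]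
  norm_num

/-- If the three coefficients of the quartic on a line through the node vanish, then the line lies
on the surface. -/
theorem eq_zero_of_coeffs {z : Fin 4 → K} (h0 : (pencil A z).det = 0)
    (h1 : linearCoeff d₁ d₂ d₃ (pencil A z) = 0) (h2 : (lower (pencil A z)).det = 0) (s t : K) :
    MvPolynomial.eval (s • p + t • z) (pencilDet A) = 0 := by
  rw [eval_pencilDet, pencil_add, pencil_smul, pencil_smul, hp, add_comm,
    det_pencil (pencil_isSymm hA z), h0, h2]
  rw [linearCoeff] at h1
  rw [h1]
  ring

variable [NeZero (2 : K)] (hH : (hessian (pencilDet A) p).rank = 3)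

include hH

/-- The tangent cone at the node is nondegenerate: its polar form vanishes at `u` only if `u`
lies over the node. -/
theorem not_linearIndependent_of_polar {u : Fin 4 → K}
    (hu : ∀ w, (lower (pencil A (u + w))).det =
      (lower (pencil A u)).det + (lower (pencil A w)).det) :
    ¬ LinearIndependent K ![p, u] := by
  have hq : ∀ w, w ⬝ᵥ (hessian (pencilDet A) p *ᵥ w) =
      2 * ((d₁ * d₂ - d₃ ^ 2) * (lower (pencil A w)).det) := fun w => by
    rw [hessian_quad, restrict_at_node_coeff_two hA hp]
  have hsymm := hessian_isSymm (pencilDet A) p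
  refine not_linearIndependent_of_rank_three hH (mulVec_eq_zero_of_polar hsymm fun w => ?_)
    (mulVec_eq_zero_of_polar hsymm fun w => ?_)
  · rw [hq, hq, hq, pencil_add, hp, lower_add, lower_corner, zero_add]
    simp
  · rw [hq, hq, hq, hu]
    ring

theorem not_linearIndependent_of_lower_eq_zero {u : Fin 4 → K} (hu : lower (pencil A u) = 0) :
    ¬ LinearIndependent K ![p, u] := by
  refine not_linearIndependent_of_polar hA hp hH fun w => ?_
  rw [pencil_add, lower_add, hu, zero_add]
  simp

end Node

/-! ### Smoothness of the ramification cubics -/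

section Smooth

variable {K : Type*} [Field K] {A : Fin 4 → Matrix (Fin 4) (Fin 4) K} (hA : ∀ i, (A i).IsSymm)

include hA in
/-- The Desnanot–Jacobi identity for the generic member of the linear system. -/
theorem pencilDet_mul_lower :
    pencilDet A * pencilDet (fun i => lower (A i)) =
      pencilDet (fun i => face₁ (A i)) * pencilDet (fun i => face₂ (A i)) -
        pencilDet (fun i => mixed (A i)) ^ 2 := by
  set m : Matrix (Fin 4) (Fin 4) (MvPolynomial (Fin 4) K) :=
    ∑ i, (MvPolynomial.X i : MvPolynomial (Fin 4) K) • (A i).map MvPolynomial.C with hm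
  have hs : m.IsSymm := by
    rw [hm, IsSymm, transpose_sum]
    exact Finset.sum_congr rfl fun i _ => by rw [transpose_smul, ← transpose_map, (hA i).eq]
  have h := det_mul_det_lower hs
  have e1 : pencilDet (fun i => lower (A i)) = (lower m).det := by
    rw [pencilDet]
    congr 1
  have e2 : pencilDet (fun i => face₁ (A i)) = (face₁ m).det := by
    rw [pencilDet]
    congr 1
  have e3 : pencilDet (fun i => face₂ (A i)) = (face₂ m).det := by
    rw [pencilDet]
    congr 1
  have e4 : pencilDet (fun i => mixed (A i)) = (mixed m).det := by
    rw [pencilDet]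
    congr 1
  rw [e1, e2, e3, e4, ← h]
  rfl

theorem pencil_face₁ (z : Fin 4 → K) : pencil (fun i => face₁ (A i)) z = face₁ (pencil A z) := by
  ext1 i j
  simp only [pencil, face₁, submatrix_apply, Matrix.sum_apply, Matrix.smul_apply]

theorem pencil_face₂ (z : Fin 4 → K) : pencil (fun i => face₂ (A i)) z = face₂ (pencil A z) := by
  ext1 i j
  simp only [pencil, face₂, submatrix_apply, Matrix.sum_apply, Matrix.smul_apply]

theorem pencil_mixed (z : Fin 4 → K) : pencil (fun i => mixed (A i)) z = mixed (pencil A z) := by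
  ext1 i j
  simp only [pencil, mixed, submatrix_apply, Matrix.sum_apply, Matrix.smul_apply]

theorem pencil_lower (z : Fin 4 → K) : pencil (fun i => lower (A i)) z = lower (pencil A z) := by
  ext1 i j
  simp only [pencil, lower, submatrix_apply, Matrix.sum_apply, Matrix.smul_apply]

theorem det_submatrix_eq_zero_of_rank {M : Matrix (Fin 4) (Fin 4) K} (h : M.rank = 2)
    (a b : Fin 3 → Fin 4) : (M.submatrix a b).det = 0 := by
  by_contra hd
  have h1 : (M.submatrix a b).rank = 3 := by
    simpa using rank_of_isUnit _ ((isUnit_iff_isUnit_det _).2 (isUnit_iff_ne_zero.2 hd))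
  have h2 : M.submatrix a b =
      (1 : Matrix (Fin 4) (Fin 4) K).submatrix a id * M *
        (1 : Matrix (Fin 4) (Fin 4) K).submatrix id b := by
    ext i j
    simp [Matrix.mul_apply, Matrix.one_apply]
  have h3 : (M.submatrix a b).rank ≤ M.rank := by
    rw [h2]
    exact (rank_mul_le_left _ _).trans (rank_mul_le_right _ _)
  omega

theorem coeff_mul_two (P Q : Polynomial K) : (P * Q).coeff 2 =
    P.coeff 0 * Q.coeff 2 + P.coeff 1 * Q.coeff 1 + P.coeff 2 * Q.coeff 0 := by
  rw [Polynomial.coeff_mul,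
    show Finset.HasAntidiagonal.antidiagonal 2 =
      ({(0, 2), (1, 1), (2, 0)} : Finset (ℕ × ℕ)) from rfl]
  simp
  ring

theorem coeff_mul_one (P Q : Polynomial K) : (P * Q).coeff 1 =
    P.coeff 0 * Q.coeff 1 + P.coeff 1 * Q.coeff 0 := by
  rw [Polynomial.coeff_mul, show Finset.HasAntidiagonal.antidiagonal 1 =
    ({(0, 1), (1, 0)} : Finset (ℕ × ℕ)) from rfl]
  simp

variable [NeZero (2 : K)] {p : Fin 4 → K} (hp : pencil A p = corner 0 0 1)
  (hH : (hessian (pencilDet A) p).rank = 3)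
  (hnodal : ∀ z : Fin 4 → K, z ≠ 0 → IsSingularAt (pencilDet A) z →
    IsNodeAt (pencilDet A) z ∧ (pencil A z).rank = 2)
  (hline : ∀ z : Fin 4 → K, LinearIndependent K ![p, z] →
    ∃ s t : K, MvPolynomial.eval (s • p + t • z) (pencilDet A) ≠ 0)

include hA hp hH hnodal hline

/-- The cubic `det (face₁ A)` is smooth outside the centre of projection.  At a critical zero `z`
off the tangent cone, the point of the line over `z` at which the mixed minor vanishes is a
singular point of the quartic, and the Desnanot–Jacobi identity gives it a Hessian of rank at
most one.  At a critical zero on the tangent cone, the tangent cone itself would be singular. -/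
theorem face₁_smooth {z : Fin 4 → K} (hz : LinearIndependent K ![p, z])
    (hF : (face₁ (pencil A z)).det = 0)
    (hdF : ∀ w, (restrict (pencilDet fun i => face₁ (A i)) z w).coeff 1 = 0) : False := by
  have hfac : ∀ c : K, face₁ (pencil A (z + c • p)) = face₁ (pencil A z) := by
    intro c
    rw [pencil_add, pencil_smul, hp]
    ext i j
    fin_cases i <;> fin_cases j <;> simp [face₁, corner]
  have hlow : ∀ c : K, lower (pencil A (z + c • p)) = lower (pencil A z) := by
    intro c
    rw [pencil_add, pencil_smul, hp]
    ext i j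
    fin_cases i <;> fin_cases j <;> simp [lower, corner]
  have hmix : ∀ c : K, (mixed (pencil A (z + c • p))).det =
      (mixed (pencil A z)).det + c * (lower (pencil A z)).det := by
    intro c
    rw [pencil_add, pencil_smul, hp, det_fin_three, det_fin_three, det_fin_two]
    simp only [mixed, lower, corner, submatrix_apply, Matrix.add_apply, Matrix.smul_apply, of_apply,
      cons_val_zero, cons_val_one, cons_val, smul_eq_mul, mul_zero, add_zero, mul_one]
    ring
  have hdes := pencilDet_mul_lower hA
  have hprod : ∀ x w : Fin 4 → K, restrict (pencilDet A) x w *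
      restrict (pencilDet fun i => lower (A i)) x w =
      restrict (pencilDet fun i => face₁ (A i)) x w * restrict (pencilDet fun i => face₂ (A i)) x w
        - restrict (pencilDet fun i => mixed (A i)) x w *
          restrict (pencilDet fun i => mixed (A i)) x w := by
    intro x w
    rw [← restrict_mul, hdes, pow_two, restrict_sub, restrict_mul, restrict_mul]
  by_cases hr : (lower (pencil A z)).det = 0
  · -- The critical zero lies on the tangent cone.
    have hg : (mixed (pencil A z)).det = 0 := by
      have := det_mul_det_lower (pencil_isSymm hA z)
      rw [hr, hF] at this
      exact pow_eq_zero_iff two_ne_zero |>.1 (by linear_combination this)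
    have hc : (pencil A z).det ≠ 0 := by
      intro h0
      obtain ⟨s, t, h⟩ := hline z hz
      exact h (eq_zero_of_coeffs hA hp h0 (by rw [linearCoeff, hg]; ring) hr s t)
    refine not_linearIndependent_of_polar hA hp hH (u := z) (fun w => ?_) hz
    have h1 := congrArg (fun P => Polynomial.coeff P 1) (hprod z w)
    simp only [Polynomial.coeff_sub, coeff_mul_one, restrict_coeff_zero, eval_pencilDet,
      pencil_lower, pencil_face₁, pencil_face₂, pencil_mixed, hr, hF, hg, hdF] at h1
    have h2 : (restrict (pencilDet fun i => lower (A i)) z w).coeff 1 = 0 := by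
      have : (pencil A z).det * (restrict (pencilDet fun i => lower (A i)) z w).coeff 1 = 0 := by
        linear_combination h1
      exact (mul_eq_zero.1 this).resolve_left hc
    have hexp : ((lower (pencil A z)).map Polynomial.C + (Polynomial.X : Polynomial K) •
        (lower (pencil A w)).map Polynomial.C).det = Polynomial.C (lower (pencil A z)).det +
        Polynomial.C ((lower (pencil A z + pencil A w)).det - (lower (pencil A z)).det -
          (lower (pencil A w)).det) * Polynomial.X +
        Polynomial.C (lower (pencil A w)).det * Polynomial.X ^ 2 := by
      rw [lower_add]
      simp only [det_fin_two, Matrix.add_apply, Matrix.smul_apply, map_apply, smul_eq_mul, map_add,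
        map_sub, map_mul]
      ring
    rw [restrict_pencilDet, pencil_lower, pencil_lower, hexp] at h2
    simp at h2
    rw [pencil_add]
    linear_combination h2
  · -- The point of the line over the critical zero at which the mixed minor vanishes.
    set x := z + (-(mixed (pencil A z)).det / (lower (pencil A z)).det) • p with hx
    have hxF : (face₁ (pencil A x)).det = 0 := by rw [hx, hfac, hF]
    have hxr : (lower (pencil A x)).det ≠ 0 := by rwa [hx, hlow]
    have hxg : (mixed (pencil A x)).det = 0 := by
      rw [hx, hmix]
      field_simp
      ring
    have hxdF : ∀ w, (restrict (pencilDet fun i => face₁ (A i)) x w).coeff 1 = 0 := by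
      intro w
      have := hdF w
      rw [restrict_pencilDet, pencil_face₁] at this ⊢
      rwa [hx, hfac]
    have hx0 : x ≠ 0 := by
      intro h0
      apply hxr
      rw [h0]
      rw [det_fin_two]
      simp [pencil, lower]
    have hxf : (pencil A x).det = 0 := by
      have := det_mul_det_lower (pencil_isSymm hA x)
      rw [hxF, hxg] at this
      exact (mul_eq_zero.1 (this.trans (by ring))).resolve_right hxr
    have hsing : IsSingularAt (pencilDet A) x := by
      rw [isSingularAt_iff]
      refine ⟨by rw [eval_pencilDet, hxf], fun w => ?_⟩
      have h1 := congrArg (fun P => Polynomial.coeff P 1) (hprod x w)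
      simp only [Polynomial.coeff_sub, coeff_mul_one, restrict_coeff_zero, eval_pencilDet,
        pencil_lower, pencil_face₁, pencil_face₂, pencil_mixed, hxf, hxF, hxg, hxdF] at h1
      exact (mul_eq_zero.1 ((by linear_combination h1 :
        (restrict (pencilDet A) x w).coeff 1 * (lower (pencil A x)).det = 0))).resolve_right hxr
    obtain ⟨⟨-, hrank⟩, hrank2⟩ := hnodal x hx0 hsing
    have hxG : (face₂ (pencil A x)).det = 0 := det_submatrix_eq_zero_of_rank hrank2 _ _
    have hquad : ∀ w, (restrict (pencilDet A) x w).coeff 2 * (lower (pencil A x)).det =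
        - (restrict (pencilDet fun i => mixed (A i)) x w).coeff 1 ^ 2 := by
      intro w
      have h1 := congrArg (fun P => Polynomial.coeff P 2) (hprod x w)
      have h2 := (isSingularAt_iff _ _).1 hsing |>.2 w
      simp only [Polynomial.coeff_sub, coeff_mul_two, restrict_coeff_zero, eval_pencilDet,
        pencil_lower, pencil_face₁, pencil_face₂, pencil_mixed, hxf, hxF, hxG, hxg, hxdF,
        h2] at h1
      linear_combination h1
    -- By `hquad` the Hessian is a multiple of the square of the linear form `ℓ`, so that it
    -- vanishes on the kernel of `ℓ`, which is too large for a node.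
    let ℓ : (Fin 4 → K) →ₗ[K] K := ∑ i, (MvPolynomial.eval x (MvPolynomial.pderiv i
      (pencilDet fun i => mixed (A i)))) • LinearMap.proj i
    have hℓ : ∀ w, (restrict (pencilDet fun i => mixed (A i)) x w).coeff 1 = ℓ w := by
      intro w
      rw [restrict_coeff_one]
      simp only [ℓ, LinearMap.sum_apply, LinearMap.smul_apply, LinearMap.proj_apply, smul_eq_mul]
      exact Finset.sum_congr rfl fun i _ => mul_comm _ _
    have hle := finrank_le_one_of_rank_three hrank (LinearMap.ker ℓ) fun u hu => by
      refine mulVec_eq_zero_of_polar (hessian_isSymm _ _) fun w => ?_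
      rw [hessian_quad, hessian_quad, hessian_quad]
      have h1 := hquad (u + w)
      have h2 := hquad u
      have h3 := hquad w
      rw [hℓ] at h1 h2 h3
      rw [LinearMap.mem_ker] at hu
      rw [map_add, hu] at h1
      rw [hu] at h2
      refine mul_right_cancel₀ hxr ?_
      linear_combination 2 * h1 - 2 * h2 - 2 * h3
    have hrn := ℓ.finrank_range_add_finrank_ker
    have h2 : Module.finrank K (LinearMap.range ℓ) ≤ 1 := by
      simpa using Submodule.finrank_le (LinearMap.range ℓ)
    simp at hrn
    omega

/-- Exchanging the first two coordinates turns `face₁_smooth` into the statement for the other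
face. -/
theorem face₂_smooth {z : Fin 4 → K} (hz : LinearIndependent K ![p, z])
    (hF : (face₂ (pencil A z)).det = 0)
    (hdF : ∀ w, (restrict (pencilDet fun i => face₂ (A i)) z w).coeff 1 = 0) : False := by
  set A' : Fin 4 → Matrix (Fin 4) (Fin 4) K :=
    fun i => (A i).submatrix (Equiv.swap 0 1) (Equiv.swap 0 1) with hA'
  have hpen : ∀ w, pencil A' w = (pencil A w).submatrix (Equiv.swap 0 1) (Equiv.swap 0 1) := by
    intro w
    ext1 i j
    simp only [hA', pencil, submatrix_apply, Matrix.sum_apply, Matrix.smul_apply]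
  have hface : ∀ m : Matrix (Fin 4) (Fin 4) K,
      face₁ (m.submatrix (Equiv.swap 0 1) (Equiv.swap 0 1)) = face₂ m := by
    intro m
    ext i j
    fin_cases i <;> fin_cases j <;>
      simp [face₁, face₂, Equiv.swap_apply_of_ne_of_ne]
  have hdet : pencilDet A' = pencilDet A := by
    rw [pencilDet, pencilDet, ← det_submatrix_equiv_self (Equiv.swap (0 : Fin 4) 1)
      (∑ i, (MvPolynomial.X i : MvPolynomial (Fin 4) K) • (A i).map MvPolynomial.C)]
    congr 1
  refine face₁_smooth (A := A') (fun i => (hA i).submatrix _) (p := p) ?_ (by rwa [hdet]) ?_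
    (by rwa [hdet]) hz (by rwa [hpen, hface]) ?_
  · rw [hpen, hp]
    ext i j
    fin_cases i <;> fin_cases j <;> simp [corner, Equiv.swap_apply_of_ne_of_ne]
  · intro w hw hs
    rw [hdet] at hs ⊢
    obtain ⟨h1, h2⟩ := hnodal w hw hs
    exact ⟨h1, by rw [hpen, rank_submatrix]; exact h2⟩
  · intro w
    simp only [hA', hface]
    exact hdF w

end Smooth

/-! ### Ovals of determinantal cubics -/

section Oval

variable {κ : Type*}

/-- The linear map that parametrizes a linear system of real matrices. -/
noncomputable def pencilₗ {n : ℕ} (B : Fin (n + 1) → Matrix κ κ ℝ) :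
    (Fin (n + 1) → ℝ) →ₗ[ℝ] Matrix κ κ ℝ where
  toFun := pencil B
  map_add' := pencil_add B
  map_smul' := pencil_smul B

theorem pencilₗ_apply {n : ℕ} (B : Fin (n + 1) → Matrix κ κ ℝ) (v : Fin (n + 1) → ℝ) :
    pencilₗ B v = pencil B v := rfl

theorem restrict_coeff_one_three {B : Fin 3 → Matrix (Fin 3) (Fin 3) ℝ} (hB : ∀ i, (B i).IsSymm)
    (v w : Fin 3 → ℝ) :
    (restrict (pencilDet B) v w).coeff 1 = polarDet (pencil B v) (pencil B w) := by
  have h1 : ((pencil B v).map (Polynomial.C (R := ℝ))).IsSymm := (pencil_isSymm hB v).map _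
  have h2 : ((pencil B w).map (Polynomial.C (R := ℝ))).IsSymm := (pencil_isSymm hB w).map _
  have h3 : ∀ M N : Matrix (Fin 3) (Fin 3) ℝ,
      polarDet (M.map Polynomial.C) (N.map Polynomial.C) = Polynomial.C (polarDet M N) := by
    intro M N
    simp only [polarDet, map_apply, map_add, map_mul, map_sub, map_pow, map_ofNat]
  rw [restrict_pencilDet, det_add_smul h1 h2, h3, h3, det_map_C, det_map_C,
    mul_comm Polynomial.X, mul_comm (Polynomial.X ^ 2), mul_comm (Polynomial.X ^ 3)]
  simp only [Polynomial.coeff_add, Polynomial.coeff_C_mul, Polynomial.coeff_X_pow,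
    Polynomial.coeff_C, Polynomial.coeff_X]
  norm_num

/-- The boundary of the plane spectrahedron of a smooth determinantal cubic is an oval: among the
real points of the cubic, those of the boundary are the ones with positive `minorSum`. -/
theorem isOval_boundary {B : Fin 3 → Matrix (Fin 3) (Fin 3) ℝ} (hB : ∀ i, (B i).IsSymm)
    (hinj : ∀ v, pencil B v = 0 → v = 0) {e : Fin 3 → ℝ} (he : (pencil B e).PosDef)
    (hsmooth : ∀ v : Fin 3 → ℝ, v ≠ 0 → ¬ IsSingularAt (pencilDet B) v)
    {F : MvPolynomial (Fin 3) ℝ} {c : ℝ} (hc : c ≠ 0)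
    (hF : ∀ v, MvPolynomial.eval v F = c * (pencil B v).det) :
    IsOval F (boundary (pencilₗ B)) := by
  have hB' : ∀ v, (pencilₗ B v).IsSymm := fun v => pencil_isSymm hB v
  have hcurve : ∀ y : RP 2, y ∈ realCurve F ↔ (pencil B y.rep).det = 0 := by
    intro y
    rw [realCurve, Set.mem_ofPred_eq, hF]
    simp [hc]
  have hsub : boundary (pencilₗ B) ⊆ realCurve F := fun y hy => (hcurve y).2 hy.2
  have hpos : ∀ y : RP 2, y ∈ boundary (pencilₗ B) → 0 < minorSum (pencil B y.rep) := by
    intro y hy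
    by_contra! h
    refine hsmooth _ y.rep_nonzero ((isSingularAt_iff _ _).2 ⟨?_, fun w => ?_⟩)
    · rw [eval_pencilDet]
      exact hy.2
    · rw [restrict_coeff_one_three hB]
      exact polarDet_eq_zero hy.1 hy.2 h _
  obtain ⟨y, hy⟩ := boundary_nonempty hB' hinj he
  refine ⟨⟨y, hsub hy, Set.Subset.antisymm ?_ ?_⟩, nullhomotopic_boundary hinj he⟩
  · exact (isPreconnected_boundary hB' hinj he).subset_connectedComponentIn hy hsub
  · set u : Set (RP 2) := {y | 0 < minorSum (pencil B y.rep)} with hu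
    have huo : IsOpen u := by
      refine isOpen_of_homogeneous (P := fun v => 0 < minorSum (pencil B v)) ?_ ?_
      · intro c hc v
        have : minorSum (pencil B (c • v)) = c ^ 2 * minorSum (pencil B v) := by
          rw [pencil_smul]
          simp only [minorSum, Matrix.smul_apply, smul_eq_mul]
          ring
        rw [this]
        have : 0 < c ^ 2 := by positivity
        exact mul_pos_iff_of_pos_left this
      · have hBc : Continuous (pencilₗ B) := (pencilₗ B).continuous_of_finiteDimensional
        have hBc' : Continuous fun v => pencil B v := hBc
        refine isOpen_lt continuous_const ?_
        unfold minorSum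
        fun_prop
    have hvo : IsOpen (region (pencilₗ B))ᶜ := (isClosed_region hB').isOpen_compl
    intro x hx
    have hxF := connectedComponentIn_subset _ _ hx
    have hcover : connectedComponentIn (realCurve F) y ⊆ u ∪ (region (pencilₗ B))ᶜ := by
      intro z hz
      have hzF := (hcurve z).1 (connectedComponentIn_subset _ _ hz)
      by_cases h : z ∈ region (pencilₗ B)
      · exact .inl (hpos z ⟨h, hzF⟩)
      · exact .inr h
    by_contra hxb
    obtain ⟨z, hz, hzu, hzv⟩ := isPreconnected_connectedComponentIn _ _ huo hvo hcover
      ⟨y, mem_connectedComponentIn (hsub hy), hpos y hy⟩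
      ⟨x, hx, fun h => hxb ⟨h, (hcurve x).1 hxF⟩⟩
    have hzF := (hcurve z).1 (connectedComponentIn_subset _ _ hz)
    exact hzv (semidef_of_minorSum_pos (pencil_isSymm hB _) hzF hzu)

end Oval

/-! ### Real and complex points -/

section Complexification

/-- A real vector, regarded as a complex one. -/
def toComplex {n : ℕ} (v : Fin n → ℝ) : Fin n → ℂ := fun i => (v i : ℂ)

theorem complexPoint_eq {n : ℕ} (x : RP n) : complexPoint x = toComplex x.rep := rfl

theorem complexify_isSymm {A : Fin 4 → Matrix (Fin 4) (Fin 4) ℝ} (hA : ∀ i, (A i).IsSymm)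
    (i : Fin 4) : (complexify A i).IsSymm := (hA i).map _

theorem pencil_complexify (A : Fin 4 → Matrix (Fin 4) (Fin 4) ℝ) (v : Fin 4 → ℝ) :
    pencil (complexify A) (toComplex v) = (pencil A v).map (algebraMap ℝ ℂ) := by
  ext i j
  simp [pencil, complexify, toComplex, Matrix.sum_apply]

theorem det_map_algebraMap {κ : Type*} [Fintype κ] [DecidableEq κ] (M : Matrix κ κ ℝ) :
    (M.map (algebraMap ℝ ℂ)).det = (M.det : ℂ) := (RingHom.map_det (algebraMap ℝ ℂ) M).symm

theorem linearIndependent_toComplex {n : ℕ} {u v : Fin n → ℝ} (h : LinearIndependent ℝ ![u, v]) :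
    LinearIndependent ℂ ![toComplex u, toComplex v] := by
  rw [LinearIndependent.pair_iff] at h ⊢
  intro s t hst
  have h1 := h s.re t.re (by
    ext i
    have := congrArg Complex.re (congrFun hst i)
    simpa [toComplex] using this)
  have h2 := h s.im t.im (by
    ext i
    have := congrArg Complex.im (congrFun hst i)
    simpa [toComplex] using this)
  exact ⟨Complex.ext h1.1 h2.1, Complex.ext h1.2 h2.2⟩

end Complexification

/-! ### Descent along the projection -/

section Descent

variable {L : (Fin 4 → ℝ) →ₗ[ℝ] (Fin 3 → ℝ)} {p : RP 3} (hL : LinearMap.ker L = p.submodule)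

include hL

theorem map_eq_zero_iff_mem {v : Fin 4 → ℝ} : L v = 0 ↔ ∃ c : ℝ, c • p.rep = v := by
  rw [← LinearMap.mem_ker, hL, Projectivization.submodule_eq, Submodule.mem_span_singleton]

theorem map_rep_center : L p.rep = 0 := (map_eq_zero_iff_mem hL).2 ⟨1, one_smul _ _⟩

theorem map_rep_ne_zero_iff {x : RP 3} : L x.rep ≠ 0 ↔ x ≠ p := by
  rw [not_iff_not]
  constructor
  · intro h
    obtain ⟨c, hc⟩ := (map_eq_zero_iff_mem hL).1 h
    rw [← x.mk_rep, ← p.mk_rep]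
    exact (Projectivization.mk_eq_mk_iff' ℝ _ _ _ _).2 ⟨c, hc⟩
  · rintro rfl
    exact map_rep_center hL

theorem linearIndependent_of_map_ne_zero {v : Fin 4 → ℝ} (hv : L v ≠ 0) :
    LinearIndependent ℝ ![p.rep, v] := by
  rw [LinearIndependent.pair_iff]
  intro s t h
  have h1 := congrArg L h
  rw [map_add, map_smul, map_smul, map_rep_center hL, smul_zero, zero_add, map_zero] at h1
  have ht : t = 0 := (smul_eq_zero.1 h1).resolve_right hv
  rw [ht, zero_smul, add_zero] at h
  exact ⟨(smul_eq_zero.1 h).resolve_right p.rep_nonzero, ht⟩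

theorem exists_section : ∃ s : (Fin 3 → ℝ) →ₗ[ℝ] (Fin 4 → ℝ), ∀ w, L (s w) = w := by
  have hr : LinearMap.range L = ⊤ := by
    apply Submodule.eq_top_of_finrank_eq
    have h := L.finrank_range_add_finrank_ker
    rw [hL, Projectivization.finrank_submodule] at h
    simp at h ⊢
    omega
  obtain ⟨s, hs⟩ := L.exists_rightInverse_of_surjective hr
  exact ⟨s, fun w => LinearMap.congr_fun hs w⟩

omit hL in
theorem projectsTo_mk {x : RP 3} (hx : L x.rep ≠ 0) :
    ProjectsTo L x (Projectivization.mk ℝ (L x.rep) hx) :=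
  ⟨x.rep, x.rep_nonzero, hx, x.mk_rep.symm, rfl⟩

omit hL in
theorem eq_of_projectsTo {x : RP 3} {y : RP 2} (h : ProjectsTo L x y) :
    ∃ hx : L x.rep ≠ 0, y = Projectivization.mk ℝ (L x.rep) hx := by
  obtain ⟨v, hv, hLv, hxv, rfl⟩ := h
  obtain ⟨c, hc, h1⟩ := exists_smul_rep x v hv hxv
  have hx : L x.rep ≠ 0 := by
    rw [h1, map_smul]
    exact smul_ne_zero hc hLv
  refine ⟨hx, ?_⟩
  rw [Projectivization.mk_eq_mk_iff']
  exact ⟨c⁻¹, by rw [h1, map_smul, smul_smul, inv_mul_cancel₀ hc, one_smul]⟩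

variable {s : (Fin 3 → ℝ) →ₗ[ℝ] (Fin 4 → ℝ)} (hs : ∀ w, L (s w) = w)
  {A : Fin 4 → Matrix (Fin 4) (Fin 4) ℝ} {κ : Type*}

/-- The linear system on the plane obtained by restricting the forms `A` to the span of the
coordinate vectors `a`, by means of a section `s` of the projection. -/
noncomputable def descend (A : Fin 4 → Matrix (Fin 4) (Fin 4) ℝ)
    (s : (Fin 3 → ℝ) →ₗ[ℝ] (Fin 4 → ℝ)) (a : κ → Fin 4) (i : Fin 3) : Matrix κ κ ℝ :=
  (pencil A (s (Pi.single i 1))).submatrix a a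

omit hL in
theorem descend_isSymm (hA : ∀ i, (A i).IsSymm) (a : κ → Fin 4) (i : Fin 3) :
    (descend A s a i).IsSymm := (pencil_isSymm hA _).submatrix _

omit hL in
theorem pencil_descend_section (a : κ → Fin 4) (w : Fin 3 → ℝ) :
    pencil (descend A s a) w = (pencil A (s w)).submatrix a a := by
  have h : s w = ∑ i, w i • s (Pi.single i 1) := by
    conv_lhs => rw [pi_eq_sum_univ' w, map_sum]
    exact Finset.sum_congr rfl fun i _ => by rw [map_smul]
  have h2 : pencil A (s w) = ∑ i, w i • pencil A (s (Pi.single i 1)) := by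
    have := congrArg (pencilₗ A) h
    rw [map_sum] at this
    simp only [map_smul] at this
    exact this
  rw [h2]
  ext i j
  simp only [pencil, descend, Matrix.sum_apply, Matrix.smul_apply, submatrix_apply]

include hs

/-- The descended forms agree with the original ones, if these vanish at the centre. -/
theorem pencil_descend {a : κ → Fin 4} (ha : (pencil A p.rep).submatrix a a = 0)
    (v : Fin 4 → ℝ) : pencil (descend A s a) (L v) = (pencil A v).submatrix a a := by
  obtain ⟨c, hc⟩ := (map_eq_zero_iff_mem hL).1 (show L (v - s (L v)) = 0 by
    rw [map_sub, hs, sub_self])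
  rw [pencil_descend_section]
  have : v = s (L v) + c • p.rep := by rw [hc]; abel
  conv_rhs => rw [this, pencil_add, pencil_smul]
  have h2 := congrArg (fun M => c • M) ha
  rw [submatrix_add]
  have h3 : (c • pencil A p.rep).submatrix a a = 0 := by
    rw [submatrix_smul]
    simp only [Pi.smul_apply, ha, smul_zero]
  simp [h3]

/-- Complex singular points of the descended cubic come from critical zeros of the cubic form in
space. -/
theorem exists_critical_of_singular {a : Fin 3 → Fin 4}
    (ha : (pencil A p.rep).submatrix a a = 0) {ζ : Fin 3 → ℂ} (hζ : ζ ≠ 0)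
    (h : IsSingularAt (MvPolynomial.map (algebraMap ℝ ℂ) (pencilDet (descend A s a))) ζ) :
    ∃ z : Fin 4 → ℂ, LinearIndependent ℂ ![complexPoint p, z] ∧
      ((pencil (complexify A) z).submatrix a a).det = 0 ∧
      ∀ w, (restrict (pencilDet fun i => (complexify A i).submatrix a a) z w).coeff 1 = 0 := by
  set Lm : Matrix (Fin 3) (Fin 4) ℂ := (LinearMap.toMatrix' L).map (algebraMap ℝ ℂ) with hLm
  set sm : Matrix (Fin 4) (Fin 3) ℂ := (LinearMap.toMatrix' s).map (algebraMap ℝ ℂ) with hsm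
  have hLs : Lm * sm = 1 := by
    rw [hLm, hsm, ← Matrix.map_mul, ← LinearMap.toMatrix'_comp]
    have : L ∘ₗ s = LinearMap.id := LinearMap.ext hs
    rw [this, LinearMap.toMatrix'_id, Matrix.map_one _ (map_zero _) (map_one _)]
  have hLp : Lm *ᵥ complexPoint p = 0 := by
    have h1 : LinearMap.toMatrix' L *ᵥ p.rep = 0 := by
      rw [LinearMap.toMatrix'_mulVec, map_rep_center hL]
    ext i
    have h2 := congrArg (algebraMap ℝ ℂ) (congrFun h1 i)
    rw [RingHom.map_mulVec] at h2
    rw [Pi.zero_apply, map_zero] at h2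
    exact h2
  set Bc : Fin 3 → Matrix (Fin 3) (Fin 3) ℂ :=
    fun i => (descend A s a i).map (algebraMap ℝ ℂ) with hBc
  have hpen : ∀ w, pencil Bc (Lm *ᵥ w) = pencil (fun i => (complexify A i).submatrix a a) w := by
    intro w
    have hreal : ∀ j, ∑ i, L (Pi.single j 1) i • descend A s a i = (A j).submatrix a a := by
      intro j
      have h1 := pencil_descend hL hs ha (Pi.single j 1)
      rw [pencil] at h1
      rw [h1]
      congr 1
      simp [pencil, Pi.single_apply, ite_smul]
    ext k l
    have hreal' : ∀ j, ∑ i, (L (Pi.single j 1) i : ℂ) * (descend A s a i k l : ℂ) =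
        (A j (a k) (a l) : ℂ) := by
      intro j
      have := congrFun (congrFun (hreal j) k) l
      simp only [Matrix.sum_apply, Matrix.smul_apply, smul_eq_mul, submatrix_apply] at this
      exact_mod_cast this
    simp only [pencil, Matrix.sum_apply, Matrix.smul_apply, smul_eq_mul, submatrix_apply, hBc,
      map_apply, complexify, mulVec, dotProduct, hLm, LinearMap.toMatrix'_apply,
      Complex.coe_algebraMap, Finset.sum_mul]
    rw [Finset.sum_comm]
    refine Finset.sum_congr rfl fun j _ => ?_
    rw [← hreal' j, Finset.mul_sum]
    refine Finset.sum_congr rfl fun i _ => ?_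
    ring
  rw [map_pencilDet, isSingularAt_iff, eval_pencilDet] at h
  have hz : Lm *ᵥ (sm *ᵥ ζ) = ζ := by rw [mulVec_mulVec, hLs, one_mulVec]
  have hsub : ∀ w, pencil (fun i => (complexify A i).submatrix a a) w =
      (pencil (complexify A) w).submatrix a a := by
    intro w
    ext1 i j
    simp only [pencil, submatrix_apply, Matrix.sum_apply, Matrix.smul_apply]
  refine ⟨sm *ᵥ ζ, ?_, ?_, fun w => ?_⟩
  · rw [LinearIndependent.pair_iff]
    intro α β hαβ
    have h1 := congrArg (Lm *ᵥ ·) hαβ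
    simp only [mulVec_add, mulVec_smul, hLp, hz, smul_zero, zero_add, mulVec_zero] at h1
    have hβ : β = 0 := (smul_eq_zero.1 h1).resolve_right hζ
    rw [hβ, zero_smul, add_zero] at hαβ
    refine ⟨(smul_eq_zero.1 hαβ).resolve_right fun h0 => p.rep_nonzero ?_, hβ⟩
    ext i
    have := congrFun h0 i
    simpa [complexPoint] using this
  · rw [← hsub, ← hpen, hz]
    exact h.1
  · have := h.2 (Lm *ᵥ w)
    rw [restrict_pencilDet] at this ⊢
    rw [← hpen, ← hpen, hz]
    exact this

end Descent

/-! ### The projection in normal form -/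

/-- The hypotheses of the projection theorem in coordinates in which the form at the node `p` is
`corner d₁ d₂ d₃`. -/
structure IsNormalForm (A : Fin 4 → Matrix (Fin 4) (Fin 4) ℝ) (p : RP 3)
    (L : (Fin 4 → ℝ) →ₗ[ℝ] (Fin 3 → ℝ)) (d₁ d₂ d₃ : ℝ) : Prop where
  symm : ∀ i, (A i).IsSymm
  center : pencil A p.rep = corner d₁ d₂ d₃
  nondeg : d₁ * d₂ - d₃ ^ 2 ≠ 0
  ker : LinearMap.ker L = p.submodule
  definite : ∃ e, (pencil A e).PosDef
  transversal : IsTransversal A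
  node : IsRealNode A p
  noLine : NoLineThrough A p

section Core

theorem lower_face₁ {R : Type*} (m : Matrix (Fin 4) (Fin 4) R) :
    (face₁ m).submatrix ![1, 2] ![1, 2] = lower m := by
  ext i j; fin_cases i <;> fin_cases j <;> rfl

theorem lower_face₂ {R : Type*} (m : Matrix (Fin 4) (Fin 4) R) :
    (face₂ m).submatrix ![1, 2] ![1, 2] = lower m := by
  ext i j; fin_cases i <;> fin_cases j <;> rfl

theorem Semidef.submatrix {ι κ : Type*} {M : Matrix ι ι ℝ} (h : Semidef M) (a : κ → ι) :
    Semidef (M.submatrix a a) := by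
  rcases h with h | h
  · exact .inl (h.submatrix a)
  · exact .inr (h.submatrix a)

theorem spectrahedron_eq_region (A : Fin 4 → Matrix (Fin 4) (Fin 4) ℝ) :
    spectrahedron A = region (pencilₗ A) := rfl

theorem isClosed_spectrahedron {A : Fin 4 → Matrix (Fin 4) (Fin 4) ℝ} (hA : ∀ i, (A i).IsSymm) :
    IsClosed (spectrahedron A) :=
  isClosed_region (B := pencilₗ A) fun v => pencil_isSymm hA v

variable {A : Fin 4 → Matrix (Fin 4) (Fin 4) ℝ} {p : RP 3}
  {L : (Fin 4 → ℝ) →ₗ[ℝ] (Fin 3 → ℝ)} {d₁ d₂ d₃ : ℝ}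

namespace IsNormalForm

variable (h : IsNormalForm A p L d₁ d₂ d₃)

include h

theorem complex_center : pencil (complexify A) (complexPoint p) =
    corner (d₁ : ℂ) (d₂ : ℂ) (d₃ : ℂ) := by
  rw [complexPoint_eq, pencil_complexify, h.center, corner_map]
  rfl

theorem lower_ne_zero {v : Fin 4 → ℝ} (hv : L v ≠ 0) : lower (pencil A v) ≠ 0 := by
  intro h0
  have hli := linearIndependent_toComplex (linearIndependent_of_map_ne_zero h.ker hv)
  refine not_linearIndependent_of_lower_eq_zero (complexify_isSymm h.symm) h.complex_center
    h.node.2 ?_ hli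
  rw [pencil_complexify]
  ext i j
  have := congrFun (congrFun h0 i) j
  simp only [lower, submatrix_apply, map_apply] at this ⊢
  simp [this]

theorem coeffs_ne_zero {v : Fin 4 → ℝ} (hv : L v ≠ 0) (h0 : (pencil A v).det = 0)
    (h1 : linearCoeff d₁ d₂ d₃ (pencil A v) = 0) : (lower (pencil A v)).det ≠ 0 := by
  intro h2
  have hli := linearIndependent_toComplex (linearIndependent_of_map_ne_zero h.ker hv)
  obtain ⟨s, t, hst⟩ := h.noLine _ hli
  refine hst (eq_zero_of_coeffs (complexify_isSymm h.symm) h.complex_center ?_ ?_ ?_ s t)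
  · rw [pencil_complexify, det_map_algebraMap, h0, Complex.ofReal_zero]
  · have e1 : (face₁ ((pencil A v).map (algebraMap ℝ ℂ))).det = ((face₁ (pencil A v)).det : ℂ) :=
      det_map_algebraMap _
    have e2 : (face₂ ((pencil A v).map (algebraMap ℝ ℂ))).det = ((face₂ (pencil A v)).det : ℂ) :=
      det_map_algebraMap _
    have e3 : (mixed ((pencil A v).map (algebraMap ℝ ℂ))).det = ((mixed (pencil A v)).det : ℂ) :=
      det_map_algebraMap _
    rw [linearCoeff] at h1
    rw [pencil_complexify, linearCoeff, e1, e2, e3]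
    exact_mod_cast h1
  · have e4 : (lower ((pencil A v).map (algebraMap ℝ ℂ))).det = ((lower (pencil A v)).det : ℂ) :=
      det_map_algebraMap _
    rw [pencil_complexify, e4, h2, Complex.ofReal_zero]

/-- The algebraic consequences of `x` being a node that are used below. -/
theorem of_isRealNode {x : RP 3} (hx : IsRealNode A x) :
    (pencil A x.rep).det = 0 ∧ linearCoeff d₁ d₂ d₃ (pencil A x.rep) = 0 ∧
      ∀ a b : Fin 3 → Fin 4, ((pencil A x.rep).submatrix a b).det = 0 := by
  have hsing := (isSingularAt_iff _ _).1 hx.1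
  have hx0 : complexPoint x ≠ 0 := by
    intro h0
    refine x.rep_nonzero ?_
    ext i
    have := congrFun h0 i
    simpa [complexPoint] using this
  refine ⟨?_, ?_, fun a b => ?_⟩
  · have := hsing.1
    rw [detForm_eq_pencilDet, eval_pencilDet, complexPoint_eq, pencil_complexify,
      det_map_algebraMap] at this
    exact_mod_cast this
  · have := hsing.2 (complexPoint p)
    rw [detForm_eq_pencilDet,
      restrict_through_node (complexify_isSymm h.symm) h.complex_center] at this
    simp only [Polynomial.coeff_add, Polynomial.coeff_C_mul, Polynomial.coeff_X_pow,
      Polynomial.coeff_C, Polynomial.coeff_X] at this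
    norm_num at this
    have e1 : (face₁ ((pencil A x.rep).map (algebraMap ℝ ℂ))).det =
      ((face₁ (pencil A x.rep)).det : ℂ) := det_map_algebraMap _
    have e2 : (face₂ ((pencil A x.rep).map (algebraMap ℝ ℂ))).det =
      ((face₂ (pencil A x.rep)).det : ℂ) := det_map_algebraMap _
    have e3 : (mixed ((pencil A x.rep).map (algebraMap ℝ ℂ))).det =
      ((mixed (pencil A x.rep)).det : ℂ) := det_map_algebraMap _
    rw [complexPoint_eq, pencil_complexify, linearCoeff, e1, e2, e3] at this
    rw [linearCoeff]
    exact_mod_cast this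
  · have h2 := det_submatrix_eq_zero_of_rank (h.transversal.2 _ hx0 hx) a b
    have h3 : linMat (complexify A) (complexPoint x) =
      (pencil A x.rep).map (algebraMap ℝ ℂ) := pencil_complexify A x.rep
    have h4 := det_map_algebraMap ((pencil A x.rep).submatrix a b)
    rw [h3] at h2
    have h5 := h4.symm.trans h2
    exact_mod_cast h5

theorem lower_center : (pencil A p.rep).submatrix ![2, 3] ![2, 3] = 0 := by
  rw [h.center]
  exact lower_corner _ _ _

/-- A node that projects into the closed convex region bounded by the conic is semidefinite. -/
theorem semidef_of_isRealNode {x : RP 3} (hx : IsRealNode A x) (hLx : L x.rep ≠ 0)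
    (hsd : Semidef (lower (pencil A x.rep))) : x ∈ spectrahedron A := by
  obtain ⟨h1, h2, h3⟩ := h.of_isRealNode hx
  have hdet := h.coeffs_ne_zero hLx h1 h2
  rcases hsd with hsd | hsd
  · left
    change (pencil A x.rep).PosSemidef
    refine posSemidef_of_schur (pencil_isSymm h.symm _) (posDef_of_det_ne_zero hsd hdet)
      (h3 _ _).ge (h3 _ _).ge ?_
    rw [show (mixed (pencil A x.rep)).det = 0 from h3 _ _,
      show (face₁ (pencil A x.rep)).det = 0 from h3 _ _]
    norm_num
  · right
    change (-(pencil A x.rep)).PosSemidef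
    have hneg : ∀ a b : Fin 3 → Fin 4, ((-(pencil A x.rep)).submatrix a b).det = 0 := by
      intro a b
      rw [submatrix_neg]
      change (-((pencil A x.rep).submatrix a b)).det = 0
      rw [det_neg, h3, mul_zero]
    refine posSemidef_of_schur (pencil_isSymm h.symm _).neg
      (posDef_of_det_ne_zero (M := -(lower (pencil A x.rep))) hsd ?_)
      (hneg _ _).ge (hneg _ _).ge ?_
    · rw [det_neg]
      simpa using hdet
    · rw [show (mixed (-(pencil A x.rep))).det = 0 from hneg _ _,
        show (face₁ (-(pencil A x.rep))).det = 0 from hneg _ _]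
      norm_num

section Section

variable {s : (Fin 3 → ℝ) →ₗ[ℝ] (Fin 4 → ℝ)} (hs : ∀ w, L (s w) = w)

include hs

theorem pencil_lower_section (v : Fin 4 → ℝ) :
    pencil (descend A s ![2, 3]) (L v) = lower (pencil A v) :=
  pencil_descend h.ker hs h.lower_center v

theorem lower_section_injective {w : Fin 3 → ℝ} (hw : pencil (descend A s ![2, 3]) w = 0) :
    w = 0 := by
  by_contra h0
  rw [← hs w] at h0
  exact h.lower_ne_zero h0 ((pencil_descend_section _ _).symm.trans hw)

theorem lower_section_posDef : ∃ e, (pencil (descend A s ![2, 3]) e).PosDef := by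
  obtain ⟨e, he⟩ := h.definite
  refine ⟨L e, ?_⟩
  rw [h.pencil_lower_section hs]
  exact he.submatrix (by decide)

theorem tangentConic_eq : tangentConic A p L = boundary (pencilₗ (descend A s ![2, 3])) := by
  have hcone : ∀ v, coneForm A p v = (d₁ * d₂ - d₃ ^ 2) * (lower (pencil A v)).det := by
    intro v
    change (restrict (pencilDet A) v p.rep).coeff 2 = _
    rw [restrict_through_node h.symm h.center]
    simp only [Polynomial.coeff_add, Polynomial.coeff_C_mul, Polynomial.coeff_X_pow,
      Polynomial.coeff_C, Polynomial.coeff_X]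
    norm_num
  ext y
  constructor
  · rintro ⟨x, hx, hxy⟩
    obtain ⟨hLx, rfl⟩ := eq_of_projectsTo hxy
    rw [hcone] at hx
    have hdet := (mul_eq_zero.1 hx).resolve_left h.nondeg
    rw [mem_boundary_mk, pencilₗ_apply, h.pencil_lower_section hs]
    exact ⟨posSemidef_two (lower_isSymm (pencil_isSymm h.symm _)) hdet.ge, hdet⟩
  · intro hy
    have hne : L (s y.rep) ≠ 0 := by
      rw [hs]
      exact y.rep_nonzero
    have hne' : s y.rep ≠ 0 := by
      intro h0
      rw [h0, map_zero] at hne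
      exact hne rfl
    have hproj : ProjectsTo L (Projectivization.mk ℝ (s y.rep) hne') y := by
      refine ⟨_, hne', hne, rfl, ?_⟩
      simp only [hs, Projectivization.mk_rep]
    refine ⟨_, ?_, hproj⟩
    obtain ⟨c, hc, h1⟩ := exists_smul_rep _ (s y.rep) hne' rfl
    have hy2 := hy.2
    rw [pencilₗ_apply, pencil_descend_section] at hy2
    have h2 : (lower (pencil A (s y.rep))).det = 0 := hy2
    rw [hcone, h1, pencil_smul]
    change _ * (c • lower (pencil A (s y.rep))).det = 0
    rw [det_smul, h2]
    ring

theorem convHull_tangentConic :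
    convHull (tangentConic A p L) = region (pencilₗ (descend A s ![2, 3])) := by
  obtain ⟨e, he⟩ := h.lower_section_posDef hs
  rw [h.tangentConic_eq hs]
  exact convHull_boundary (fun v => pencil_isSymm (descend_isSymm h.symm _) v)
    (fun w hw => h.lower_section_injective hs hw) he

theorem mk_mem_convHull_tangentConic {v : Fin 4 → ℝ} (hv : L v ≠ 0) :
    (Projectivization.mk ℝ (L v) hv : RP 2) ∈ convHull (tangentConic A p L) ↔
      Semidef (lower (pencil A v)) := by
  rw [h.convHull_tangentConic hs, mem_region_mk, pencilₗ_apply, h.pencil_lower_section hs]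

end Section

theorem insideCone_iff {x : RP 3} (hx : x ≠ p) :
    InsideCone A p L x ↔ Semidef (lower (pencil A x.rep)) := by
  obtain ⟨s, hs⟩ := exists_section h.ker
  have hLx := (map_rep_ne_zero_iff h.ker).2 hx
  rw [← h.mk_mem_convHull_tangentConic hs hLx, InsideCone, or_iff_right hx]
  constructor
  · rintro ⟨y, hy, hy2⟩
    obtain ⟨_, rfl⟩ := eq_of_projectsTo hy
    exact hy2
  · exact fun h => ⟨_, projectsTo_mk hLx, h⟩

theorem insideCone_of_mem {x : RP 3} (hx : x ∈ spectrahedron A) : InsideCone A p L x := by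
  by_cases hxp : x = p
  · exact .inl hxp
  · exact (h.insideCone_iff hxp).2 (Semidef.submatrix hx _)

omit h in
theorem frontier_subset_spectrahedron (hA : ∀ i, (A i).IsSymm) :
    frontier (spectrahedron A) ⊆ spectrahedron A :=
  (isClosed_spectrahedron hA).frontier_subset

theorem not_insideCone {x : RP 3} (hx : IsRealNode A x) (hxp : x ≠ p)
    (hxS : x ∉ spectrahedron A) : ¬ InsideCone A p L x := by
  rw [h.insideCone_iff hxp]
  exact fun hsd => hxS (h.semidef_of_isRealNode hx ((map_rep_ne_zero_iff h.ker).2 hxp) hsd)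

omit h in
/-- To bound the image of the strict transform by a closed set, it suffices to look outside the
centre. -/
theorem projImage_subset {S : Set (RP 3)} {Z : Set (RP 2)} (hZ : IsClosed Z)
    (hS : ∀ x ∈ S, ∀ hx : L x.rep ≠ 0, Projectivization.mk ℝ (L x.rep) hx ∈ Z) :
    projImage L S ⊆ Z := by
  rintro _ ⟨z, hz, rfl⟩
  have hcl : IsClosed {z : RP 3 × RP 2 | z.2 ∈ Z} := hZ.preimage continuous_snd
  refine closure_minimal ?_ hcl hz
  rintro ⟨x, y⟩ ⟨hx, hxy⟩
  obtain ⟨hLx, hy⟩ := eq_of_projectsTo hxy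
  rw [Set.mem_ofPred_eq, hy]
  exact hS x hx hLx

omit h in
theorem mem_projImage {S : Set (RP 3)} {x : RP 3} {y : RP 2} (hx : x ∈ S)
    (hy : ProjectsTo L x y) : y ∈ projImage L S :=
  ⟨(x, y), subset_closure ⟨hx, hy⟩, rfl⟩

end IsNormalForm

/-! ### Projection from a semidefinite node -/

theorem tendsto_mk {n : ℕ} {φ : ℕ → Fin (n + 1) → ℝ} {v : Fin (n + 1) → ℝ} (h0 : ∀ k, φ k ≠ 0)
    (hv : v ≠ 0) (hφ : Filter.Tendsto φ Filter.atTop (nhds v)) :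
    Filter.Tendsto (fun k => (Projectivization.mk ℝ (φ k) (h0 k) : RP n)) Filter.atTop
      (nhds (Projectivization.mk ℝ v hv)) := by
  have h1 : Filter.Tendsto (fun k => (⟨φ k, h0 k⟩ : {v : Fin (n + 1) → ℝ // v ≠ 0}))
      Filter.atTop (nhds ⟨v, hv⟩) := tendsto_subtype_rng.2 hφ
  exact (isOpenQuotientMap_mk.continuous.tendsto _).comp h1

/-- Adding a large multiple of a semidefinite form that is definite transversally to the last two
coordinates makes a form with definite lower block semidefinite. -/
theorem exists_posSemidef_add {m : Matrix (Fin 4) (Fin 4) ℝ} (hm : m.IsSymm)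
    (hR : (lower m).PosDef) : ∃ T₀ : ℝ, ∀ T ≥ T₀, (m + T • corner 1 1 0).PosSemidef := by
  have hr := hR.det_pos
  set r := (lower m).det with hr'
  refine ⟨(|(face₁ m).det| + |(face₂ m).det| + |(mixed m).det|) / r, fun T hT => ?_⟩
  have hT' : |(face₁ m).det| + |(face₂ m).det| + |(mixed m).det| ≤ T * r := by
    rwa [ge_iff_le, div_le_iff₀ hr] at hT
  have hcs : (corner (1 : ℝ) 1 0).IsSymm := by
    ext i j; fin_cases i <;> fin_cases j <;> rfl
  have e1 : (face₁ (m + T • corner 1 1 0)).det = (face₁ m).det + T * r := by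
    rw [hr', det_fin_three, det_fin_three, det_fin_two]
    simp [face₁, lower, corner]
    ring
  have e2 : (face₂ (m + T • corner 1 1 0)).det = (face₂ m).det + T * r := by
    rw [hr', det_fin_three, det_fin_three, det_fin_two]
    simp [face₂, lower, corner]
    ring
  have e3 : (mixed (m + T • corner 1 1 0)).det = (mixed m).det := by
    rw [det_fin_three, det_fin_three]
    simp [mixed, corner]
  have e4 : lower (m + T • corner 1 1 0) = lower m := by
    ext i j; fin_cases i <;> fin_cases j <;> simp [lower, corner]
  have a1 := neg_abs_le (face₁ m).det
  have a2 := neg_abs_le (face₂ m).det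
  have b1 := abs_nonneg (face₁ m).det
  have b2 := abs_nonneg (face₂ m).det
  have b3 := abs_nonneg (mixed m).det
  refine posSemidef_of_schur (hm.add (hcs.smul T)) (by rwa [e4]) ?_ ?_ ?_
  · rw [e1]; linarith
  · rw [e2]; linarith
  · rw [e1, e2, e3, ← sq_abs]
    have c1 : |(mixed m).det| ≤ (face₁ m).det + T * r := by linarith
    have c2 : |(mixed m).det| ≤ (face₂ m).det + T * r := by linarith
    rw [pow_two]
    exact mul_le_mul c1 c2 b3 (by linarith)

/-- From a semidefinite node, the spectrahedron projects onto the region bounded by the conic. -/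
theorem IsNormalForm.projImage_eq {ε : ℝ} (hε : ε * ε = 1) (h : IsNormalForm A p L ε ε 0) :
    projImage L (spectrahedron A) = convHull (tangentConic A p L) := by
  obtain ⟨s, hs⟩ := exists_section h.ker
  have hsymm : ∀ v, (pencilₗ (descend A s ![2, 3]) v).IsSymm :=
    fun v => pencil_isSymm (descend_isSymm h.symm _) v
  refine Set.Subset.antisymm (projImage_subset ?_ fun x hx hLx => ?_) fun y hy => ?_
  · rw [h.convHull_tangentConic hs]
    exact isClosed_region hsymm
  · rw [h.mk_mem_convHull_tangentConic hs]
    exact Semidef.submatrix hx _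
  · rw [h.convHull_tangentConic hs] at hy
    obtain ⟨w, hw, rfl, hpsd, -⟩ :=
      exists_normalized (fun w hw => h.lower_section_injective hs hw) hy
    obtain ⟨e, he⟩ := h.definite
    have hv : L (s w) ≠ 0 := by rwa [hs]
    have hlow : (lower (pencil A (s w))).PosSemidef := by
      have h1 : pencilₗ (descend A s ![2, 3]) w = lower (pencil A (s w)) :=
        pencil_descend_section _ _
      rwa [h1] at hpsd
    -- Points over `w + e / (k + 1)`, with definite lower block, that tend to the node.
    set v : ℕ → Fin 4 → ℝ := fun k => s w + ((k : ℝ) + 1)⁻¹ • e with hvdef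
    have hvpd : ∀ k, (lower (pencil A (v k))).PosDef := by
      intro k
      have h1 : lower (pencil A (v k)) =
          lower (pencil A (s w)) + ((k : ℝ) + 1)⁻¹ • lower (pencil A e) := by
        rw [hvdef, pencil_add, pencil_smul, lower_add]
        rfl
      rw [h1]
      exact PosDef.posSemidef_add hlow
        (PosDef.smul (he.submatrix (by decide)) (by positivity))
    choose T hT using fun k => exists_posSemidef_add (pencil_isSymm h.symm (v k)) (hvpd k)
    set τ : ℕ → ℝ := fun k => max (T k) (k + 1) with hτ
    have hτpos : ∀ k, 0 < τ k := fun k => lt_of_lt_of_le (by positivity) (le_max_right _ _)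
    set u : ℕ → Fin 4 → ℝ := fun k => (τ k)⁻¹ • v k + ε • p.rep with hu
    have hε0 : ε ≠ 0 := by
      rintro rfl
      simp at hε
    have hpsdu : ∀ k, (pencil A (u k)).PosSemidef := by
      intro k
      have h1 : pencil A (u k) = (τ k)⁻¹ • (pencil A (v k) + τ k • corner 1 1 0) := by
        rw [hu, pencil_add, pencil_smul, pencil_smul, h.center, smul_add, smul_smul,
          inv_mul_cancel₀ (hτpos k).ne', one_smul]
        congr 1
        ext i j
        fin_cases i <;> fin_cases j <;> simp [corner, hε]
      rw [h1]
      exact (hT k _ (le_max_left _ _)).smul (inv_nonneg.2 (hτpos k).le)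
    have hLu : ∀ k, L (u k) = (τ k)⁻¹ • L (v k) := by
      intro k
      rw [hu]
      simp only [map_add, map_smul, map_rep_center h.ker, smul_zero, add_zero]
    have hLv0 : ∀ k, L (v k) ≠ 0 := by
      intro k h0
      have h1 := hvpd k
      rw [← h.pencil_lower_section hs, h0] at h1
      have h2 := h1.det_pos
      rw [det_fin_two] at h2
      simp [pencil] at h2
    have hLu0 : ∀ k, L (u k) ≠ 0 := by
      intro k
      rw [hLu]
      exact smul_ne_zero (inv_ne_zero (hτpos k).ne') (hLv0 k)
    have hu0 : ∀ k, u k ≠ 0 := by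
      intro k h0
      exact hLu0 k (by rw [h0, map_zero])
    have hinv : Filter.Tendsto (fun k : ℕ => ((k : ℝ) + 1)⁻¹) Filter.atTop (nhds 0) := by
      simpa using tendsto_one_div_add_atTop_nhds_zero_nat (𝕜 := ℝ)
    have hvlim : Filter.Tendsto v Filter.atTop (nhds (s w)) := by
      have := (tendsto_const_nhds (x := s w)).add (hinv.smul_const e)
      simpa using this
    have hτlim : Filter.Tendsto (fun k => (τ k)⁻¹) Filter.atTop (nhds 0) := by
      refine squeeze_zero (fun k => inv_nonneg.2 (hτpos k).le) (fun k => ?_) hinv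
      exact inv_anti₀ (by positivity) (le_max_right _ _)
    have hulim : Filter.Tendsto u Filter.atTop (nhds (ε • p.rep)) := by
      have := (hτlim.smul hvlim).add_const (ε • p.rep)
      simpa using this
    have hLc : Continuous L := L.continuous_of_finiteDimensional
    have hLvlim : Filter.Tendsto (fun k => L (v k)) Filter.atTop (nhds w) := by
      have := (hLc.tendsto _).comp hvlim
      rwa [hs] at this
    have hp0 : ε • p.rep ≠ 0 := smul_ne_zero hε0 p.rep_nonzero
    refine ⟨(Projectivization.mk ℝ (ε • p.rep) hp0, Projectivization.mk ℝ w hw), ?_, rfl⟩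
    refine mem_closure_of_tendsto
      ((tendsto_mk hu0 hp0 hulim).prodMk_nhds (tendsto_mk hLv0 hw hLvlim))
      (Filter.Eventually.of_forall fun k => ⟨?_, u k, hu0 k, hLu0 k, rfl, ?_⟩)
    · change _ ∈ region (pencilₗ A)
      rw [mem_region_mk]
      exact .inl (hpsdu k)
    · rw [Projectivization.mk_eq_mk_iff']
      exact ⟨τ k, by rw [hLu, smul_smul, mul_inv_cancel₀ (hτpos k).ne', one_smul]⟩

end Core

/-! ### Projection from an indefinite node -/

section Indefinite

variable {A : Fin 4 → Matrix (Fin 4) (Fin 4) ℝ} {p : RP 3}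
  {L : (Fin 4 → ℝ) →ₗ[ℝ] (Fin 3 → ℝ)}

/-- The restriction of `face₁` to the plane, in terms of a section of the projection. -/
noncomputable abbrev cubic₁ (A : Fin 4 → Matrix (Fin 4) (Fin 4) ℝ)
    (s : (Fin 3 → ℝ) →ₗ[ℝ] (Fin 4 → ℝ)) : Fin 3 → Matrix (Fin 3) (Fin 3) ℝ :=
  descend A s ![0, 2, 3]

/-- The restriction of `face₂` to the plane, in terms of a section of the projection. -/
noncomputable abbrev cubic₂ (A : Fin 4 → Matrix (Fin 4) (Fin 4) ℝ)
    (s : (Fin 3 → ℝ) →ₗ[ℝ] (Fin 4 → ℝ)) : Fin 3 → Matrix (Fin 3) (Fin 3) ℝ :=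
  descend A s ![1, 2, 3]

/-- If the restrictions of `m` to both faces are positive semidefinite and the lower block is
singular, then `m` and the lower block have a common kernel vector. -/
theorem det_eq_zero_of_faces {m : Matrix (Fin 4) (Fin 4) ℝ} (hm : m.IsSymm)
    (h₁ : (face₁ m).PosSemidef) (h₂ : (face₂ m).PosSemidef) (hR : (lower m).det = 0) :
    m.det = 0 ∧ (mixed m).det = 0 := by
  obtain ⟨e1, e2, e3, e4, e5, e6⟩ := symm_entries hm
  obtain ⟨u, hu, hu0⟩ := exists_mulVec_eq_zero_iff.2 hR
  have hq : u ⬝ᵥ (lower m *ᵥ u) = 0 := by rw [hu0, dotProduct_zero]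
  have k1 := mulVec_eq_zero_of_quad h₁ (x := ![0, u 0, u 1]) (by
    refine Eq.trans ?_ hq
    simp [dotProduct, mulVec, Fin.sum_univ_three, Fin.sum_univ_two, face₁, lower])
  have k2 := mulVec_eq_zero_of_quad h₂ (x := ![0, u 0, u 1]) (by
    refine Eq.trans ?_ hq
    simp [dotProduct, mulVec, Fin.sum_univ_three, Fin.sum_univ_two, face₂, lower])
  have a0 : m 0 2 * u 0 + m 0 3 * u 1 = 0 := by
    simpa [dotProduct, mulVec, Fin.sum_univ_three, face₁] using congrFun k1 0
  have a1 : m 1 2 * u 0 + m 1 3 * u 1 = 0 := by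
    simpa [dotProduct, mulVec, Fin.sum_univ_three, face₂] using congrFun k2 0
  have a2 : m 2 2 * u 0 + m 2 3 * u 1 = 0 := by
    simpa [dotProduct, mulVec, Fin.sum_univ_two, lower] using congrFun hu0 0
  have a3 : m 3 2 * u 0 + m 3 3 * u 1 = 0 := by
    simpa [dotProduct, mulVec, Fin.sum_univ_two, lower] using congrFun hu0 1
  constructor
  · refine exists_mulVec_eq_zero_iff.1 ⟨![0, 0, u 0, u 1], ?_, ?_⟩
    · intro h0
      apply hu
      ext i
      fin_cases i
      · exact congrFun h0 2
      · exact congrFun h0 3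
    · ext i
      fin_cases i <;> simp [dotProduct, mulVec, Fin.sum_univ_four, a0, a1, a2, a3]
  · refine exists_mulVec_eq_zero_iff.1 ⟨![0, u 0, u 1], ?_, ?_⟩
    · intro h0
      apply hu
      ext i
      fin_cases i
      · exact congrFun h0 1
      · exact congrFun h0 2
    · ext i
      fin_cases i <;> simp [dotProduct, mulVec, Fin.sum_univ_three, mixed, a0, a2, a3]

theorem not_isSingularAt_real {F : MvPolynomial (Fin 3) ℝ}
    (hF : ∀ ζ : Fin 3 → ℂ, ζ ≠ 0 → ¬ IsSingularAt (MvPolynomial.map (algebraMap ℝ ℂ) F) ζ)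
    (v : Fin 3 → ℝ) (hv : v ≠ 0) : ¬ IsSingularAt F v := by
  rintro ⟨h1, h2⟩
  have hev : ∀ G : MvPolynomial (Fin 3) ℝ, MvPolynomial.eval v G = 0 →
      MvPolynomial.eval (toComplex v) (MvPolynomial.map (algebraMap ℝ ℂ) G) = 0 := by
    intro G hG
    have h3 := MvPolynomial.eval₂_comp_left (algebraMap ℝ ℂ) (RingHom.id ℝ) v G
    rw [MvPolynomial.eval₂_id, hG, map_zero, RingHom.comp_id] at h3
    rw [MvPolynomial.eval_map]
    exact h3.symm
  refine hF (toComplex v) ?_ ⟨hev _ h1, fun i => ?_⟩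
  · intro h0
    apply hv
    ext i
    have := congrFun h0 i
    simpa [toComplex] using this
  · rw [MvPolynomial.pderiv_map]
    exact hev _ (h2 i)

theorem isSmoothCubic_C_mul {B : Fin 3 → Matrix (Fin 3) (Fin 3) ℝ} {c : ℝ} (hc : c ≠ 0)
    (hB : ∀ ζ : Fin 3 → ℂ, ζ ≠ 0 →
      ¬ IsSingularAt (MvPolynomial.map (algebraMap ℝ ℂ) (pencilDet B)) ζ) :
    IsSmoothCubic (MvPolynomial.C c * pencilDet B) := by
  refine ⟨?_, fun ζ hζ hs => hB ζ hζ ?_⟩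
  · simpa using (MvPolynomial.isHomogeneous_C (Fin 3) c).mul (pencilDet_isHomogeneous B)
  · rw [map_mul, MvPolynomial.map_C] at hs
    have hc' : algebraMap ℝ ℂ c ≠ 0 := by simpa using hc
    refine ⟨?_, fun i => ?_⟩
    · have := hs.1
      rw [map_mul, MvPolynomial.eval_C] at this
      exact (mul_eq_zero.1 this).resolve_left hc'
    · have := hs.2 i
      rw [MvPolynomial.pderiv_C_mul, map_mul, MvPolynomial.eval_C] at this
      exact (mul_eq_zero.1 this).resolve_left hc'

namespace IsNormalForm

variable (h : IsNormalForm A p L 0 0 1)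

include h

theorem face₁_center : (pencil A p.rep).submatrix ![0, 2, 3] ![0, 2, 3] = 0 := by
  rw [h.center]
  ext i j; fin_cases i <;> fin_cases j <;> simp [corner]

theorem face₂_center : (pencil A p.rep).submatrix ![1, 2, 3] ![1, 2, 3] = 0 := by
  rw [h.center]
  ext i j; fin_cases i <;> fin_cases j <;> simp [corner]

variable {s : (Fin 3 → ℝ) →ₗ[ℝ] (Fin 4 → ℝ)} (hs : ∀ w, L (s w) = w)

include hs

theorem pencil_cubic₁ (v : Fin 4 → ℝ) : pencil (cubic₁ A s) (L v) = face₁ (pencil A v) :=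
  pencil_descend h.ker hs h.face₁_center v

theorem pencil_cubic₂ (v : Fin 4 → ℝ) : pencil (cubic₂ A s) (L v) = face₂ (pencil A v) :=
  pencil_descend h.ker hs h.face₂_center v

theorem cubic₁_injective {w : Fin 3 → ℝ} (hw : pencil (cubic₁ A s) w = 0) : w = 0 := by
  refine h.lower_section_injective hs ?_
  rw [← hs w, h.pencil_cubic₁ hs] at hw
  rw [← hs w, h.pencil_lower_section hs, ← lower_face₁, hw]
  rfl

theorem cubic₂_injective {w : Fin 3 → ℝ} (hw : pencil (cubic₂ A s) w = 0) : w = 0 := by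
  refine h.lower_section_injective hs ?_
  rw [← hs w, h.pencil_cubic₂ hs] at hw
  rw [← hs w, h.pencil_lower_section hs, ← lower_face₂, hw]
  rfl

theorem cubic₁_posDef : ∃ e, (pencil (cubic₁ A s) e).PosDef := by
  obtain ⟨e, he⟩ := h.definite
  refine ⟨L e, ?_⟩
  rw [h.pencil_cubic₁ hs]
  exact he.submatrix (by decide)

theorem cubic₂_posDef : ∃ e, (pencil (cubic₂ A s) e).PosDef := by
  obtain ⟨e, he⟩ := h.definite
  refine ⟨L e, ?_⟩
  rw [h.pencil_cubic₂ hs]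
  exact he.submatrix (by decide)

omit hs in
theorem complex_nodal {z : Fin 4 → ℂ} (hz : z ≠ 0)
    (hsing : IsSingularAt (pencilDet (complexify A)) z) :
    IsNodeAt (pencilDet (complexify A)) z ∧ (pencil (complexify A) z).rank = 2 := by
  have hn := h.transversal.1 z hz hsing
  exact ⟨hn, h.transversal.2 z hz hn⟩

omit hs in
theorem complex_center_hyperbolic : pencil (complexify A) (complexPoint p) = corner 0 0 1 := by
  have := h.complex_center
  simpa using this

theorem cubic₁_smooth {ζ : Fin 3 → ℂ} (hζ : ζ ≠ 0) :
    ¬ IsSingularAt (MvPolynomial.map (algebraMap ℝ ℂ) (pencilDet (cubic₁ A s))) ζ := by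
  intro hsing
  obtain ⟨z, hz, h1, h2⟩ := exists_critical_of_singular h.ker hs h.face₁_center hζ hsing
  exact face₁_smooth (complexify_isSymm h.symm) h.complex_center_hyperbolic h.node.2
    (fun z hz hs => h.complex_nodal hz hs) h.noLine hz h1 h2

theorem cubic₂_smooth {ζ : Fin 3 → ℂ} (hζ : ζ ≠ 0) :
    ¬ IsSingularAt (MvPolynomial.map (algebraMap ℝ ℂ) (pencilDet (cubic₂ A s))) ζ := by
  intro hsing
  obtain ⟨z, hz, h1, h2⟩ := exists_critical_of_singular h.ker hs h.face₂_center hζ hsing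
  exact face₂_smooth (complexify_isSymm h.symm) h.complex_center_hyperbolic h.node.2
    (fun z hz hs => h.complex_nodal hz hs) h.noLine hz h1 h2

theorem ramification_eq (v : Fin 4 → ℝ) : ramification A p v =
    4 * (MvPolynomial.eval (L v) (pencilDet (cubic₁ A s)) *
      MvPolynomial.eval (L v) (pencilDet (cubic₂ A s))) := by
  have h0 : alongLine (detForm A) p.rep v = restrict (pencilDet A) v p.rep := rfl
  rw [eval_pencilDet, eval_pencilDet, h.pencil_cubic₁ hs, h.pencil_cubic₂ hs, ramification, h0,
    restrict_through_node h.symm h.center]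
  simp only [Polynomial.coeff_add, Polynomial.coeff_C_mul, Polynomial.coeff_X_pow,
    Polynomial.coeff_C, Polynomial.coeff_X, linearCoeff]
  have := det_mul_det_lower (pencil_isSymm h.symm v)
  norm_num
  linear_combination 4 * this

/-- Over a point of both plane spectrahedra the lower block is definite, because otherwise a whole
line through the node would lie on the quartic. -/
theorem exists_lift {y : RP 2}
    (hy : y ∈ region (pencilₗ (cubic₁ A s)) ∩ region (pencilₗ (cubic₂ A s))) :
    ∃ (w : Fin 3 → ℝ) (hw : w ≠ 0), y = Projectivization.mk ℝ w hw ∧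
      (face₁ (pencil A (s w))).PosSemidef ∧ (face₂ (pencil A (s w))).PosSemidef ∧
      (lower (pencil A (s w))).PosDef := by
  obtain ⟨hy₁, hy₂⟩ := hy
  obtain ⟨w, hw, rfl, hpsd, -⟩ := exists_normalized (fun w hw => h.cubic₁_injective hs hw) hy₁
  rw [mem_region_mk, pencilₗ_apply] at hy₂
  rw [pencilₗ_apply] at hpsd
  rw [← hs w, h.pencil_cubic₁ hs] at hpsd
  rw [← hs w, h.pencil_cubic₂ hs] at hy₂
  have hLv : L (s w) ≠ 0 := by rwa [hs]
  set m := pencil A (s w) with hm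
  have hmsymm : m.IsSymm := pencil_isSymm h.symm _
  have hlow : (lower m).PosSemidef := by
    rw [← lower_face₁]
    exact hpsd.submatrix _
  have hpsd₂ : (face₂ m).PosSemidef := by
    rcases hy₂ with hy₂ | hy₂
    · exact hy₂
    · exfalso
      have h1 : (-(lower m)).PosSemidef := by
        rw [← lower_face₂]
        exact hy₂.submatrix ![1, 2]
      have h2 := h1.trace_nonneg
      rw [trace_neg] at h2
      have h3 := hlow.trace_nonneg
      exact h.lower_ne_zero hLv (hlow.trace_eq_zero_iff.1 (by linarith))
  have hdet : (lower m).det ≠ 0 := by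
    intro h0
    obtain ⟨h1, h2⟩ := det_eq_zero_of_faces hmsymm hpsd hpsd₂ h0
    exact h.coeffs_ne_zero hLv h1 (by rw [linearCoeff, h2]; ring) h0
  exact ⟨w, hw, rfl, hpsd, hpsd₂, posDef_of_det_ne_zero hlow hdet⟩

/-- The image of the spectrahedron is the intersection of the plane spectrahedra of the two
faces: over a point of the intersection, the Schur complement of the lower block becomes diagonal
for the right point on the line through the node. -/
theorem projImage_eq_inter : projImage L (spectrahedron A) =
    region (pencilₗ (cubic₁ A s)) ∩ region (pencilₗ (cubic₂ A s)) := by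
  have hsymm₁ : ∀ v, (pencilₗ (cubic₁ A s) v).IsSymm :=
    fun v => pencil_isSymm (descend_isSymm h.symm _) v
  have hsymm₂ : ∀ v, (pencilₗ (cubic₂ A s) v).IsSymm :=
    fun v => pencil_isSymm (descend_isSymm h.symm _) v
  refine Set.Subset.antisymm (projImage_subset
    ((isClosed_region hsymm₁).inter (isClosed_region hsymm₂)) fun x hx hLx => ?_) ?_
  · rw [Set.mem_inter_iff, mem_region_mk, mem_region_mk, pencilₗ_apply, pencilₗ_apply,
      h.pencil_cubic₁ hs, h.pencil_cubic₂ hs]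
    exact ⟨Semidef.submatrix hx _, Semidef.submatrix hx _⟩
  · intro y hy
    obtain ⟨w, hw, rfl, hpsd, hpsd₂, hpd⟩ := h.exists_lift hs hy
    have hdet := det_ne_zero_of_posDef hpd
    -- The multiple of the node that makes the mixed minor vanish.
    set m := pencil A (s w) with hm
    set t := -(mixed m).det / (lower m).det with ht
    set v := s w + t • p.rep with hv
    have hLv' : L v = w := by
      rw [hv, map_add, map_smul, map_rep_center h.ker, smul_zero, add_zero, hs]
    have hv0 : v ≠ 0 := by
      intro h0
      rw [h0, map_zero] at hLv'
      exact hw hLv'.symm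
    have hpv : pencil A v = m + t • corner 0 0 1 := by
      rw [hv, pencil_add, pencil_smul, h.center]
    have e1 : face₁ (m + t • corner 0 0 1) = face₁ m := by
      ext i j; fin_cases i <;> fin_cases j <;> simp [face₁, corner]
    have e2 : face₂ (m + t • corner 0 0 1) = face₂ m := by
      ext i j; fin_cases i <;> fin_cases j <;> simp [face₂, corner]
    have e3 : (mixed (m + t • corner 0 0 1)).det = 0 := by
      have : (mixed (m + t • corner 0 0 1)).det = (mixed m).det + t * (lower m).det := by
        rw [det_fin_three, det_fin_three, det_fin_two]
        simp [mixed, lower, corner]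
        ring
      rw [this, ht]
      field_simp
      ring
    have e4 : lower (m + t • corner 0 0 1) = lower m := by
      ext i j; fin_cases i <;> fin_cases j <;> simp [lower, corner]
    have hmem : Projectivization.mk ℝ v hv0 ∈ spectrahedron A := by
      rw [spectrahedron_eq_region, mem_region_mk, pencilₗ_apply]
      left
      refine posSemidef_of_schur (pencil_isSymm h.symm v) ?_ ?_ ?_ ?_
      · rwa [hpv, e4]
      · rw [hpv, e1]
        exact hpsd.det_nonneg
      · rw [hpv, e2]
        exact hpsd₂.det_nonneg
      · rw [hpv, e1, e2, e3, zero_pow two_ne_zero]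
        exact mul_nonneg hpsd.det_nonneg hpsd₂.det_nonneg
    refine mem_projImage hmem ⟨v, hv0, by rwa [hLv'], rfl, ?_⟩
    simp only [hLv']

theorem convHull_cubic₁_subset :
    region (pencilₗ (cubic₁ A s)) ⊆ convHull (tangentConic A p L) := by
  intro y hy
  rw [h.convHull_tangentConic hs]
  have h1 : Semidef (pencil (cubic₁ A s) y.rep) := hy
  change Semidef (pencil (descend A s ![2, 3]) y.rep)
  rw [← hs y.rep, h.pencil_cubic₁ hs] at h1
  rw [← hs y.rep, h.pencil_lower_section hs, ← lower_face₁]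
  exact h1.submatrix _

theorem convHull_cubic₂_subset :
    region (pencilₗ (cubic₂ A s)) ⊆ convHull (tangentConic A p L) := by
  intro y hy
  rw [h.convHull_tangentConic hs]
  have h1 : Semidef (pencil (cubic₂ A s) y.rep) := hy
  change Semidef (pencil (descend A s ![2, 3]) y.rep)
  rw [← hs y.rep, h.pencil_cubic₂ hs] at h1
  rw [← hs y.rep, h.pencil_lower_section hs, ← lower_face₂]
  exact h1.submatrix _

/-- The ramification cubics and their ovals; the factor `c` accounts for a change of basis. -/
theorem exists_ramification_cubics {c : ℝ} (hc : c ≠ 0) :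
    ∃ F₁ F₂ : MvPolynomial (Fin 3) ℝ, (IsSmoothCubic F₁ ∧ IsSmoothCubic F₂ ∧
      ∀ v, c * ramification A p v = MvPolynomial.eval (L v) F₁ * MvPolynomial.eval (L v) F₂) ∧
      ∃ O₁ O₂ : Set (RP 2), IsOval F₁ O₁ ∧ IsOval F₂ O₂ ∧
        projImage L (spectrahedron A) = convHull O₁ ∩ convHull O₂ ∧
        convHull O₁ ⊆ convHull (tangentConic A p L) ∧
        convHull O₂ ⊆ convHull (tangentConic A p L) := by
  obtain ⟨e₁, he₁⟩ := h.cubic₁_posDef hs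
  obtain ⟨e₂, he₂⟩ := h.cubic₂_posDef hs
  have hsymm₁ : ∀ i, (cubic₁ A s i).IsSymm := descend_isSymm h.symm _
  have hsymm₂ : ∀ i, (cubic₂ A s i).IsSymm := descend_isSymm h.symm _
  have hinj₁ : ∀ w, pencil (cubic₁ A s) w = 0 → w = 0 := fun w hw => h.cubic₁_injective hs hw
  have hinj₂ : ∀ w, pencil (cubic₂ A s) w = 0 → w = 0 := fun w hw => h.cubic₂_injective hs hw
  have hsm₁ := fun ζ hζ => h.cubic₁_smooth hs (ζ := ζ) hζ
  have hsm₂ := fun ζ hζ => h.cubic₂_smooth hs (ζ := ζ) hζ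
  have hc4 : 4 * c ≠ 0 := mul_ne_zero four_ne_zero hc
  have hconv₁ := convHull_boundary (B := pencilₗ (cubic₁ A s)) (fun v => pencil_isSymm hsymm₁ v)
    hinj₁ he₁
  have hconv₂ := convHull_boundary (B := pencilₗ (cubic₂ A s)) (fun v => pencil_isSymm hsymm₂ v)
    hinj₂ he₂
  refine ⟨MvPolynomial.C (4 * c) * pencilDet (cubic₁ A s),
    MvPolynomial.C 1 * pencilDet (cubic₂ A s),
    ⟨isSmoothCubic_C_mul hc4 hsm₁, isSmoothCubic_C_mul one_ne_zero hsm₂, fun v => ?_⟩,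
    boundary (pencilₗ (cubic₁ A s)), boundary (pencilₗ (cubic₂ A s)), ?_, ?_, ?_, ?_, ?_⟩
  · rw [h.ramification_eq hs, MvPolynomial.eval_mul, MvPolynomial.eval_mul, MvPolynomial.eval_C,
      MvPolynomial.eval_C]
    ring
  · refine isOval_boundary hsymm₁ hinj₁ he₁ (not_isSingularAt_real hsm₁) hc4 fun v => ?_
    rw [MvPolynomial.eval_mul, MvPolynomial.eval_C, eval_pencilDet]
  · refine isOval_boundary hsymm₂ hinj₂ he₂ (not_isSingularAt_real hsm₂) one_ne_zero fun v => ?_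
    rw [MvPolynomial.eval_mul, MvPolynomial.eval_C, eval_pencilDet]
  · rw [hconv₁, hconv₂]
    exact h.projImage_eq_inter hs
  · rw [hconv₁]
    exact h.convHull_cubic₁_subset hs
  · rw [hconv₂]
    exact h.convHull_cubic₂_subset hs

/-- Over the image of the spectrahedron the lower block is definite, which is an open condition. -/
theorem projImage_subset_interior :
    projImage L (spectrahedron A) ⊆ interior (convHull (tangentConic A p L)) := by
  set B : Fin 3 → Matrix (Fin 2) (Fin 2) ℝ := descend A s ![2, 3] with hB
  have hBs : ∀ i, (B i).IsSymm := descend_isSymm h.symm _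
  have hopen : IsOpen {y : RP 2 | 0 < (pencil B y.rep).det} := by
    refine isOpen_of_homogeneous (P := fun v => 0 < (pencil B v).det) (fun c hc v => ?_) ?_
    · rw [pencil_smul, det_smul]
      have : 0 < c ^ Fintype.card (Fin 2) := by
        rw [Fintype.card_fin]
        positivity
      exact mul_pos_iff_of_pos_left this
    · have hBc : Continuous (pencilₗ B) := (pencilₗ B).continuous_of_finiteDimensional
      have hBc' : Continuous fun v => pencil B v := hBc
      exact isOpen_lt continuous_const hBc'.matrix_det
  intro y hy
  rw [h.projImage_eq_inter hs] at hy
  rw [h.convHull_tangentConic hs]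
  refine mem_interior.2 ⟨{y : RP 2 | 0 < (pencil B y.rep).det},
    fun z hz => posSemidef_two (pencil_isSymm hBs _) (le_of_lt hz), hopen, ?_⟩
  obtain ⟨w, hw, rfl, -, -, hpd⟩ := h.exists_lift hs hy
  obtain ⟨c, hc, h1⟩ := exists_smul_rep _ w hw rfl
  rw [Set.mem_ofPred_eq, h1, pencil_smul, det_smul, Fintype.card_fin, ← hs w,
    h.pencil_lower_section hs]
  have := hpd.det_pos
  positivity

/-- Nodes on the boundary of the spectrahedron are sent to the boundary of its image, because
the restriction of a form of rank two to a face is singular. -/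
theorem mem_frontier_projImage {x : RP 3} (hx : IsRealNode A x) (hxp : x ≠ p)
    (hxS : x ∈ spectrahedron A) :
    ∃ y, ProjectsTo L x y ∧ y ∈ frontier (projImage L (spectrahedron A)) := by
  have hLx := (map_rep_ne_zero_iff h.ker).2 hxp
  refine ⟨_, projectsTo_mk hLx, subset_closure (mem_projImage hxS (projectsTo_mk hLx)), ?_⟩
  obtain ⟨e₁, he₁⟩ := h.cubic₁_posDef hs
  have hinj₁ : ∀ w, pencil (cubic₁ A s) w = 0 → w = 0 := fun w hw => h.cubic₁_injective hs hw
  rw [h.projImage_eq_inter hs]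
  refine fun hint => notMem_interior_of_mem_boundary (B := pencilₗ (cubic₁ A s)) hinj₁ he₁ ?_
    (interior_mono Set.inter_subset_left hint)
  rw [mem_boundary_mk, pencilₗ_apply, h.pencil_cubic₁ hs]
  exact ⟨Semidef.submatrix hxS _, (h.of_isRealNode hx).2.2 _ _⟩

end IsNormalForm

end Indefinite

/-! ### Normal form of the node -/

section Diagonalization

theorem congr_mul {M Q S : Matrix (Fin 4) (Fin 4) ℝ} :
    (Q * S)ᵀ * M * (Q * S) = Sᵀ * (Qᵀ * M * Q) * S := by
  rw [transpose_mul]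
  simp only [Matrix.mul_assoc]

/-- A diagonal form of rank two, supported on the first two coordinates, is congruent to a definite
form or to a hyperbolic plane. -/
theorem exists_congr_diagonal {a b : ℝ} (ha : a ≠ 0) (hb : b ≠ 0) :
    ∃ S : Matrix (Fin 4) (Fin 4) ℝ, S.det ≠ 0 ∧
      ((∃ ε : ℝ, ε * ε = 1 ∧ Sᵀ * corner a b 0 * S = corner ε ε 0) ∨
        Sᵀ * corner a b 0 * S = corner 0 0 1) := by
  have hsq : ∀ {a : ℝ}, a ≠ 0 → ∃ x σ : ℝ, x ≠ 0 ∧ (σ = 1 ∨ σ = -1) ∧ a * x ^ 2 = σ := by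
    intro a ha
    have h1 : 0 < |a| := abs_pos.2 ha
    refine ⟨(√|a|)⁻¹, SignType.sign a, by positivity, ?_, ?_⟩
    · rcases lt_or_gt_of_ne ha with h | h
      · right; simp [h]
      · left; simp [h]
    · rw [inv_pow, Real.sq_sqrt h1.le, ← div_eq_mul_inv, div_eq_iff h1.ne', sign_mul_abs]
  obtain ⟨x, σ, hx, hσ, hax⟩ := hsq ha
  obtain ⟨y, τ, hy, hτ, hby⟩ := hsq hb
  have hσ2 : σ * σ = 1 := by rcases hσ with h | h <;> rw [h] <;> norm_num
  by_cases hst : σ = τ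
  · refine ⟨diagonal ![x, y, 1, 1], ?_, .inl ⟨σ, hσ2, ?_⟩⟩
    · rw [det_diagonal, Fin.prod_univ_four]
      simp [hx, hy]
    · rw [diagonal_transpose]
      ext i j
      rw [mul_diagonal, diagonal_mul]
      fin_cases i <;> fin_cases j <;> simp [corner]
      · linear_combination hax
      · rw [hst]; linear_combination hby
  · have hτσ : τ = -σ := by
      rcases hσ with rfl | rfl <;> rcases hτ with rfl | rfl
      · exact absurd rfl hst
      · rfl
      · rw [neg_neg]
      · exact absurd rfl hst
    -- The columns are the isotropic vectors `(x, y)` and `(x, -y)`, the second one scaled by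
    -- `σ / 2` so that their product is `σ ^ 2 = 1`.
    refine ⟨!![x, σ / 2 * x, 0, 0; y, -(σ / 2) * y, 0, 0; 0, 0, 1, 0; 0, 0, 0, 1], ?_, .inr ?_⟩
    · rw [det_fin_four]
      simp
      have : σ ≠ 0 := by
        rintro rfl
        simp at hσ2
      intro h
      have h2 : x * y * σ = 0 := by linear_combination -h
      simp_all
    · rw [hτσ] at hby
      ext i j
      fin_cases i <;> fin_cases j <;>
        simp [corner, Matrix.mul_apply, Fin.sum_univ_four]
      · linear_combination hax + hby
      · linear_combination σ / 2 * hax - σ / 2 * hby + hσ2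
      · linear_combination σ / 2 * hax - σ / 2 * hby + hσ2
      · linear_combination σ ^ 2 / 4 * (hax + hby)

/-- Symmetric forms of rank two in four variables are congruent to a definite binary form or to a
hyperbolic plane. -/
theorem exists_congr_corner {M : Matrix (Fin 4) (Fin 4) ℝ} (hM : M.IsSymm) (hr : M.rank = 2) :
    ∃ Q : Matrix (Fin 4) (Fin 4) ℝ, Q.det ≠ 0 ∧
      ((∃ ε : ℝ, ε * ε = 1 ∧ Qᵀ * M * Q = corner ε ε 0) ∨ Qᵀ * M * Q = corner 0 0 1) := by
  have hH := isHermitian_of_isSymm hM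
  set U : Matrix (Fin 4) (Fin 4) ℝ := hH.eigenvectorUnitary.1 with hU
  have hUU : Uᵀ * U = 1 := by
    have := Unitary.coe_star_mul_self hH.eigenvectorUnitary
    rwa [star_eq_conjTranspose, conjTranspose_eq_transpose_of_trivial] at this
  have hUdet : U.det ≠ 0 := by
    intro h0
    have := congrArg det hUU
    rw [det_mul, h0, mul_zero, det_one] at this
    exact zero_ne_one this
  have hdiag : Uᵀ * M * U = diagonal hH.eigenvalues := by
    have := hH.conjStarAlgAut_star_eigenvectorUnitary
    rw [Unitary.conjStarAlgAut_star_apply, star_eq_conjTranspose,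
      conjTranspose_eq_transpose_of_trivial] at this
    exact this
  have hcard := hH.rank_eq_card_non_zero_eigs
  rw [hr, Fintype.card_subtype] at hcard
  obtain ⟨i, j, hij, hset⟩ := Finset.card_eq_two.1 hcard.symm
  have hmem : ∀ k, hH.eigenvalues k ≠ 0 ↔ k = i ∨ k = j := by
    intro k
    have : k ∈ ({k | hH.eigenvalues k ≠ 0} : Finset (Fin 4)) ↔ k ∈ ({i, j} : Finset (Fin 4)) := by
      rw [hset]
    simpa using this
  obtain ⟨σ, h0, h1⟩ : ∃ σ : Equiv.Perm (Fin 4), σ 0 = i ∧ σ 1 = j := by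
    clear hset hmem
    revert i j
    decide
  have hperm : (U.submatrix id σ)ᵀ * M * U.submatrix id σ =
      corner (hH.eigenvalues i) (hH.eigenvalues j) 0 := by
    have h2 : (U.submatrix id σ)ᵀ * M * U.submatrix id σ = (Uᵀ * M * U).submatrix σ σ := by
      ext k l
      simp [Matrix.mul_apply]
    have hz : ∀ k, k ≠ 0 → k ≠ 1 → hH.eigenvalues (σ k) = 0 := by
      intro k hk0 hk1
      by_contra hne
      rcases (hmem _).1 hne with h | h
      · exact hk0 (σ.injective (h.trans h0.symm))
      · exact hk1 (σ.injective (h.trans h1.symm))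
    rw [h2, hdiag, submatrix_diagonal_equiv, ← h0, ← h1]
    ext k l
    fin_cases k <;> fin_cases l <;> simp [corner, hz]
  obtain ⟨S, hS, hcase⟩ := exists_congr_diagonal ((hmem i).2 (.inl rfl)) ((hmem j).2 (.inr rfl))
  refine ⟨U.submatrix id σ * S, ?_, ?_⟩
  · rw [det_mul, det_permute']
    refine mul_ne_zero (mul_ne_zero ?_ hUdet) hS
    simp
  · rw [congr_mul, hperm]
    exact hcase

end Diagonalization

/-! ### Change of basis -/

section Transfer

/-- The linear system `A` in the basis given by the columns of `Q`. -/
def changeBasis {K : Type*} [Field K] (A : Fin 4 → Matrix (Fin 4) (Fin 4) K)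
    (Q : Matrix (Fin 4) (Fin 4) K) (i : Fin 4) : Matrix (Fin 4) (Fin 4) K := Qᵀ * A i * Q

theorem pencil_changeBasis {K : Type*} [Field K] (A : Fin 4 → Matrix (Fin 4) (Fin 4) K)
    (Q : Matrix (Fin 4) (Fin 4) K) (v : Fin 4 → K) :
    pencil (changeBasis A Q) v = Qᵀ * pencil A v * Q := by
  simp only [pencil, changeBasis, Matrix.mul_sum, Matrix.sum_mul, Matrix.mul_smul, Matrix.smul_mul]

theorem pencilDet_changeBasis {K : Type*} [Field K] (A : Fin 4 → Matrix (Fin 4) (Fin 4) K)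
    (Q : Matrix (Fin 4) (Fin 4) K) :
    pencilDet (changeBasis A Q) = MvPolynomial.C (Q.det ^ 2) * pencilDet A := by
  have h : ∑ i, (MvPolynomial.X i : MvPolynomial (Fin 4) K) •
      (changeBasis A Q i).map (MvPolynomial.C (σ := Fin 4)) =
      (Q.map (MvPolynomial.C (σ := Fin 4)))ᵀ *
        (∑ i, (MvPolynomial.X i : MvPolynomial (Fin 4) K) •
          (A i).map (MvPolynomial.C (σ := Fin 4))) * Q.map (MvPolynomial.C (σ := Fin 4)) := by
    simp only [changeBasis, Matrix.mul_sum, Matrix.sum_mul, Matrix.mul_smul, Matrix.smul_mul,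
      Matrix.map_mul, transpose_map]
  have hd : (Q.map (MvPolynomial.C (σ := Fin 4))).det = MvPolynomial.C Q.det :=
    (RingHom.map_det MvPolynomial.C Q).symm
  rw [pencilDet, h, det_mul, det_mul, det_transpose, hd, pencilDet, map_pow]
  ring

theorem complexify_changeBasis (A : Fin 4 → Matrix (Fin 4) (Fin 4) ℝ)
    (Q : Matrix (Fin 4) (Fin 4) ℝ) :
    complexify (changeBasis A Q) = changeBasis (complexify A) (Q.map (algebraMap ℝ ℂ)) := by
  funext i
  simp only [complexify, changeBasis, Matrix.map_mul, transpose_map]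

section Scale

variable {n : ℕ} {K : Type*} [Field K] {c : K} (hc : c ≠ 0)

theorem hessian_C_mul (F : MvPolynomial (Fin n) K) (z : Fin n → K) :
    hessian (MvPolynomial.C c * F) z = c • hessian F z := by
  ext i j
  simp [hessian]

include hc

theorem isSingularAt_C_mul (F : MvPolynomial (Fin n) K) (z : Fin n → K) :
    IsSingularAt (MvPolynomial.C c * F) z ↔ IsSingularAt F z := by
  simp [IsSingularAt, hc]

theorem isNodeAt_C_mul (F : MvPolynomial (Fin 4) K) (z : Fin 4 → K) :
    IsNodeAt (MvPolynomial.C c * F) z ↔ IsNodeAt F z := by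
  have hrank : (c • hessian F z).rank = (hessian F z).rank := by
    exact rank_smul_of_mem_nonZeroDivisors _ (mem_nonZeroDivisors_of_ne_zero hc)
  rw [IsNodeAt, isSingularAt_C_mul hc, hessian_C_mul, hrank, IsNodeAt]

end Scale

variable {A : Fin 4 → Matrix (Fin 4) (Fin 4) ℝ} {Q : Matrix (Fin 4) (Fin 4) ℝ}

theorem alongLine_changeBasis (p v : Fin 4 → ℝ) :
    alongLine (detForm (changeBasis A Q)) p v =
      Polynomial.C (Q.det ^ 2) * alongLine (detForm A) p v := by
  rw [detForm_eq_pencilDet, pencilDet_changeBasis, alongLine, map_mul]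
  congr 1
  simp

theorem coneForm_changeBasis (p : RP 3) (v : Fin 4 → ℝ) :
    coneForm (changeBasis A Q) p v = Q.det ^ 2 * coneForm A p v := by
  rw [coneForm, alongLine_changeBasis, Polynomial.coeff_C_mul, coneForm]

theorem ramification_changeBasis (p : RP 3) (v : Fin 4 → ℝ) :
    ramification (changeBasis A Q) p v = Q.det ^ 4 * ramification A p v := by
  simp only [ramification, alongLine_changeBasis, Polynomial.coeff_C_mul]
  ring

variable (hQ : Q.det ≠ 0)

include hQ

theorem semidef_congr_iff {M : Matrix (Fin 4) (Fin 4) ℝ} :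
    Semidef (Qᵀ * M * Q) ↔ Semidef M := by
  have hu : IsUnit Q := (isUnit_iff_isUnit_det _).2 (isUnit_iff_ne_zero.2 hQ)
  have h : ∀ N : Matrix (Fin 4) (Fin 4) ℝ, (Qᵀ * N * Q).PosSemidef ↔ N.PosSemidef := by
    intro N
    have := hu.posSemidef_star_left_conjugate_iff (x := N)
    rwa [star_eq_conjTranspose, conjTranspose_eq_transpose_of_trivial] at this
  rw [Semidef, Semidef, h, ← h (-M)]
  simp

theorem spectrahedron_changeBasis : spectrahedron (changeBasis A Q) = spectrahedron A := by
  ext x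
  change Semidef (pencil (changeBasis A Q) x.rep) ↔ Semidef (pencil A x.rep)
  rw [pencil_changeBasis, semidef_congr_iff hQ]

theorem tangentConic_changeBasis (p : RP 3) (L : (Fin 4 → ℝ) →ₗ[ℝ] (Fin 3 → ℝ)) :
    tangentConic (changeBasis A Q) p L = tangentConic A p L := by
  ext y
  simp [tangentConic, coneForm_changeBasis, hQ]

theorem det_map_ne_zero : (Q.map (algebraMap ℝ ℂ)).det ^ 2 ≠ 0 := by
  rw [det_map_algebraMap]
  exact pow_ne_zero _ (by exact_mod_cast hQ)

theorem isNodeAt_changeBasis (z : Fin 4 → ℂ) :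
    IsNodeAt (detForm (complexify (changeBasis A Q))) z ↔ IsNodeAt (detForm (complexify A)) z := by
  rw [complexify_changeBasis, detForm_eq_pencilDet, pencilDet_changeBasis,
    isNodeAt_C_mul (det_map_ne_zero hQ), detForm_eq_pencilDet]

theorem isRealNode_changeBasis (x : RP 3) :
    IsRealNode (changeBasis A Q) x ↔ IsRealNode A x := isNodeAt_changeBasis hQ _

theorem isTransversal_changeBasis (h : IsTransversal A) : IsTransversal (changeBasis A Q) := by
  refine ⟨fun z hz hs => ?_, fun z hz hn => ?_⟩
  · rw [isNodeAt_changeBasis hQ]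
    refine h.1 z hz ?_
    rwa [complexify_changeBasis, detForm_eq_pencilDet, pencilDet_changeBasis,
      isSingularAt_C_mul (det_map_ne_zero hQ)] at hs
  · have h1 := h.2 z hz ((isNodeAt_changeBasis hQ z).1 hn)
    have h2 : linMat (complexify (changeBasis A Q)) z = (Q.map (algebraMap ℝ ℂ))ᵀ *
        linMat (complexify A) z * Q.map (algebraMap ℝ ℂ) := by
      rw [complexify_changeBasis]
      exact pencil_changeBasis _ _ _
    have hd : (Q.map (algebraMap ℝ ℂ)).det ≠ 0 := fun h0 => det_map_ne_zero hQ (by rw [h0]; simp)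
    rw [h2, rank_mul_eq_left_of_isUnit_det _ _ (isUnit_iff_ne_zero.2 hd),
      rank_mul_eq_right_of_isUnit_det _ _ (by rw [det_transpose]; exact isUnit_iff_ne_zero.2 hd),
      h1]

theorem noLineThrough_changeBasis {p : RP 3} (h : NoLineThrough A p) :
    NoLineThrough (changeBasis A Q) p := by
  intro z hz
  obtain ⟨s, t, hst⟩ := h z hz
  refine ⟨s, t, ?_⟩
  rw [complexify_changeBasis, detForm_eq_pencilDet, pencilDet_changeBasis, map_mul,
    MvPolynomial.eval_C]
  exact mul_ne_zero (det_map_ne_zero hQ) hst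

end Transfer

/-- A spectrahedron with interior points contains a definite form, because the quartic does not
vanish identically. -/
theorem exists_posDef {A : Fin 4 → Matrix (Fin 4) (Fin 4) ℝ}
    (hfull : (interior (spectrahedron A)).Nonempty) {p : RP 3} (hnode : IsRealNode A p) :
    ∃ e, (pencil A e).PosDef := by
  have hne : pencilDet A ≠ 0 := by
    intro h0
    have h1 : detForm (complexify A) = 0 := by
      have := map_pencilDet (algebraMap ℝ ℂ) A
      rw [h0, map_zero] at this
      exact this.symm
    have h2 := hnode.2
    have h3 : hessian (detForm (complexify A)) (complexPoint p) = 0 := by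
      rw [h1]
      ext i j
      simp [hessian]
    rw [h3, rank_zero] at h2
    norm_num at h2
  obtain ⟨w, hw⟩ : ∃ w, MvPolynomial.eval w (pencilDet A) ≠ 0 := by
    by_contra! h
    exact hne (MvPolynomial.funext fun w => by rw [h, map_zero])
  obtain ⟨x, hx⟩ := hfull
  have hopen := isOpen_cone (isOpen_interior (s := spectrahedron A))
  set P := restrict (pencilDet A) x.rep (w - x.rep) with hP
  have hP0 : P ≠ 0 := by
    intro h0
    have := eval_restrict (pencilDet A) x.rep (w - x.rep) 1
    rw [← hP, h0, one_smul, add_sub_cancel, Polynomial.eval_zero] at this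
    exact hw this.symm
  have hcont : Continuous fun t : ℝ => x.rep + t • (w - x.rep) := by fun_prop
  have hnhds := (hopen.preimage hcont).mem_nhds (x := 0) (by
    simp only [Set.mem_preimage, zero_smul, add_zero]
    exact ⟨x.rep_nonzero, by rwa [x.mk_rep]⟩)
  obtain ⟨t, ⟨ht, hmem⟩, hroot⟩ :=
    ((infinite_of_mem_nhds 0 hnhds).sdiff (Polynomial.finite_setOfPred_isRoot hP0)).nonempty
  have h1 : (Projectivization.mk ℝ _ ht : RP 3) ∈ region (pencilₗ A) := interior_subset hmem
  rw [mem_region_mk, pencilₗ_apply] at h1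
  have h2 : (pencil A (x.rep + t • (w - x.rep))).det ≠ 0 := by
    rw [← eval_pencilDet, ← eval_restrict]
    exact hroot
  rcases h1 with h1 | h1
  · exact ⟨_, posDef_of_det_ne_zero h1 h2⟩
  · refine ⟨(-1 : ℝ) • (x.rep + t • (w - x.rep)), ?_⟩
    rw [pencil_smul, neg_one_smul]
    exact posDef_of_det_ne_zero h1 (by rw [det_neg]; simpa using h2)

/-- A basis in which the form at the node is a nondegenerate upper left block puts the system into
normal form. -/
theorem isNormalForm_changeBasis {A : Fin 4 → Matrix (Fin 4) (Fin 4) ℝ} (hA : ∀ i, (A i).IsSymm)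
    (hfull : (interior (spectrahedron A)).Nonempty) (htrans : IsTransversal A) {p : RP 3}
    (hnode : IsRealNode A p) (hline : NoLineThrough A p)
    {L : (Fin 4 → ℝ) →ₗ[ℝ] (Fin 3 → ℝ)} (hL : LinearMap.ker L = p.submodule)
    {Q : Matrix (Fin 4) (Fin 4) ℝ} (hQ : Q.det ≠ 0) {d₁ d₂ d₃ : ℝ}
    (hd : d₁ * d₂ - d₃ ^ 2 ≠ 0) (hcorner : Qᵀ * pencil A p.rep * Q = corner d₁ d₂ d₃) :
    IsNormalForm (changeBasis A Q) p L d₁ d₂ d₃ where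
  symm i := by
    rw [changeBasis, IsSymm, transpose_mul, transpose_mul, transpose_transpose, (hA i).eq,
      Matrix.mul_assoc]
  center := by rw [pencil_changeBasis, hcorner]
  nondeg := hd
  ker := hL
  definite := by
    obtain ⟨e, he⟩ := exists_posDef hfull hnode
    refine ⟨e, ?_⟩
    rw [pencil_changeBasis]
    have hu : IsUnit Q := (isUnit_iff_isUnit_det _).2 (isUnit_iff_ne_zero.2 hQ)
    have := (hu.posDef_star_left_conjugate_iff (x := pencil A e)).2 he
    rwa [star_eq_conjTranspose, conjTranspose_eq_transpose_of_trivial] at this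
  transversal := isTransversal_changeBasis hQ htrans
  node := (isRealNode_changeBasis hQ p).2 hnode
  noLine := noLineThrough_changeBasis hQ hline

end QSpec

theorem proposition4p1
    (A : Fin 4 → Matrix (Fin 4) (Fin 4) ℝ) (hA : ∀ i, (A i).IsSymm)
    (hfull : (interior (spectrahedron A)).Nonempty)
    (htrans : IsTransversal A)
    (p : RP 3) (hnode : IsRealNode A p) (hrank : (linMat A p.rep).rank = 2)
    (hline : NoLineThrough A p)
    (L : (Fin 4 → ℝ) →ₗ[ℝ] (Fin 3 → ℝ)) (hL : LinearMap.ker L = p.submodule) :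
    (∀ x ∈ spectrahedron A, InsideCone A p L x) ∧
    (p ∈ spectrahedron A →
      projImage L (spectrahedron A) = convHull (tangentConic A p L) ∧
      (∀ x, IsRealNode A x → x ≠ p → x ∈ frontier (spectrahedron A) → InsideCone A p L x) ∧
      (∀ x, IsRealNode A x → x ∉ spectrahedron A → ¬ InsideCone A p L x)) ∧
    (p ∉ spectrahedron A →
      (∃ F₁ F₂ : MvPolynomial (Fin 3) ℝ, AreRamificationCubics A p L F₁ F₂ ∧
        ∃ O₁ O₂ : Set (RP 2), IsOval F₁ O₁ ∧ IsOval F₂ O₂ ∧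
          projImage L (spectrahedron A) = convHull O₁ ∩ convHull O₂ ∧
          convHull O₁ ⊆ convHull (tangentConic A p L) ∧
          convHull O₂ ⊆ convHull (tangentConic A p L)) ∧
      projImage L (spectrahedron A) ⊆ interior (convHull (tangentConic A p L)) ∧
      (∀ x, IsRealNode A x → x ∈ frontier (spectrahedron A) →
        ∃ y, ProjectsTo L x y ∧ y ∈ frontier (projImage L (spectrahedron A))) ∧
      (∀ x, IsRealNode A x → x ∉ spectrahedron A → x ≠ p →
        ∃ y, ProjectsTo L x y ∧ y ∉ convHull (tangentConic A p L))) := by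
  obtain ⟨Q, hQ, hcase⟩ := exists_congr_corner (pencil_isSymm hA p.rep) hrank
  have hS := spectrahedron_changeBasis (A := A) hQ
  have hC := tangentConic_changeBasis (A := A) hQ p L
  have hI : ∀ x, InsideCone (changeBasis A Q) p L x ↔ InsideCone A p L x := by
    intro x
    rw [InsideCone, InsideCone, hC]
  have hN := fun x => isRealNode_changeBasis (A := A) hQ x
  have hpS : p ∈ spectrahedron A ↔ Semidef (Q.transpose * pencil A p.rep * Q) :=
    (semidef_congr_iff hQ).symm
  rcases hcase with ⟨ε, hε, hcorner⟩ | hcorner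
  · -- The form at the node is semidefinite.
    have h := isNormalForm_changeBasis hA hfull htrans hnode hline hL hQ
      (by rw [hε]; norm_num) hcorner
    have hp : p ∈ spectrahedron A := by
      rw [hpS, hcorner]
      have h1 : corner ε ε 0 = ε • Matrix.diagonal ![1, 1, 0, 0] := by
        ext i j
        fin_cases i <;> fin_cases j <;> simp [corner]
      rw [h1]
      refine Semidef.smul (.inl (Matrix.PosSemidef.diagonal ?_)) ε
      intro i
      fin_cases i <;> simp
    have hin : ∀ x ∈ spectrahedron A, InsideCone A p L x := fun x hx =>
      (hI x).1 (h.insideCone_of_mem (by rwa [hS]))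
    refine ⟨hin, fun _ => ⟨?_, fun x _ _ hx => ?_, fun x hx hxS => ?_⟩, fun hp' => absurd hp hp'⟩
    · have := h.projImage_eq hε
      rwa [hS, hC] at this
    · exact hin x (IsNormalForm.frontier_subset_spectrahedron hA hx)
    · rw [← hI]
      refine h.not_insideCone ((hN x).2 hx) ?_ (by rwa [hS])
      rintro rfl
      exact hxS hp
  · -- The form at the node is a hyperbolic plane.
    have h := isNormalForm_changeBasis hA hfull htrans hnode hline hL hQ
      (by norm_num) hcorner
    obtain ⟨s, hs⟩ := exists_section hL
    have hp : p ∉ spectrahedron A := by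
      rw [hpS, hcorner]
      intro hsd
      have h1 : ∀ M : Matrix (Fin 4) (Fin 4) ℝ, M.PosSemidef → (M = corner 0 0 1 ∨
          M = -corner 0 0 1) → False := by
        intro M hM hcases
        have h2 := (hM.submatrix ![0, 1]).det_nonneg
        rw [Matrix.det_fin_two] at h2
        rcases hcases with rfl | rfl <;> simp [corner] at h2 <;> linarith
      rcases hsd with h2 | h2
      · exact h1 _ h2 (.inl rfl)
      · exact h1 _ h2 (.inr rfl)
    refine ⟨fun x hx => (hI x).1 (h.insideCone_of_mem (by rwa [hS])),
      fun hp' => absurd hp' hp, fun _ => ⟨?_, ?_, fun x hx hxS => ?_, fun x hx hxS hxp => ?_⟩⟩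
    · have hQ4 : Q.det ^ 4 ≠ 0 := pow_ne_zero _ hQ
      obtain ⟨F₁, F₂, ⟨hF₁, hF₂, hram⟩, O₁, O₂, hO⟩ :=
        h.exists_ramification_cubics hs (inv_ne_zero hQ4)
      rw [hS, hC] at hO
      refine ⟨F₁, F₂, ⟨hF₁, hF₂, fun v => ?_⟩, O₁, O₂, hO⟩
      rw [← hram, ramification_changeBasis, inv_mul_cancel_left₀ hQ4]
    · have := h.projImage_subset_interior hs
      rwa [hS, hC] at this
    · have hxS' := IsNormalForm.frontier_subset_spectrahedron hA hxS
      have := h.mem_frontier_projImage hs ((hN x).2 hx) (by rintro rfl; exact hp hxS')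
        (by rwa [hS])
      rwa [hS] at this
    · have hLx := (map_rep_ne_zero_iff hL).2 hxp
      refine ⟨_, projectsTo_mk hLx, fun hy => ?_⟩
      exact h.not_insideCone ((hN x).2 hx) hxp (by rwa [hS])
        ((hI x).2 (.inr ⟨_, projectsTo_mk hLx, hy⟩))
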